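/- Let $K$ be a field and $Q$ a finite quiver with vertex set $I$; write $t(a)$, $h(a)$ for the tail and head of an arrow $a$. Let $\overline{Q}$ be the double of $Q$, obtained by adjoining a reverse arrow $a^*:j\to i$ for each arrow $a:i\to j$ of $Q$; put $(a^*)^*=a$, and $\epsilon(a)=1$ for $a$ in $Q$, $\epsilon(a)=-1$ for the adjoined arrows. For a weight $\lambda\in K^I$ let $$\Pi^\lambda=K\overline{Q}\Big/\Big(\sum_{a\in\overline{Q}}\epsilon(a)aa^*-\sum_{i\in I}\lambda_ie_i\Big)$$ be the deformed preprojective algebra. The category $\operatorname{Mod}\Pi^\lambda$ of left modules is identified, via $V_i=e_iM$ and $V_a=(a\cdot)$, with the category of families of vector spaces $V_i$ ($i\in I$) and linear maps $V_a:V_{t(a)}\to V_{h(a)}$ ($a\in\overline{Q}$) such that $\sum_{h(a)=i}\epsilon(a)V_aV_{a^*}=\lambda_i\,\mathrm{id}_{V_i}$ for all $i$. For a vertex $i$ that is loop-free (no arrow of $Q$ has both head and tail $i$), let $(r_i\lambda)_j=\lambda_j-(\epsilon_i,\epsilon_j)\lambda_i$, where $(\alpha,\beta)=\langle\alpha,\beta\rangle+\langle\beta,\alpha\rangle$,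 $\langle\alpha,\beta\rangle=\sum_{k\in I}\alpha_k\beta_k-\sum_{a\in Q}\alpha_{t(a)}\beta_{h(a)}$ on $\mathbb{Z}^I$, and $\epsilon_i$ is the $i$-th coordinate vector. For $V\in\operatorname{Mod}\Pi^\lambda$ let $V_\oplus=\bigoplus_{h(a)=i}V_{t(a)}$ (sum over arrows $a$ of $\overline{Q}$), with canonical injections $\mu_a$ and projections $\pi_a$, and let $\mu=\sum_{h(a)=i}\mu_aV_{a^*}:V_i\to V_\oplus$ and $\pi=\sum_{h(a)=i}\epsilon(a)V_a\pi_a:V_\oplus\to V_i$, so that $\pi\mu=\lambda_i\,\mathrm{id}$. The reflection functors $$C_i=C_i^\lambda,\quad K_i=K_i^\lambda:\ \operatorname{Mod}\Pi^\lambda\to\operatorname{Mod}\Pi^{r_i\lambda}$$ are as follows. Both leave $V_j$ for $j\ne i$ and $V_a$ for $h(a)\ne i\ne t(a)$ unchanged. One sets $C_i(V)_i=\operatorname{Coker}\mu$, with projection $c:V_\oplus\to\operatorname{Coker}\mu$ and the map $\gamma:\operatorname{Coker}\mu\to V_\oplus$ determined by $\gamma c=\mu\pi-\lambda_i\,\mathrm{id}$,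 and $C_i(V)_a=\epsilon(a)c\mu_a$ if $h(a)=i$, $C_i(V)_a=\pi_{a^*}\gamma$ if $t(a)=i$. One sets $K_i(V)_i=\operatorname{Ker}\pi$, with inclusion $\iota:\operatorname{Ker}\pi\to V_\oplus$ and the map $\gamma:V_\oplus\to\operatorname{Ker}\pi$ determined by $\iota\gamma=\mu\pi-\lambda_i\,\mathrm{id}$, and $K_i(V)_a=\epsilon(a)\gamma\mu_a$ if $h(a)=i$, $K_i(V)_a=\pi_{a^*}\iota$ if $t(a)=i$. On morphisms both functors act by the induced maps. Theorem. Let $i$ and $j$ be loop-free vertices of $Q$ and let $\lambda\in K^I$ be arbitrary. (i) If there is no arrow between $i$ and $j$ in $Q$ (in either direction), then $r_ir_j\lambda=r_jr_i\lambda$, and there are isomorphisms of functors $$C_i^{r_j\lambda}C_j^{\lambda}\cong C_j^{r_i\lambda}C_i^{\lambda},\qquad K_i^{r_j\lambda}K_j^{\lambda}\cong K_j^{r_i\lambda}K_i^{\lambda}.$$ (ii) If there is exactly one arrow between $i$ and $j$ in $Q$ (counting both directions), then $r_ir_jr_i\lambda=r_jr_ir_j\lambda$, and there are isomorphisms of functors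 $$C_i^{r_jr_i\lambda}C_j^{r_i\lambda}C_i^{\lambda}\cong C_j^{r_ir_j\lambda}C_i^{r_j\lambda}C_j^{\lambda},\qquad K_i^{r_jr_i\lambda}K_j^{r_i\lambda}K_i^{\lambda}\cong K_j^{r_ir_j\lambda}K_i^{r_j\lambda}K_j^{\lambda}.$$ -/

import Mathlib

open CategoryTheory

universe u v w

set_option linter.unusedSectionVars false

noncomputable section

namespace DefPreproj

/-! ### The double of a quiver

`I` is the vertex set of the quiver `Q`, and `i ⟶ j` is the set of arrows of `Q` with tail `i`
and head `j`. The double of `Q` is Mathlib's `Quiver.Symmetrify I`. -/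

section Quiver

variable {I : Type u} [Quiver.{u} I]

/-- Arrows of the double quiver with tail `i` and head `j`. -/
abbrev DArr (i j : I) : Type u := (i ⟶ j) ⊕ (j ⟶ i)

/-- The involution `a ↦ a*` on the arrows of the double. -/
abbrev rev {i j : I} (a : DArr i j) : DArr j i := a.swap

/-- The sign `ε(a)`: it is `1` on arrows of `Q` and `-1` on the adjoined reverse arrows. -/
def eps (K : Type v) [Field K] {i j : I} : DArr i j → K
  | .inl _ => 1
  | .inr _ => -1

/-- The arrows of the double with head `i`, each given as a pair (tail, arrow). -/
abbrev InArr (i : I) : Type u := Σ j : I, DArr j i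

/-- A vertex is loop-free if no arrow has both head and tail there. -/
def LoopFree (i : I) : Prop := IsEmpty (i ⟶ i)

/-- The number of arrows of `Q` between `i` and `j`, in either direction (for `i ≠ j`). -/
def numArrows (i j : I) [Fintype (i ⟶ j)] [Fintype (j ⟶ i)] : ℕ :=
  Fintype.card (i ⟶ j) + Fintype.card (j ⟶ i)

/-- The paths of the double quiver, including the trivial ones, as triples (start, end, path). -/
abbrev DPath (I : Type u) [Quiver.{u} I] : Type u :=
  Σ (i j : Quiver.Symmetrify I), Quiver.Path i j

/-- The trivial path at `i`. -/
def DPath.triv (i : I) : DPath I := ⟨i, i, Quiver.Path.nil⟩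

/-- The path of length one given by an arrow of the double. -/
def DPath.arr {i j : I} (a : DArr i j) : DPath I :=
  ⟨i, j, Quiver.Hom.toPath (V := Quiver.Symmetrify I) a⟩

end Quiver

/-! ### The path algebra of the double and the deformed preprojective algebra -/

section PathAlgebra

instance {I : Type u} [DecidableEq I] : DecidableEq (Quiver.Symmetrify I) :=
  inferInstanceAs (DecidableEq I)

variable (K : Type v) [Field K] (I : Type u) [Quiver.{u} I]

/-- The path algebra of the double quiver: the vector space with basis the set of paths. -/
def PathAlg : Type (max u v) := DPath I →₀ K

instance : AddCommGroup (PathAlg K I) := inferInstanceAs (AddCommGroup (DPath I →₀ K))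
instance : Module K (PathAlg K I) := inferInstanceAs (Module K (DPath I →₀ K))

variable {I} in
/-- The basis of the path algebra given by the paths. -/
def pathBasis : Module.Basis (DPath I) K (PathAlg K I) :=
  Module.Basis.ofRepr (LinearEquiv.refl K (DPath I →₀ K))

variable {I}

/-- The product of two paths in the path algebra: `p q` means first `q` and then `p`, and the
product is `0` if `q` does not end where `p` starts. -/
def pathMul [DecidableEq I] (p q : DPath I) : PathAlg K I :=
  if h : q.2.1 = p.1 then pathBasis K ⟨q.1, p.2.1, q.2.2.comp (p.2.2.cast h.symm rfl)⟩ else 0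

/-- The bilinear extension of the product of paths. -/
def pathMulLin [DecidableEq I] : PathAlg K I →ₗ[K] PathAlg K I →ₗ[K] PathAlg K I :=
  (pathBasis K).constr K fun p => (pathBasis K).constr K fun q => pathMul K p q

variable {K}

theorem pathMulLin_basis [DecidableEq I] (p q : DPath I) :
    pathMulLin K (pathBasis K p) (pathBasis K q) = pathMul K p q := by
  simp [pathMulLin, Module.Basis.constr_basis]

theorem pathMulLin_assoc [DecidableEq I] (x y z : PathAlg K I) :
    pathMulLin K (pathMulLin K x y) z = pathMulLin K x (pathMulLin K y z) := by
  have h : (pathMulLin K).compr₂ (pathMulLin K) =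
      ((LinearMap.llcomp K (PathAlg K I) (PathAlg K I) (PathAlg K I)).comp
        (pathMulLin K)).compl₂ (pathMulLin K) := by
    refine (pathBasis K).ext fun p => (pathBasis K).ext fun q => (pathBasis K).ext fun r => ?_
    obtain ⟨p₁, p₂, p⟩ := p
    obtain ⟨q₁, q₂, q⟩ := q
    obtain ⟨r₁, r₂, r⟩ := r
    simp only [LinearMap.compr₂_apply, LinearMap.compl₂_apply, LinearMap.comp_apply,
      LinearMap.llcomp_apply, pathMulLin_basis]
    unfold pathMul
    by_cases h1 : q₂ = p₁ <;> by_cases h2 : r₂ = q₁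
    · subst h1 h2
      simp [pathMulLin_basis, pathMul]
    · subst h1
      simp [pathMulLin_basis, pathMul, h2]
    · subst h2
      simp [pathMulLin_basis, pathMul, h1]
    · simp [h1, h2]
  exact LinearMap.congr_fun (LinearMap.congr_fun (LinearMap.congr_fun h x) y) z

variable [Fintype I] [DecidableEq I]

variable (K I) in
/-- The unit of the path algebra, the sum of the trivial paths. -/
def pathOne : PathAlg K I := ∑ i : I, pathBasis K (DPath.triv i)

theorem pathMulLin_one_left (x : PathAlg K I) : pathMulLin K (pathOne K I) x = x := by
  have h : pathMulLin K (pathOne K I) = LinearMap.id := by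
    refine (pathBasis K).ext fun p => ?_
    obtain ⟨p₁, p₂, p⟩ := p
    simp only [pathOne, map_sum, LinearMap.sum_apply, pathMulLin_basis, LinearMap.id_apply]
    refine (Finset.sum_eq_single (M := PathAlg K I) (p₂ : I) ?_ ?_).trans ?_
    · intro b _ hb
      exact dif_neg (fun h => hb h.symm)
    · exact fun h => absurd (Finset.mem_univ (α := I) _) h
    · simp [pathMul, DPath.triv]
  exact LinearMap.congr_fun h x

theorem pathMulLin_one_right (x : PathAlg K I) : pathMulLin K x (pathOne K I) = x := by
  have h : (pathMulLin K).flip (pathOne K I) = LinearMap.id := by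
    refine (pathBasis K).ext fun p => ?_
    obtain ⟨p₁, p₂, p⟩ := p
    simp only [pathOne, map_sum, LinearMap.sum_apply, LinearMap.flip_apply, pathMulLin_basis,
      LinearMap.id_apply]
    refine (Finset.sum_eq_single (M := PathAlg K I) (p₁ : I) ?_ ?_).trans ?_
    · intro b _ hb
      exact dif_neg (fun h => hb h)
    · exact fun h => absurd (Finset.mem_univ (α := I) _) h
    · simp [pathMul, DPath.triv]
  exact LinearMap.congr_fun h x

instance : Ring (PathAlg K I) where
  __ := (inferInstance : AddCommGroup (PathAlg K I))
  mul x y := pathMulLin K x y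
  one := pathOne K I
  left_distrib x y z := map_add (pathMulLin K x) y z
  right_distrib x y z := LinearMap.map_add₂ (pathMulLin K) x y z
  zero_mul x := LinearMap.map_zero₂ (pathMulLin K) x
  mul_zero x := map_zero (pathMulLin K x)
  mul_assoc := pathMulLin_assoc
  one_mul := pathMulLin_one_left
  mul_one := pathMulLin_one_right

theorem PathAlg.mul_def (x y : PathAlg K I) : x * y = pathMulLin K x y := rfl

instance : Algebra K (PathAlg K I) :=
  Algebra.ofModule (fun r x y => LinearMap.map_smul₂ (pathMulLin K) r x y)
    (fun r x y => map_smul (pathMulLin K x) r y)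

variable (K)

/-- The element of the path algebra given by an arrow of the double. -/
def PathAlg.arr {i j : I} (a : DArr i j) : PathAlg K I := pathBasis K (DPath.arr a)

/-- The idempotent `e_i`, the trivial path at `i`. -/
def PathAlg.idem (i : I) : PathAlg K I := pathBasis K (DPath.triv i)

variable {K} [∀ i j : I, Fintype (i ⟶ j)]

/-- The element `ρ_λ = ∑ ε(a) a a* - ∑ λ_i e_i`; the first sum is over all arrows `a` of the
double, listed by their heads `i`. -/
def rhoElt (lam : I → K) : PathAlg K I :=
  (∑ i : I, ∑ x : InArr i, eps K x.2 • (PathAlg.arr K x.2 * PathAlg.arr K (rev x.2)))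
    - ∑ i : I, lam i • PathAlg.idem K i

/-- The relation that sets `ρ_λ` equal to `0`. -/
inductive RhoRel (lam : I → K) : PathAlg K I → PathAlg K I → Prop
  | mk : RhoRel lam (rhoElt lam) 0

/-- The deformed preprojective algebra `Π^λ(Q)`: the quotient of the path algebra of the double
by the two-sided ideal generated by `ρ_λ`. -/
abbrev DPAlg (lam : I → K) : Type (max u v) := RingQuot (RhoRel lam)

end PathAlgebra

/-! ### Representations of the deformed preprojective algebra -/

section Rep

variable {K : Type v} [Field K] {I : Type u} [Quiver.{u} I] [Fintype I]
  [∀ i j : I, Fintype (i ⟶ j)]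

/-- A representation of `Π^λ`: a vector space for each vertex and a linear map for each arrow of
the double, such that `∑_{h(a) = i} ε(a) V_a V_{a*} = λ_i` for each vertex `i`. -/
structure DPRep (lam : I → K) where
  obj : I → ModuleCat.{max u w} K
  map : ∀ {i j : I}, DArr i j → (obj i →ₗ[K] obj j)
  rel : ∀ (i : I) (v : obj i),
    ∑ x : InArr i, eps K x.2 • map x.2 (map (rev x.2) v) = lam i • v

namespace DPRep

variable {lam : I → K}

/-- A morphism of representations: linear maps at the vertices that commute with the arrows. -/
@[ext]
structure Hom (U V : DPRep.{u, v, w} lam) where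
  app : ∀ i : I, U.obj i →ₗ[K] V.obj i
  comm : ∀ {i j : I} (a : DArr i j) (x : U.obj i), app j (U.map a x) = V.map a (app i x)

instance : Category (DPRep.{u, v, w} lam) where
  Hom U V := Hom U V
  id U := ⟨fun _ => LinearMap.id, fun _ _ => rfl⟩
  comp f g := ⟨fun i => (g.app i).comp (f.app i), fun a x => by simp [f.comm, g.comm]⟩

@[ext]
theorem hom_ext {U V : DPRep.{u, v, w} lam} {f g : U ⟶ V} (h : ∀ i x, f.app i x = g.app i x) :
    f = g :=
  Hom.ext (funext fun i => LinearMap.ext (h i))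

@[simp]
theorem id_app (U : DPRep.{u, v, w} lam) (i : I) : Hom.app (𝟙 U) i = LinearMap.id := rfl

@[simp]
theorem comp_app {U V W : DPRep.{u, v, w} lam} (f : U ⟶ V) (g : V ⟶ W) (i : I) :
    (f ≫ g).app i = (g.app i).comp (f.app i) := rfl

end DPRep

end Rep

/-! ### The reflection of weights -/

section Weights

variable {I : Type u} [Quiver.{u} I] [Fintype I] [DecidableEq I] [∀ i j : I, Fintype (i ⟶ j)]

/-- The Ringel form of the quiver. -/
def ringelForm (α β : I → ℤ) : ℤ :=
  ∑ i : I, α i * β i - ∑ i : I, ∑ j : I, ∑ _a : i ⟶ j, α i * β j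

/-- The symmetric bilinear form `(α, β) = ⟨α, β⟩ + ⟨β, α⟩`. -/
def symForm (α β : I → ℤ) : ℤ := ringelForm α β + ringelForm β α

/-- The reflection `r_i` on weights: `(r_i λ)_j = λ_j - (ε_i, ε_j) λ_i`. -/
def reflWeight {K : Type v} [Field K] (i : I) (lam : I → K) : I → K := fun j =>
  lam j - (symForm (Pi.single i 1 : I → ℤ) (Pi.single j 1) : K) * lam i

theorem ringelForm_single (i j : I) : ringelForm (Pi.single i 1 : I → ℤ) (Pi.single j 1) =
    (if i = j then 1 else 0) - (Fintype.card (i ⟶ j) : ℤ) := by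
  simp [ringelForm, Pi.single_apply, Finset.sum_ite_eq, eq_comm]

theorem reflWeight_self {K : Type v} [Field K] {i : I} (hi : LoopFree i) (lam : I → K) :
    reflWeight i lam i = - lam i := by
  have : IsEmpty (i ⟶ i) := hi
  simp [reflWeight, symForm, ringelForm_single]
  ring

theorem reflWeight_ne {K : Type v} [Field K] {i j : I} (h : j ≠ i) (lam : I → K) :
    reflWeight i lam j = lam j + (Fintype.card (DArr i j) : K) * lam i := by
  simp [reflWeight, symForm, ringelForm_single, h, h.symm]
  ring

end Weights

/-! ### Reflection functors on representations -/

section Reflection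

variable {K : Type v} [Field K] {I : Type u} [Quiver.{u} I] [Fintype I] [DecidableEq I]
  [∀ i j : I, Fintype (i ⟶ j)] {lam : I → K}

theorem eps_mul_self {i j : I} (a : DArr i j) : eps K a * eps K a = 1 := by
  cases a <;> simp [eps]

theorem eps_rev {i j : I} (a : DArr i j) : eps K (rev a) = - eps K a := by
  cases a <;> simp [eps]

namespace DPRep

variable (V : DPRep.{u, v, w} lam)

/-- The space `V_⊕`, the direct sum of the spaces `V_{t(a)}` over the arrows `a` of the double
with head `k`. -/
abbrev plus (k : I) : Type (max u w) := ∀ x : InArr k, V.obj x.1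

/-- The map `μ : V_k → V_⊕`. -/
def mu (k : I) : V.obj k →ₗ[K] V.plus k := LinearMap.pi fun x => V.map (rev x.2)

/-- The map `π : V_⊕ → V_k`. -/
def pi (k : I) : V.plus k →ₗ[K] V.obj k :=
  ∑ x : InArr k, eps K x.2 • (V.map x.2).comp (LinearMap.proj x)

theorem pi_apply (k : I) (y : V.plus k) :
    V.pi k y = ∑ x : InArr k, eps K x.2 • V.map x.2 (y x) := by
  simp [pi]

theorem pi_mu (k : I) (v : V.obj k) : V.pi k (V.mu k v) = lam k • v := by
  rw [pi_apply]
  exact V.rel k v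

/-- The canonical injection `μ_a : V_{t(a)} → V_⊕`. -/
def inj {k : I} (x : InArr k) : V.obj x.1 →ₗ[K] V.plus k :=
  letI := Classical.decEq (InArr k)
  LinearMap.single K (fun x : InArr k => V.obj x.1) x

theorem inj_same {k : I} (x : InArr k) (v : V.obj x.1) : V.inj x v x = v := by
  simp [inj]

theorem inj_ne {k : I} {x y : InArr k} (h : y ≠ x) (v : V.obj x.1) : V.inj x v y = 0 := by
  simp [inj, h]

theorem sum_inj {k : I} (y : V.plus k) : ∑ x : InArr k, V.inj x (y x) = y := by
  classical
  funext z
  rw [Finset.sum_apply, Finset.sum_eq_single z]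
  · exact V.inj_same z _
  · exact fun x _ hx => V.inj_ne hx.symm _
  · exact fun h => absurd (Finset.mem_univ _) h

theorem pi_inj {k : I} (x : InArr k) (v : V.obj x.1) :
    V.pi k (V.inj x v) = eps K x.2 • V.map x.2 v := by
  rw [pi_apply, Finset.sum_eq_single x]
  · rw [inj_same]
  · intro y _ hy
    rw [V.inj_ne hy, map_zero, smul_zero]
  · exact fun h => absurd (Finset.mem_univ _) h

/-- The endomorphism `μ π - λ_k` of `V_⊕`. -/
def theta (k : I) : V.plus k →ₗ[K] V.plus k := (V.mu k).comp (V.pi k) - lam k • LinearMap.id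

/-- The cokernel of `μ`. -/
abbrev cok (k : I) : Type (max u w) := V.plus k ⧸ LinearMap.range (V.mu k)

/-- The canonical map `c : V_⊕ → Coker μ`. -/
abbrev cokProj (k : I) : V.plus k →ₗ[K] V.cok k := (LinearMap.range (V.mu k)).mkQ

/-- The map `γ : Coker μ → V_⊕` with `γ c = μ π - λ_k`. -/
def cokGamma (k : I) : V.cok k →ₗ[K] V.plus k :=
  (LinearMap.range (V.mu k)).liftQ (V.theta k) <| by
    rintro _ ⟨v, rfl⟩
    simp [theta, pi_mu]

/-- The kernel of `π`. -/
abbrev ker (k : I) : Type (max u w) := LinearMap.ker (V.pi k)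

/-- The inclusion `ι : Ker π → V_⊕`. -/
abbrev kerIncl (k : I) : V.ker k →ₗ[K] V.plus k := (LinearMap.ker (V.pi k)).subtype

/-- The map `γ : V_⊕ → Ker π` with `ι γ = μ π - λ_k`. -/
def kerGamma (k : I) : V.plus k →ₗ[K] V.ker k :=
  (V.theta k).codRestrict (LinearMap.ker (V.pi k)) fun y => by
    simp [theta, pi_mu]

/-- The space of `C_i(V)` at `k`: the cokernel of `μ` if `k = i`, and `V_k` otherwise. -/
def cObj (i k : I) : Decidable (k = i) → ModuleCat.{max u w} K
  | isTrue _ => ModuleCat.of K (V.cok k)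
  | isFalse _ => V.obj k

/-- The map of `C_i(V)` at an arrow `a : j → k` of the double. The last case does not occur if
`i` is loop-free. -/
def cMap (i : I) {j k : I} (a : DArr j k) :
    ∀ (dj : Decidable (j = i)) (dk : Decidable (k = i)), V.cObj i j dj →ₗ[K] V.cObj i k dk
  | isFalse _, isFalse _ => V.map a
  | isFalse _, isTrue _ =>
      eps K a • (V.cokProj k).comp (V.inj ⟨j, a⟩)
  | isTrue _, isFalse _ =>
      (LinearMap.proj (⟨k, rev a⟩ : InArr j)).comp (V.cokGamma j)
  | isTrue _, isTrue _ => 0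

/-- The space of `K_i(V)` at `k`: the kernel of `π` if `k = i`, and `V_k` otherwise. -/
def kObj (i k : I) : Decidable (k = i) → ModuleCat.{max u w} K
  | isTrue _ => ModuleCat.of K (V.ker k)
  | isFalse _ => V.obj k

/-- The map of `K_i(V)` at an arrow `a : j → k` of the double. The last case does not occur if
`i` is loop-free. -/
def kMap (i : I) {j k : I} (a : DArr j k) :
    ∀ (dj : Decidable (j = i)) (dk : Decidable (k = i)), V.kObj i j dj →ₗ[K] V.kObj i k dk
  | isFalse _, isFalse _ => V.map a
  | isFalse _, isTrue _ =>
      eps K a • (V.kerGamma k).comp (V.inj ⟨j, a⟩)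
  | isTrue _, isFalse _ =>
      (LinearMap.proj (⟨k, rev a⟩ : InArr j)).comp (V.kerIncl j)
  | isTrue _, isTrue _ => 0

theorem no_loop {i j k : I} (hi : LoopFree i) (a : DArr j k) (hj : j = i) (hk : k = i) : False := by
  subst hj hk
  exact a.elim hi.false hi.false

theorem theta_inj {k : I} (x : InArr k) (v : V.obj x.1) :
    V.theta k (V.inj x v) x = eps K x.2 • V.map (rev x.2) (V.map x.2 v) - lam k • v := by
  simp [theta, pi_inj, mu, inj_same]

/-- The common computation of the relation of `C_i(V)` and `K_i(V)` at a vertex `k ≠ i`. -/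
theorem sum_rel_ne {i k : I} (hk : k ≠ i) (v : V.obj k) (T : InArr k → V.obj k)
    (h₁ : ∀ x : InArr k, x.1 ≠ i → T x = eps K x.2 • V.map x.2 (V.map (rev x.2) v))
    (h₂ : ∀ x : InArr k, x.1 = i → T x = eps K x.2 • eps K (rev x.2) •
      V.theta x.1 (V.inj (⟨k, rev x.2⟩ : InArr x.1) v) ⟨k, rev x.2⟩) :
    ∑ x : InArr k, T x = reflWeight i lam k • v := by
  have h : ∀ x : InArr k, T x =
      eps K x.2 • V.map x.2 (V.map (rev x.2) v) + (if x.1 = i then lam i • v else 0) := by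
    rintro ⟨j, a⟩
    by_cases hx : j = i
    · subst hx
      rw [h₂ _ rfl, theta_inj]
      cases a <;> simp [eps] <;> abel
    · rw [h₁ _ hx, if_neg hx, add_zero]
  rw [Finset.sum_congr rfl fun x _ => h x, Finset.sum_add_distrib, V.rel, reflWeight_ne hk, add_smul]
  congr 1
  rw [Fintype.sum_sigma, Finset.sum_eq_single i]
  · simp only [if_true]
    rw [Finset.sum_const, Finset.card_univ, mul_smul, Nat.cast_smul_eq_nsmul]
  · intro j _ hj
    simp [hj]
  · simp

theorem cok_sum (k : I) (y : V.plus k) :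
    ∑ x : InArr k, V.cokProj k (V.inj x (V.theta k y x)) = (- lam k) • V.cokProj k y := by
  rw [← map_sum, sum_inj]
  simp [theta]

theorem ker_sum (k : I) (v : V.ker k) :
    ∑ x : InArr k, V.kerGamma k (V.inj x (V.kerIncl k v x)) = (- lam k) • v := by
  rw [← map_sum, sum_inj]
  refine Subtype.ext ?_
  change V.theta k v.1 = (- lam k) • v.1
  have hv : V.pi k v.1 = 0 := v.2
  simp [theta, hv]

/-- The representation `C_i(V)` of `Π^{r_i λ}`. -/
def cRep {i : I} (hi : LoopFree i) : DPRep.{u, v, w} (reflWeight i lam) where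
  obj k := V.cObj i k inferInstance
  map {j k} a := V.cMap i a inferInstance inferInstance
  rel k := by
    generalize (inferInstance : Decidable (k = i)) = dk
    cases dk with
    | isTrue hk =>
      intro v
      obtain ⟨y, rfl⟩ := Submodule.mkQ_surjective _ v
      have h : ∀ x : InArr k,
          (eps K x.2 • V.cMap i x.2 inferInstance (isTrue hk)
            (V.cMap i (rev x.2) (isTrue hk) inferInstance (V.cokProj k y)) : V.cok k) =
          V.cokProj k (V.inj x (V.theta k y x)) := by
        rintro ⟨j, a⟩
        generalize (inferInstance : Decidable (j = i)) = dj
        cases dj with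
        | isTrue h => exact (no_loop hi a h hk).elim
        | isFalse h =>
          change eps K a • eps K a • V.cokProj k (V.inj ⟨j, a⟩ (V.theta k y ⟨j, rev (rev a)⟩)) = _
          rw [smul_smul, eps_mul_self, one_smul]
          cases a <;> rfl
      have hw : reflWeight i lam k = - lam k := by rw [hk, reflWeight_self hi]
      rw [hw]
      exact (Finset.sum_congr rfl fun x _ => h x).trans (V.cok_sum k y)
    | isFalse hk =>
      intro v
      refine V.sum_rel_ne hk v _ ?_ ?_
      · intro x hx
        generalize (inferInstance : Decidable (x.1 = i)) = dx
        cases dx with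
        | isTrue h => exact absurd h hx
        | isFalse h => rfl
      · intro x hx
        generalize (inferInstance : Decidable (x.1 = i)) = dx
        cases dx with
        | isTrue h =>
          change eps K x.2 • V.cokGamma x.1 (eps K (rev x.2) •
            V.cokProj x.1 (V.inj ⟨k, rev x.2⟩ v)) ⟨k, rev x.2⟩ = _
          rw [map_smul]
          rfl
        | isFalse h => exact absurd hx h

/-- The representation `K_i(V)` of `Π^{r_i λ}`. -/
def kRep {i : I} (hi : LoopFree i) : DPRep.{u, v, w} (reflWeight i lam) where
  obj k := V.kObj i k inferInstance
  map {j k} a := V.kMap i a inferInstance inferInstance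
  rel k := by
    generalize (inferInstance : Decidable (k = i)) = dk
    cases dk with
    | isTrue hk =>
      intro v
      have h : ∀ x : InArr k,
          (eps K x.2 • V.kMap i x.2 inferInstance (isTrue hk)
            (V.kMap i (rev x.2) (isTrue hk) inferInstance v) : V.ker k) =
          V.kerGamma k (V.inj x (V.kerIncl k v x)) := by
        rintro ⟨j, a⟩
        generalize (inferInstance : Decidable (j = i)) = dj
        cases dj with
        | isTrue h => exact (no_loop hi a h hk).elim
        | isFalse h =>
          change eps K a • eps K a •
            V.kerGamma k (V.inj ⟨j, a⟩ (V.kerIncl k v ⟨j, rev (rev a)⟩)) = _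
          rw [smul_smul, eps_mul_self, one_smul]
          cases a <;> rfl
      have hw : reflWeight i lam k = - lam k := by rw [hk, reflWeight_self hi]
      rw [hw]
      exact (Finset.sum_congr rfl fun x _ => h x).trans (V.ker_sum k v)
    | isFalse hk =>
      intro v
      refine V.sum_rel_ne hk v _ ?_ ?_
      · intro x hx
        generalize (inferInstance : Decidable (x.1 = i)) = dx
        cases dx with
        | isTrue h => exact absurd h hx
        | isFalse h => rfl
      · intro x hx
        generalize (inferInstance : Decidable (x.1 = i)) = dx
        cases dx with
        | isTrue h => rfl
        | isFalse h => exact absurd hx h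

variable {V} {U W : DPRep.{u, v, w} lam}

/-- The map `⊕_a f_{t(a)} : U_⊕ → V_⊕` given by a morphism `f : U → V`. -/
def plusMap (f : U ⟶ V) (k : I) : U.plus k →ₗ[K] V.plus k :=
  LinearMap.pi fun x => (f.app x.1).comp (LinearMap.proj x)

theorem plusMap_inj (f : U ⟶ V) {k : I} (x : InArr k) (v : U.obj x.1) :
    plusMap f k (U.inj x v) = V.inj x (f.app x.1 v) := by
  funext y
  change f.app y.1 (U.inj x v y) = _
  by_cases h : y = x
  · subst h
    rw [inj_same, inj_same]
  · rw [inj_ne _ h, inj_ne _ h, map_zero]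

theorem plusMap_mu (f : U ⟶ V) (k : I) (v : U.obj k) :
    plusMap f k (U.mu k v) = V.mu k (f.app k v) :=
  funext fun x => f.comm (rev x.2) v

theorem pi_plusMap (f : U ⟶ V) (k : I) (y : U.plus k) :
    V.pi k (plusMap f k y) = f.app k (U.pi k y) := by
  rw [pi_apply, pi_apply, map_sum]
  refine Finset.sum_congr rfl fun x _ => ?_
  rw [map_smul, f.comm]
  rfl

theorem plusMap_theta (f : U ⟶ V) (k : I) (y : U.plus k) :
    plusMap f k (U.theta k y) = V.theta k (plusMap f k y) := by
  simp [theta, plusMap_mu, pi_plusMap]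

/-- The map of cokernels induced by a morphism. -/
def cokMap (f : U ⟶ V) (k : I) : U.cok k →ₗ[K] V.cok k :=
  Submodule.mapQ _ _ (plusMap f k) <| by
    rintro _ ⟨v, rfl⟩
    exact ⟨f.app k v, (plusMap_mu f k v).symm⟩

/-- The map of kernels induced by a morphism. -/
def kerMap (f : U ⟶ V) (k : I) : U.ker k →ₗ[K] V.ker k :=
  (plusMap f k).restrict <| by
    intro y hy
    rw [LinearMap.mem_ker] at hy ⊢
    rw [pi_plusMap, hy, map_zero]

/-- The component of `C_i(f)` at `k`. -/
def cApp (f : U ⟶ V) (i k : I) : ∀ d : Decidable (k = i), U.cObj i k d →ₗ[K] V.cObj i k d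
  | isTrue _ => cokMap f k
  | isFalse _ => f.app k

/-- The component of `K_i(f)` at `k`. -/
def kApp (f : U ⟶ V) (i k : I) : ∀ d : Decidable (k = i), U.kObj i k d →ₗ[K] V.kObj i k d
  | isTrue _ => kerMap f k
  | isFalse _ => f.app k

theorem cApp_comm (f : U ⟶ V) (i : I) {j k : I} (a : DArr j k)
    (dj : Decidable (j = i)) (dk : Decidable (k = i)) (x : U.cObj i j dj) :
    cApp f i k dk (U.cMap i a dj dk x) = V.cMap i a dj dk (cApp f i j dj x) := by
  cases dj with
  | isTrue hj =>
    cases dk with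
    | isTrue hk => exact map_zero (cokMap f k)
    | isFalse hk =>
      obtain ⟨y, rfl⟩ := Submodule.mkQ_surjective _ x
      exact congrFun (plusMap_theta f j y) ⟨k, rev a⟩
  | isFalse hj =>
    cases dk with
    | isTrue hk =>
      change cokMap f k (eps K a • U.cokProj k (U.inj ⟨j, a⟩ x)) =
        eps K a • V.cokProj k (V.inj ⟨j, a⟩ (f.app j x))
      rw [map_smul, ← plusMap_inj f ⟨j, a⟩ x]
      rfl
    | isFalse hk => exact f.comm a x

theorem kApp_comm (f : U ⟶ V) (i : I) {j k : I} (a : DArr j k)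
    (dj : Decidable (j = i)) (dk : Decidable (k = i)) (x : U.kObj i j dj) :
    kApp f i k dk (U.kMap i a dj dk x) = V.kMap i a dj dk (kApp f i j dj x) := by
  cases dj with
  | isTrue hj =>
    cases dk with
    | isTrue hk => exact map_zero (kerMap f k)
    | isFalse hk => rfl
  | isFalse hj =>
    cases dk with
    | isTrue hk =>
      change kerMap f k (eps K a • U.kerGamma k (U.inj ⟨j, a⟩ x)) =
        eps K a • V.kerGamma k (V.inj ⟨j, a⟩ (f.app j x))
      rw [map_smul, ← plusMap_inj f ⟨j, a⟩ x]
      exact congrArg (eps K a • ·) (Subtype.ext (plusMap_theta f k _))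
    | isFalse hk => exact f.comm a x

theorem cApp_id (i k : I) (d : Decidable (k = i)) (x : U.cObj i k d) :
    cApp (𝟙 U) i k d x = x := by
  cases d with
  | isTrue h =>
    obtain ⟨y, rfl⟩ := Submodule.mkQ_surjective _ x
    rfl
  | isFalse h => rfl

theorem cApp_comp (f : U ⟶ V) (g : V ⟶ W) (i k : I) (d : Decidable (k = i)) (x : U.cObj i k d) :
    cApp (f ≫ g) i k d x = cApp g i k d (cApp f i k d x) := by
  cases d with
  | isTrue h =>
    obtain ⟨y, rfl⟩ := Submodule.mkQ_surjective _ x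
    rfl
  | isFalse h => rfl

theorem kApp_id (i k : I) (d : Decidable (k = i)) (x : U.kObj i k d) :
    kApp (𝟙 U) i k d x = x := by
  cases d <;> rfl

theorem kApp_comp (f : U ⟶ V) (g : V ⟶ W) (i k : I) (d : Decidable (k = i)) (x : U.kObj i k d) :
    kApp (f ≫ g) i k d x = kApp g i k d (kApp f i k d x) := by
  cases d <;> rfl

/-- The reflection functor `C_i` on representations. -/
def cFunctor (lam : I → K) {i : I} (hi : LoopFree i) :
    DPRep.{u, v, w} lam ⥤ DPRep.{u, v, w} (reflWeight i lam) where
  obj V := V.cRep hi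
  map f := ⟨fun k => cApp f i k inferInstance, fun a x => cApp_comm f i a _ _ x⟩
  map_id _ := hom_ext fun k x => cApp_id i k _ x
  map_comp f g := hom_ext fun k x => cApp_comp f g i k _ x

/-- The reflection functor `K_i` on representations. -/
def kFunctor (lam : I → K) {i : I} (hi : LoopFree i) :
    DPRep.{u, v, w} lam ⥤ DPRep.{u, v, w} (reflWeight i lam) where
  obj V := V.kRep hi
  map f := ⟨fun k => kApp f i k inferInstance, fun a x => kApp_comm f i a _ _ x⟩
  map_id _ := hom_ext fun k x => kApp_id i k _ x
  map_comp f g := hom_ext fun k x => kApp_comp f g i k _ x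

end DPRep

end Reflection

/-! ### Modules and representations -/

section Equivalence

variable {K : Type v} [Field K] {I : Type u} [Quiver.{u} I] [Fintype I] [DecidableEq I]
  [∀ i j : I, Fintype (i ⟶ j)]

theorem PathAlg.basis_mul (p q : DPath I) : pathBasis K p * pathBasis K q = pathMul K p q :=
  pathMulLin_basis p q

theorem PathAlg.one_def : (1 : PathAlg K I) = ∑ i : I, PathAlg.idem K i := rfl

theorem PathAlg.idem_mul_self (i : I) : PathAlg.idem K i * PathAlg.idem K i = PathAlg.idem K i := by
  rw [PathAlg.idem, PathAlg.basis_mul]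
  exact dif_pos rfl

theorem PathAlg.idem_mul_ne {i j : I} (h : i ≠ j) : PathAlg.idem K i * PathAlg.idem K j = 0 := by
  rw [PathAlg.idem, PathAlg.idem, PathAlg.basis_mul]
  exact dif_neg h.symm

theorem PathAlg.arr_mul_idem {i j : I} (a : DArr i j) :
    PathAlg.arr K a * PathAlg.idem K i = PathAlg.arr K a := by
  rw [PathAlg.arr, PathAlg.idem, PathAlg.basis_mul]
  exact dif_pos rfl

theorem PathAlg.idem_mul_arr {i j : I} (a : DArr i j) :
    PathAlg.idem K j * PathAlg.arr K a = PathAlg.arr K a := by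
  rw [PathAlg.arr, PathAlg.idem, PathAlg.basis_mul]
  exact dif_pos rfl

theorem PathAlg.basis_cons {i j k : Quiver.Symmetrify I} (p : Quiver.Path i j) (a : j ⟶ k) :
    pathBasis K (⟨i, k, p.cons a⟩ : DPath I) =
      PathAlg.arr K (I := I) (i := j) (j := k) a * pathBasis K (⟨i, j, p⟩ : DPath I) := by
  refine Eq.trans ?_ (PathAlg.basis_mul _ _).symm
  unfold pathMul
  rw [dif_pos (by rfl)]
  rfl

/-- The path algebra is generated by the trivial paths and the arrows. -/
theorem PathAlg.induction {P : PathAlg K I → Prop} (h_idem : ∀ i, P (PathAlg.idem K i))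
    (h_arr : ∀ {i j : I} (a : DArr i j), P (PathAlg.arr K a))
    (h_zero : P 0) (h_add : ∀ x y, P x → P y → P (x + y))
    (h_smul : ∀ (c : K) x, P x → P (c • x)) (h_mul : ∀ x y, P x → P y → P (x * y))
    (x : PathAlg K I) : P x := by
  have hb : ∀ p : DPath I, P (pathBasis K p) := by
    rintro ⟨i, j, p⟩
    induction p with
    | nil => exact h_idem i
    | cons p a ih =>
      rw [PathAlg.basis_cons]
      exact h_mul _ _ (h_arr _) ih
  have hx : x ∈ Submodule.span K (Set.range (pathBasis K (I := I))) := by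
    rw [(pathBasis K).span_eq]
    trivial
  induction hx using Submodule.span_induction with
  | mem x h =>
    obtain ⟨p, rfl⟩ := h
    exact hb p
  | zero => exact h_zero
  | add x y _ _ hx hy => exact h_add x y hx hy
  | smul c x _ hx => exact h_smul c x hx

namespace DPAlg

variable (lam : I → K)

/-- The quotient map from the path algebra to `Π^λ`. -/
def proj : PathAlg K I →ₐ[K] DPAlg lam := RingQuot.mkAlgHom K (RhoRel lam)

/-- The idempotent `e_i` of `Π^λ`. -/
def e (i : I) : DPAlg lam := proj lam (PathAlg.idem K i)

/-- The element of `Π^λ` given by an arrow of the double. -/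
def arr {i j : I} (a : DArr i j) : DPAlg lam := proj lam (PathAlg.arr K a)

theorem one_eq : (1 : DPAlg lam) = ∑ i : I, e lam i := by
  rw [← map_one (proj lam), PathAlg.one_def, map_sum]
  rfl

theorem e_mul_self (i : I) : e lam i * e lam i = e lam i := by
  rw [e, ← map_mul, PathAlg.idem_mul_self]

theorem e_mul_ne {i j : I} (h : i ≠ j) : e lam i * e lam j = 0 := by
  rw [e, e, ← map_mul, PathAlg.idem_mul_ne h, map_zero]

theorem arr_mul_e {i j : I} (a : DArr i j) : arr lam a * e lam i = arr lam a := by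
  rw [arr, e, ← map_mul, PathAlg.arr_mul_idem]

theorem e_mul_arr {i j : I} (a : DArr i j) : e lam j * arr lam a = arr lam a := by
  rw [arr, e, ← map_mul, PathAlg.idem_mul_arr]

theorem arr_mul_e_ne {i j k : I} (a : DArr i j) (h : i ≠ k) : arr lam a * e lam k = 0 := by
  rw [← arr_mul_e, mul_assoc, e_mul_ne lam h, mul_zero]

theorem rel : ∑ i : I, ∑ x : InArr i, eps K x.2 • (arr lam x.2 * arr lam (rev x.2)) =
    ∑ i : I, lam i • e lam i := by
  have h : proj lam (rhoElt lam) = proj lam 0 := RingQuot.mkAlgHom_rel K RhoRel.mk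
  rw [map_zero, rhoElt, map_sub, sub_eq_zero] at h
  simpa only [map_sum, map_smul, map_mul, e, arr] using h

theorem rel_mul_e (i : I) : ∑ x : InArr i, eps K x.2 • (arr lam x.2 * arr lam (rev x.2)) =
    lam i • e lam i := by
  have h := congrArg (· * e lam i) (rel lam)
  simp only [Finset.sum_mul, smul_mul_assoc, mul_assoc] at h
  rw [Finset.sum_eq_single i, Finset.sum_eq_single i] at h
  · simpa only [arr_mul_e, e_mul_self] using h
  · intro j _ hj
    rw [e_mul_ne lam hj, smul_zero]
  · exact fun h => absurd (Finset.mem_univ _) h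
  · intro j _ hj
    refine Finset.sum_eq_zero fun x _ => ?_
    rw [arr_mul_e_ne lam _ hj, mul_zero, smul_zero]
  · exact fun h => absurd (Finset.mem_univ _) h

theorem induction {P : DPAlg lam → Prop} (h_idem : ∀ i, P (e lam i))
    (h_arr : ∀ {i j : I} (a : DArr i j), P (arr lam a))
    (h_zero : P 0) (h_add : ∀ x y, P x → P y → P (x + y))
    (h_smul : ∀ (c : K) x, P x → P (c • x)) (h_mul : ∀ x y, P x → P y → P (x * y))
    (x : DPAlg lam) : P x := by
  obtain ⟨x, rfl⟩ := RingQuot.mkAlgHom_surjective K (RhoRel lam) x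
  refine PathAlg.induction (P := fun x => P (proj lam x)) h_idem h_arr ?_ ?_ ?_ ?_ x
  · rwa [map_zero]
  · intro x y hx hy
    rw [map_add]
    exact h_add _ _ hx hy
  · intro c x hx
    rw [map_smul]
    exact h_smul _ _ hx
  · intro x y hx hy
    rw [map_mul]
    exact h_mul _ _ hx hy

end DPAlg

open scoped ModuleCat

section ToRep

variable {lam : I → K}

/-- The subspace `e_i M` of a `Π^λ`-module `M`. -/
abbrev eSub (M : ModuleCat.{max u w} (DPAlg lam)) (i : I) : Submodule K M :=
  LinearMap.range (Algebra.lsmul K K M (DPAlg.e lam i))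

theorem e_smul_of_mem {M : ModuleCat.{max u w} (DPAlg lam)} {i : I} {m : M} (h : m ∈ eSub M i) :
    DPAlg.e lam i • m = m := by
  obtain ⟨n, rfl⟩ := h
  change DPAlg.e lam i • DPAlg.e lam i • n = DPAlg.e lam i • n
  rw [smul_smul, DPAlg.e_mul_self]

theorem arr_smul_mem (M : ModuleCat.{max u w} (DPAlg lam)) {i j : I} (a : DArr i j) (m : M) :
    DPAlg.arr lam a • m ∈ eSub M j :=
  ⟨DPAlg.arr lam a • m, by
    change DPAlg.e lam j • DPAlg.arr lam a • m = _
    rw [smul_smul, DPAlg.e_mul_arr]⟩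

theorem sum_e_smul (M : ModuleCat.{max u w} (DPAlg lam)) (m : M) :
    ∑ i : I, DPAlg.e lam i • m = m := by
  rw [← Finset.sum_smul, ← DPAlg.one_eq, one_smul]

/-- The representation `(e_i M, (a ·))` given by a `Π^λ`-module `M`. -/
def repOfModule (M : ModuleCat.{max u w} (DPAlg lam)) : DPRep.{u, v, w} lam where
  obj i := ModuleCat.of K (eSub M i)
  map {i j} a := ((Algebra.lsmul K K M (DPAlg.arr lam a)).comp (eSub M i).subtype).codRestrict
    (eSub M j) fun m => arr_smul_mem M a m.1
  rel i v := by
    refine Subtype.ext ?_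
    have h : ∑ x : InArr i, eps K x.2 • (DPAlg.arr lam x.2 • DPAlg.arr lam (rev x.2) • v.1) =
        lam i • v.1 := by
      have := congrArg (· • v.1) (DPAlg.rel_mul_e lam i)
      simpa only [Finset.sum_smul, smul_assoc, mul_smul, e_smul_of_mem v.2] using this
    refine Eq.trans ?_ h
    exact map_sum (eSub M i).subtype _ _

/-- The functor `F : Mod Π^λ → Rep Π^λ` with `F(M)_i = e_i M` and `F(M)_a = (a ·)`. -/
def toRep (lam : I → K) : ModuleCat.{max u w} (DPAlg lam) ⥤ DPRep.{u, v, w} lam where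
  obj M := repOfModule M
  map {M N} f :=
    { app := fun i =>
        { toFun := fun m => ⟨f.hom m.1, by
            rw [← e_smul_of_mem m.2, map_smul]
            exact ⟨_, rfl⟩⟩
          map_add' := fun x y => Subtype.ext (map_add f.hom x.1 y.1)
          map_smul' := fun c x => Subtype.ext (map_smul f.hom (algebraMap K (DPAlg lam) c) x.1) }
      comm := fun a x => Subtype.ext (map_smul f.hom (DPAlg.arr lam a) x.1) }

instance : (toRep.{u, v, w} lam).Faithful where
  map_injective {M N} f g h := by
    ext m
    rw [← sum_e_smul M m, map_sum, map_sum]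
    refine Finset.sum_congr rfl fun i _ => ?_
    have := congrArg (fun t : repOfModule M ⟶ repOfModule N =>
      t.app i (⟨DPAlg.e lam i • m, ⟨m, rfl⟩⟩ : eSub M i)) h
    exact congrArg Subtype.val this

/-- The linear map `m ↦ ∑ f_i(e_i m)` given by a morphism `f` of the representations. -/
def homOfRep {M N : ModuleCat.{max u w} (DPAlg lam)} (f : repOfModule M ⟶ repOfModule N) :
    M →ₗ[K] N :=
  ∑ i : I, ((eSub N i).subtype.comp (f.app i)).comp
    (Algebra.lsmul K K M (DPAlg.e lam i)).rangeRestrict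

theorem homOfRep_of_mem {M N : ModuleCat.{max u w} (DPAlg lam)}
    (f : repOfModule M ⟶ repOfModule N) {i : I} (m : eSub M i) :
    homOfRep f m.1 = (f.app i m : eSub N i).1 := by
  rw [homOfRep, LinearMap.sum_apply, Finset.sum_eq_single i]
  · have h : (Algebra.lsmul K K M (DPAlg.e lam i)).rangeRestrict m.1 = m :=
      Subtype.ext (e_smul_of_mem m.2)
    exact congrArg (fun t => (f.app i t : eSub N i).1) h
  · intro j _ hj
    have h : (Algebra.lsmul K K M (DPAlg.e lam j)).rangeRestrict m.1 = 0 := by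
      refine Subtype.ext ?_
      change DPAlg.e lam j • m.1 = 0
      rw [← e_smul_of_mem m.2, smul_smul, DPAlg.e_mul_ne lam hj, zero_smul]
    exact (congrArg (fun t => (f.app j t : eSub N j).1) h).trans
      (congrArg Subtype.val (map_zero (f.app j)))
  · exact fun h => absurd (Finset.mem_univ _) h

theorem homOfRep_e {M N : ModuleCat.{max u w} (DPAlg lam)}
    (f : repOfModule M ⟶ repOfModule N) (i : I) (m : M) :
    homOfRep f (DPAlg.e lam i • m) = DPAlg.e lam i • homOfRep f m := by
  have h : ∀ j, homOfRep f (DPAlg.e lam j • m) ∈ eSub N j := fun j => by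
    have := homOfRep_of_mem f (⟨DPAlg.e lam j • m, ⟨m, rfl⟩⟩ : eSub M j)
    rw [this]
    exact Subtype.prop _
  conv_rhs => rw [← sum_e_smul M m, map_sum, Finset.smul_sum]
  rw [Finset.sum_eq_single i]
  · rw [e_smul_of_mem (h i)]
  · intro j _ hj
    rw [← e_smul_of_mem (h j), smul_smul, DPAlg.e_mul_ne lam hj.symm, zero_smul]
  · exact fun h => absurd (Finset.mem_univ _) h

theorem homOfRep_arr {M N : ModuleCat.{max u w} (DPAlg lam)}
    (f : repOfModule M ⟶ repOfModule N) {i j : I} (a : DArr i j) (m : M) :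
    homOfRep f (DPAlg.arr lam a • m) = DPAlg.arr lam a • homOfRep f m := by
  let n : eSub M i := ⟨DPAlg.e lam i • m, ⟨m, rfl⟩⟩
  have h₁ : DPAlg.arr lam a • m = DPAlg.arr lam a • n.1 := by
    rw [smul_smul, DPAlg.arr_mul_e]
  have h₂ : DPAlg.arr lam a • homOfRep f m = DPAlg.arr lam a • homOfRep f n.1 := by
    rw [homOfRep_e, smul_smul, DPAlg.arr_mul_e]
  rw [h₁, h₂, homOfRep_of_mem]
  refine (homOfRep_of_mem f (⟨_, arr_smul_mem M a n.1⟩ : eSub M j)).trans ?_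
  exact congrArg Subtype.val (f.comm a n)

theorem homOfRep_smul {M N : ModuleCat.{max u w} (DPAlg lam)}
    (f : repOfModule M ⟶ repOfModule N) (x : DPAlg lam) :
    ∀ m : M, homOfRep f (x • m) = x • homOfRep f m := by
  induction x using DPAlg.induction with
  | h_idem i => exact homOfRep_e f i
  | h_arr a => exact homOfRep_arr f a
  | h_zero => simp
  | h_add x y hx hy =>
    intro m
    rw [add_smul, add_smul, map_add, hx, hy]
  | h_smul c x hx =>
    intro m
    rw [smul_assoc, smul_assoc, map_smul, hx]
  | h_mul x y hx hy =>
    intro m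
    rw [mul_smul, mul_smul, hx, hy]

instance : (toRep.{u, v, w} lam).Full where
  map_surjective {M N} f := by
    refine ⟨ModuleCat.ofHom
      { toFun := homOfRep f
        map_add' := map_add (homOfRep f)
        map_smul' := homOfRep_smul f }, ?_⟩
    refine DPRep.hom_ext fun i m => ?_
    exact Subtype.ext (homOfRep_of_mem f m)

end ToRep

section OfRep

variable {lam : I → K} (V : DPRep.{u, v, w} lam)

/-- The linear map by which a path of the double acts on a representation. -/
def DPRep.pathMap (V : DPRep.{u, v, w} lam) {i : Quiver.Symmetrify I} : ∀ {j : Quiver.Symmetrify I},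
    Quiver.Path i j → (V.obj i →ₗ[K] V.obj j)
  | _, .nil => LinearMap.id
  | _, .cons p a => (V.map a).comp (V.pathMap p)

theorem DPRep.pathMap_comp {i j k : Quiver.Symmetrify I} (p : Quiver.Path i j)
    (q : Quiver.Path j k) : V.pathMap (p.comp q) = (V.pathMap q).comp (V.pathMap p) := by
  induction q with
  | nil => rfl
  | cons q a ih =>
    rw [Quiver.Path.comp_cons, pathMap, ih]
    rfl

/-- The total space of a representation. -/
abbrev DPRep.tot : Type (max u w) := ∀ i : I, V.obj i

/-- The action of a path on the total space. -/
def DPRep.pathEnd (p : DPath I) : Module.End K V.tot :=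
  (LinearMap.single K (fun i : I => V.obj i) p.2.1).comp
    ((V.pathMap p.2.2).comp (LinearMap.proj (φ := fun i : I => V.obj i) p.1))

/-- The action of the path algebra on the total space. -/
def DPRep.pathAct : PathAlg K I →ₗ[K] Module.End K V.tot :=
  (pathBasis K).constr K V.pathEnd

theorem DPRep.pathAct_basis (p : DPath I) : V.pathAct (pathBasis K p) = V.pathEnd p := by
  simp [pathAct, Module.Basis.constr_basis]

theorem DPRep.pathAct_one : V.pathAct 1 = 1 := by
  rw [PathAlg.one_def, map_sum]
  refine LinearMap.ext fun t => ?_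
  rw [LinearMap.sum_apply]
  refine Eq.trans ?_ (Finset.univ_sum_single t)
  refine Finset.sum_congr rfl fun i _ => ?_
  rw [PathAlg.idem, pathAct_basis]
  rfl

theorem DPRep.pathEnd_mul (p q : DPath I) :
    V.pathAct (pathMul K p q) = V.pathEnd p * V.pathEnd q := by
  obtain ⟨p₁, p₂, p⟩ := p
  obtain ⟨q₁, q₂, q⟩ := q
  refine LinearMap.ext fun t => ?_
  let T : I → Type (max u w) := fun i => V.obj i
  let S : ∀ i : I, V.obj i →ₗ[K] V.tot := LinearMap.single K T
  by_cases h : q₂ = p₁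
  · subst h
    rw [pathMul, dif_pos rfl, pathAct_basis]
    change S p₂ (V.pathMap (q.comp p) (t q₁)) = S p₂ (V.pathMap p (S q₂ (V.pathMap q (t q₁)) q₂))
    have h0 : S q₂ (V.pathMap q (t q₁)) q₂ = V.pathMap q (t q₁) := Pi.single_eq_same (M := T) _ _
    rw [h0, pathMap_comp, LinearMap.comp_apply]
  · rw [pathMul, dif_neg h, map_zero]
    change 0 = S p₂ (V.pathMap p (S q₂ (V.pathMap q (t q₁)) p₁))
    have h0 : S q₂ (V.pathMap q (t q₁)) p₁ = 0 := Pi.single_eq_of_ne (M := T) (Ne.symm h) _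
    rw [h0, map_zero, map_zero]

theorem DPRep.pathAct_mul (x y : PathAlg K I) : V.pathAct (x * y) = V.pathAct x * V.pathAct y := by
  have h : (pathMulLin K).compr₂ V.pathAct =
      ((LinearMap.mul K (Module.End K V.tot)).comp V.pathAct).compl₂ V.pathAct := by
    refine (pathBasis K).ext fun p => (pathBasis K).ext fun q => ?_
    simp only [LinearMap.compr₂_apply, LinearMap.compl₂_apply, LinearMap.comp_apply,
      pathMulLin_basis, LinearMap.mul_apply', pathAct_basis, pathEnd_mul]
  exact LinearMap.congr_fun (LinearMap.congr_fun h x) y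

/-- The action of the path algebra on the total space, as a homomorphism of algebras. -/
def DPRep.pathHom : PathAlg K I →ₐ[K] Module.End K V.tot :=
  AlgHom.ofLinearMap V.pathAct V.pathAct_one V.pathAct_mul

theorem DPRep.pathHom_arr {i j : I} (a : DArr i j) (t : V.tot) :
    V.pathHom (PathAlg.arr K a) t = Pi.single j (V.map a (t i)) := by
  change V.pathAct _ t = _
  rw [PathAlg.arr, pathAct_basis]
  rfl

theorem DPRep.pathHom_idem (i : I) (t : V.tot) :
    V.pathHom (PathAlg.idem K i) t = Pi.single i (t i) := by
  change V.pathAct _ t = _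
  rw [PathAlg.idem, pathAct_basis]
  rfl

theorem DPRep.pathHom_rho : V.pathHom (rhoElt lam) = 0 := by
  refine LinearMap.ext fun t => ?_
  rw [rhoElt, map_sub, LinearMap.sub_apply, LinearMap.zero_apply, sub_eq_zero, map_sum, map_sum,
    LinearMap.sum_apply, LinearMap.sum_apply]
  refine Finset.sum_congr rfl fun i _ => ?_
  rw [map_smul, LinearMap.smul_apply, pathHom_idem, ← Pi.single_smul, ← V.rel, map_sum,
    LinearMap.sum_apply]
  have h := map_sum (LinearMap.single K (fun i : I => V.obj i) i)
    (fun x : InArr i => eps K x.2 • V.map x.2 (V.map (rev x.2) (t i))) Finset.univ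
  refine Eq.trans ?_ h.symm
  refine Finset.sum_congr rfl fun x _ => ?_
  rw [map_smul, map_mul, LinearMap.smul_apply, Module.End.mul_apply, pathHom_arr, pathHom_arr,
    Pi.single_eq_same, map_smul]
  rfl

/-- The action of `Π^λ` on the total space. -/
def DPRep.actHom : DPAlg lam →ₐ[K] Module.End K V.tot :=
  RingQuot.liftAlgHom K ⟨V.pathHom, by
    rintro _ _ ⟨⟩
    rw [pathHom_rho, map_zero]⟩

theorem DPRep.actHom_proj (x : PathAlg K I) : V.actHom (DPAlg.proj lam x) = V.pathHom x :=
  RingQuot.liftAlgHom_mkAlgHom_apply _ _ _ x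

/-- The `Π^λ`-module on the total space of a representation. -/
def DPRep.toModule : ModuleCat.{max u w} (DPAlg lam) :=
  letI : Module (DPAlg lam) V.tot := Module.compHom V.tot V.actHom.toRingHom
  ModuleCat.of (DPAlg lam) V.tot

theorem DPRep.toModule_smul (x : DPAlg lam) (t : V.tot) :
    (x • (show V.toModule from t) : V.toModule) = V.actHom x t := rfl

/-- The evaluation `e_i (⊕ V) → V_i`. -/
def DPRep.evalHom : repOfModule V.toModule ⟶ V where
  app i :=
    { toFun := fun m => (show V.tot from m.1) i
      map_add' := fun _ _ => rfl
      map_smul' := fun c m => by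
        change (V.actHom (algebraMap K (DPAlg lam) c) (show V.tot from m.1)) i = _
        rw [AlgHom.commutes]
        rfl }
  comm {i j} a m := by
    change (V.actHom (DPAlg.proj lam (PathAlg.arr K a)) (show V.tot from m.1)) j = _
    rw [actHom_proj, pathHom_arr, Pi.single_eq_same]
    rfl

theorem DPRep.evalHom_bijective (i : I) : Function.Bijective (V.evalHom.app i) := by
  have hs : ∀ m : eSub V.toModule i,
      (show V.tot from m.1) = Pi.single i ((show V.tot from m.1) i) := fun m => by
    conv_lhs => rw [← e_smul_of_mem m.2]
    change V.actHom (DPAlg.proj lam (PathAlg.idem K i)) (show V.tot from m.1) = _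
    rw [actHom_proj, pathHom_idem]
  refine ⟨fun m n h => Subtype.ext ?_, fun v => ?_⟩
  · refine (hs m).trans (Eq.trans ?_ (hs n).symm)
    exact congrArg (Pi.single i) h
  · refine ⟨⟨DPAlg.e lam i • (show V.toModule from (Pi.single i v : V.tot)), ⟨_, rfl⟩⟩, ?_⟩
    change (V.actHom (DPAlg.proj lam (PathAlg.idem K i)) (Pi.single i v : V.tot)) i = _
    rw [actHom_proj, pathHom_idem, Pi.single_eq_same, Pi.single_eq_same]

/-- A morphism of representations that is bijective at each vertex is an isomorphism. -/
def DPRep.isoOfBijective {U V : DPRep.{u, v, w} lam} (f : U ⟶ V)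
    (hf : ∀ i, Function.Bijective (f.app i)) : U ≅ V where
  hom := f
  inv :=
    { app := fun i => ((LinearEquiv.ofBijective (f.app i) (hf i)).symm : V.obj i →ₗ[K] U.obj i)
      comm := fun {i j} a x => by
        refine (hf j).1 ?_
        have h : ∀ k y, f.app k ((LinearEquiv.ofBijective (f.app k) (hf k)).symm y) = y :=
          fun k y => (LinearEquiv.ofBijective (f.app k) (hf k)).apply_symm_apply y
        rw [f.comm]
        exact (h j _).trans (congrArg (V.map a) (h i x).symm) }
  hom_inv_id := DPRep.hom_ext fun i x =>
    (LinearEquiv.ofBijective (f.app i) (hf i)).symm_apply_apply x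
  inv_hom_id := DPRep.hom_ext fun i x =>
    (LinearEquiv.ofBijective (f.app i) (hf i)).apply_symm_apply x

instance : (toRep.{u, v, w} lam).EssSurj where
  mem_essImage V := ⟨V.toModule, ⟨DPRep.isoOfBijective V.evalHom V.evalHom_bijective⟩⟩

instance : (toRep.{u, v, w} lam).IsEquivalence where

/-- The equivalence `Mod Π^λ ≌ Rep Π^λ` given by `M ↦ (e_i M, (a ·))`. -/
def modEquivRep (lam : I → K) : ModuleCat.{max u w} (DPAlg lam) ≌ DPRep.{u, v, w} lam :=
  (toRep.{u, v, w} lam).asEquivalence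

end OfRep

/-! ### Reflection functors on modules -/

/-- The reflection functor `C_i^λ : Mod Π^λ ⥤ Mod Π^{r_i λ}` at a loop-free vertex `i`. Modules
are identified with representations by the equivalence `modEquivRep`. -/
def reflC (lam : I → K) (i : I) (hi : LoopFree i) :
    ModuleCat.{max u w} (DPAlg lam) ⥤ ModuleCat.{max u w} (DPAlg (reflWeight i lam)) :=
  (modEquivRep.{u, v, w} lam).functor ⋙ DPRep.cFunctor.{u, v, w} lam hi ⋙
    (modEquivRep.{u, v, w} (reflWeight i lam)).inverse

/-- The reflection functor `K_i^λ : Mod Π^λ ⥤ Mod Π^{r_i λ}` at a loop-free vertex `i`. -/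
def reflK (lam : I → K) (i : I) (hi : LoopFree i) :
    ModuleCat.{max u w} (DPAlg lam) ⥤ ModuleCat.{max u w} (DPAlg (reflWeight i lam)) :=
  (modEquivRep.{u, v, w} lam).functor ⋙ DPRep.kFunctor.{u, v, w} lam hi ⋙
    (modEquivRep.{u, v, w} (reflWeight i lam)).inverse

/-- The identity functor, read as a functor `Mod Π^λ ⥤ Mod Π^{λ'}` for equal weights
`λ = λ'`. -/
def modCast {lam lam' : I → K} (h : lam = lam') :
    ModuleCat.{max u w} (DPAlg lam) ⥤ ModuleCat.{max u w} (DPAlg lam') :=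
  match lam', h with
  | _, rfl => 𝟭 _


end Equivalence

end DefPreproj
end

noncomputable section

namespace DefPreproj

/-! ### Linear algebra at two vertices -/

section TwoVertex

/-! Write X and Y for the spaces at i and j, and A and B for the sums of the spaces at the other
tails of the arrows into i and into j. Reflections at i and j change X and Y only.

Suppose that one arrow joins i and j. In C_i C_j C_i the space X becomes X₁ = Coker(X → A ⊕ Y), then
Y becomes Y₂ = Coker(Y → B ⊕ X₁), then X₁ becomes X₃ = Coker(X₁ → A ⊕ Y₂). The components Y → X₁ and
X₁ → Y₂ are, up to sign, the canonical maps into a cokernel. So Y cancels in Y₂ and X₁ cancels in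
X₃, which leaves Y₂ = Coker(X → A ⊕ B) and X₃ = Coker(Y → A ⊕ B), where X reaches B through Y and Y
reaches A through X (`cokNormal_of_isCok`). This description treats i and j alike, so it also fits
C_j C_i C_j. For K the argument is dual, with subspaces of A ⊕ B (`kerNormal_of_isKer`).

The maps agree too. The round trips A → A and B → B both drop by λ_i + λ_j, and the paths between A
and B do not change (`samePaths_of_isRefl`). These values fix the maps between X₃, Y₂ and A, B; the
relations at i and j then fix the maps between X₃ and Y₂ (`exists_intertwines_of_cokNormal`,
`exists_intertwines_of_kerNormal`).

If no arrow joins i and j, the two reflections act on unrelated data, recorded by `CokAt` and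
`KerAt`.

Naturality needs no formula. A morphism out of a composite of functors C is determined away from i
and j, because A and B generate the spaces there; dually for morphisms into a composite of functors
K (`hom_ext_of_armIn`, `hom_ext_of_armOut`). Hence isomorphisms chosen object by object are natural
as soon as they respect the unchanged spaces (`nonempty_iso`). Conjugation by the equivalences with
modules transports the result. -/

theorem exists_equiv_of_ker_eq {K M N N' : Type*} [Field K] [AddCommGroup M] [Module K M]
    [AddCommGroup N] [Module K N] [AddCommGroup N'] [Module K N'] (f : M →ₗ[K] N) (f' : M →ₗ[K] N')
    (hf : Function.Surjective f) (hf' : Function.Surjective f') (h : ∀ x, f x = 0 ↔ f' x = 0) :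
    ∃ e : N ≃ₗ[K] N', ∀ x, e (f x) = f' x := by
  have hk : LinearMap.ker f = LinearMap.ker f' := Submodule.ext h
  refine ⟨(f.quotKerEquivOfSurjective hf).symm ≪≫ₗ Submodule.quotEquivOfEq _ _ hk ≪≫ₗ
    f'.quotKerEquivOfSurjective hf', fun x => ?_⟩
  have : (f.quotKerEquivOfSurjective hf).symm (f x) = Submodule.Quotient.mk x := by
    rw [LinearEquiv.symm_apply_eq]
    rfl
  rw [LinearEquiv.trans_apply, LinearEquiv.trans_apply, this]
  rfl

theorem exists_equiv_of_range_eq {K M N N' : Type*} [Field K] [AddCommGroup M] [Module K M]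
    [AddCommGroup N] [Module K N] [AddCommGroup N'] [Module K N'] (f : N →ₗ[K] M) (f' : N' →ₗ[K] M)
    (hf : Function.Injective f) (hf' : Function.Injective f')
    (h : ∀ x, (∃ y, f y = x) ↔ ∃ y, f' y = x) :
    ∃ e : N ≃ₗ[K] N', ∀ x, f' (e x) = f x := by
  have hk : LinearMap.range f = LinearMap.range f' := Submodule.ext h
  refine ⟨LinearEquiv.ofInjective f hf ≪≫ₗ LinearEquiv.ofEq _ _ hk ≪≫ₗ
    (LinearEquiv.ofInjective f' hf').symm, fun x => ?_⟩
  have := (LinearEquiv.ofInjective f' hf').apply_symm_apply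
    (LinearEquiv.ofEq _ _ hk (LinearEquiv.ofInjective f hf x))
  exact congrArg Subtype.val this

variable {K : Type v} [Field K]

/-- The part of a representation seen by two vertices: the spaces `X` and `Y` at the vertices, the
maps between them, and the maps from and to the sums `A` and `B` of the other neighbours. -/
structure TwoVertex (K : Type v) [Field K] (A B : Type w) [AddCommGroup A] [Module K A]
    [AddCommGroup B] [Module K B] where
  X : ModuleCat.{w} K
  Y : ModuleCat.{w} K
  outX : X →ₗ[K] A
  inX : A →ₗ[K] X
  toY : X →ₗ[K] Y
  toX : Y →ₗ[K] X
  outY : Y →ₗ[K] B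
  inY : B →ₗ[K] Y

namespace TwoVertex

variable {A B : Type w} [AddCommGroup A] [Module K A] [AddCommGroup B] [Module K B]

/-- The same data with the two vertices exchanged. -/
def swap (D : TwoVertex K A B) : TwoVertex K B A where
  X := D.Y
  Y := D.X
  outX := D.outY
  inX := D.inY
  toY := D.toX
  toX := D.toY
  outY := D.outX
  inY := D.inX

/-- The relations between `D` and a reflection `D₁` of `D` at the first vertex with weight `l`
there. -/
structure IsRefl (l : K) (D D₁ : TwoVertex K A B) (o : D.Y ≃ₗ[K] D₁.Y) : Prop where
  outY_eq : ∀ y, D₁.outY (o y) = D.outY y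
  inY_eq : ∀ b, D₁.inY b = o (D.inY b)
  outX_inX : ∀ a, D₁.outX (D₁.inX a) = D.outX (D.inX a) - l • a
  outX_toX : ∀ y, D₁.outX (D₁.toX (o y)) = D.outX (D.toX y)
  toY_inX : ∀ a, D₁.toY (D₁.inX a) = o (D.toY (D.inX a))

/-- The space at the first vertex of `D₁` is the cokernel of `X → A ⊕ Y`. -/
structure IsCok (e : K) (D D₁ : TwoVertex K A B) (o : D.Y ≃ₗ[K] D₁.Y) : Prop where
  surj : ∀ x, ∃ a y, x = D₁.inX a + e • D₁.toX (o y)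
  ker : ∀ a y, D₁.inX a + e • D₁.toX (o y) = 0 ↔ ∃ x, a = D.outX x ∧ y = D.toY x

/-- The space at the first vertex of `D₁` is the kernel of `A ⊕ Y → X`. -/
structure IsKer (e : K) (D D₁ : TwoVertex K A B) (o : D.Y ≃ₗ[K] D₁.Y) : Prop where
  inj : ∀ x, D₁.outX x = 0 → D₁.toY x = 0 → x = 0
  range : ∀ a y, (∃ x, D₁.outX x = a ∧ D₁.toY x = o y) ↔ D.inX a + e • D.toX y = 0

/-- The values on `D₃` of the paths between `A` and `B`, for an iterated reflection `D₃` of `D`. -/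
structure SamePaths (s : K) (D D₃ : TwoVertex K A B) : Prop where
  outX_inX : ∀ a, D₃.outX (D₃.inX a) = D.outX (D.inX a) - s • a
  outY_inY : ∀ b, D₃.outY (D₃.inY b) = D.outY (D.inY b) - s • b
  outY_toY_inX : ∀ a, D₃.outY (D₃.toY (D₃.inX a)) = D.outY (D.toY (D.inX a))
  outX_toX_inY : ∀ b, D₃.outX (D₃.toX (D₃.inY b)) = D.outX (D.toX (D.inY b))

/-- The spaces of a threefold reflection of `D` by cokernels, as quotients of `A ⊕ B`. -/
structure CokNormal (D D₃ : TwoVertex K A B) : Prop where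
  surjX : ∀ x, ∃ a b, x = D₃.inX a + D₃.toX (D₃.inY b)
  surjY : ∀ y, ∃ a b, y = D₃.toY (D₃.inX a) + D₃.inY b
  kerX : ∀ a b, D₃.inX a + D₃.toX (D₃.inY b) = 0 ↔ ∃ y, a = D.outX (D.toX y) ∧ b = D.outY y
  kerY : ∀ a b, D₃.toY (D₃.inX a) + D₃.inY b = 0 ↔ ∃ x, a = D.outX x ∧ b = D.outY (D.toY x)

/-- The spaces of a threefold reflection of `D` by kernels, as subspaces of `A ⊕ B`. -/
structure KerNormal (D D₃ : TwoVertex K A B) : Prop where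
  injX : ∀ x, D₃.outX x = 0 → D₃.outY (D₃.toY x) = 0 → x = 0
  injY : ∀ y, D₃.outX (D₃.toX y) = 0 → D₃.outY y = 0 → y = 0
  rangeX : ∀ a b, (∃ x, D₃.outX x = a ∧ D₃.outY (D₃.toY x) = b) ↔ D.toY (D.inX a) + D.inY b = 0
  rangeY : ∀ a b, (∃ y, D₃.outX (D₃.toX y) = a ∧ D₃.outY y = b) ↔ D.inX a + D.toX (D.inY b) = 0

/-- The relations of the deformed preprojective algebra at the two vertices. -/
structure Rel (e m n : K) (D : TwoVertex K A B) : Prop where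
  relX : ∀ x, D.inX (D.outX x) + e • D.toX (D.toY x) = m • x
  relY : ∀ y, D.inY (D.outY y) - e • D.toY (D.toX y) = n • y

/-- Compatibility of linear isomorphisms at the two vertices with all maps. -/
structure Intertwines (D D' : TwoVertex K A B) (φ : D.X ≃ₗ[K] D'.X) (ψ : D.Y ≃ₗ[K] D'.Y) :
    Prop where
  outX_eq : ∀ x, D'.outX (φ x) = D.outX x
  inX_eq : ∀ a, φ (D.inX a) = D'.inX a
  toY_eq : ∀ x, ψ (D.toY x) = D'.toY (φ x)
  toX_eq : ∀ y, φ (D.toX y) = D'.toX (ψ y)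
  outY_eq : ∀ y, D'.outY (ψ y) = D.outY y
  inY_eq : ∀ b, ψ (D.inY b) = D'.inY b

variable {D D₁ D₂ D₃ D₃' : TwoVertex K A B}

/-- Exchanging the vertices permutes the conditions of `SamePaths`, and likewise those of
`CokNormal` and `KerNormal` below. The normal forms therefore do not remember which vertex was
reflected first, and this symmetry is the source of the braid relation. -/
theorem SamePaths.of_swap {s : K} (h : SamePaths s D.swap D₃.swap) : SamePaths s D D₃ :=
  ⟨h.outY_inY, h.outX_inX, h.outX_toX_inY, h.outY_toY_inX⟩

theorem CokNormal.of_swap (h : CokNormal D.swap D₃.swap) : CokNormal D D₃ where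
  surjX x := by
    obtain ⟨b, a, h⟩ := h.surjY x
    exact ⟨a, b, h.trans (add_comm _ _)⟩
  surjY x := by
    obtain ⟨b, a, h⟩ := h.surjX x
    exact ⟨a, b, h.trans (add_comm _ _)⟩
  kerX a b := by
    rw [add_comm]
    exact (h.kerY b a).trans (exists_congr fun _ => and_comm)
  kerY a b := by
    rw [add_comm]
    exact (h.kerX b a).trans (exists_congr fun _ => and_comm)

theorem KerNormal.of_swap (h : KerNormal D.swap D₃.swap) : KerNormal D D₃ where
  injX x hx hy := h.injY x hy hx
  injY x hx hy := h.injX x hy hx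
  rangeX a b := by
    rw [add_comm]
    exact (exists_congr fun _ => and_comm).trans (h.rangeY b a)
  rangeY a b := by
    rw [add_comm]
    exact (exists_congr fun _ => and_comm).trans (h.rangeX b a)

/-! ### Normal form of three successive reflections -/

section Chain

variable {e l₁ l₂ l₃ : K} {o₁ : D.Y ≃ₗ[K] D₁.Y} {o₂ : D₁.X ≃ₗ[K] D₂.X} {o₃ : D₂.Y ≃ₗ[K] D₃.Y}

/-- The round trip from A is shifted by the first and third reflections, the one from B only by the
second; `hl` says that the totals agree. A path between A and B passes through both vertices, and no
reflection shifts it. -/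
theorem samePaths_of_isRefl (h₁ : IsRefl l₁ D D₁ o₁) (h₂ : IsRefl l₂ D₁.swap D₂.swap o₂)
    (h₃ : IsRefl l₃ D₂ D₃ o₃) (hl : l₁ + l₃ = l₂) : SamePaths l₂ D D₃ where
  outX_inX a := by
    have e₁ : D₂.inX a = o₂ (D₁.inX a) := h₂.inY_eq a
    have e₂ : ∀ x, D₂.outX (o₂ x) = D₁.outX x := h₂.outY_eq
    rw [h₃.outX_inX, e₁, e₂, h₁.outX_inX, ← hl, add_smul, sub_sub]
  outY_inY b := by
    have e₁ : ∀ b, D₂.outY (D₂.inY b) = D₁.outY (D₁.inY b) - l₂ • b := h₂.outX_inX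
    rw [h₃.inY_eq, h₃.outY_eq, e₁, h₁.inY_eq, h₁.outY_eq]
  outY_toY_inX a := by
    have e₁ : D₂.inX a = o₂ (D₁.inX a) := h₂.inY_eq a
    have e₂ : ∀ x, D₂.outY (D₂.toY (o₂ x)) = D₁.outY (D₁.toY x) := h₂.outX_toX
    rw [h₃.toY_inX, h₃.outY_eq, e₁, e₂, h₁.toY_inX, h₁.outY_eq]
  outX_toX_inY b := by
    have e₁ : D₂.toX (D₂.inY b) = o₂ (D₁.toX (D₁.inY b)) := h₂.toY_inX b
    have e₂ : ∀ x, D₂.outX (o₂ x) = D₁.outX x := h₂.outY_eq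
    rw [h₃.inY_eq, h₃.outX_toX, e₁, e₂, h₁.inY_eq, h₁.outX_toX]

/-- The summand Y of A ⊕ Y → X₁ also enters the relation Y → B ⊕ X₁ that defines Y₂, so it can be
eliminated; in the same way X₁ is eliminated from the third cokernel. The facts `toX₃` and `toY₂`
are these eliminations. -/
theorem cokNormal_of_isCok (he : e * e = 1) (r₁ : IsRefl l₁ D D₁ o₁)
    (r₂ : IsRefl l₂ D₁.swap D₂.swap o₂) (r₃ : IsRefl l₃ D₂ D₃ o₃) (h₁ : IsCok e D D₁ o₁)
    (h₂ : IsCok (-e) D₁.swap D₂.swap o₂) (h₃ : IsCok e D₂ D₃ o₃) : CokNormal D D₃ := by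
  have surj₂ : ∀ y, ∃ b x, y = D₂.inY b + (-e) • D₂.toY (o₂ x) := h₂.surj
  have ker₂ : ∀ b x, D₂.inY b + (-e) • D₂.toY (o₂ x) = 0 ↔ ∃ y, b = D₁.outY y ∧ x = D₁.toX y :=
    h₂.ker
  have outX₂ : ∀ x, D₂.outX (o₂ x) = D₁.outX x := r₂.outY_eq
  have inX₂ : ∀ a, D₂.inX a = o₂ (D₁.inX a) := r₂.inY_eq
  -- The image of X₂ → A ⊕ Y₂ vanishes in X₃, so a summand from Y₂ that comes from X₂ can be traded
  -- for one from A.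
  have toX₃ : ∀ x, D₃.toX (o₃ (D₂.toY x)) = - (e • D₃.inX (D₂.outX x)) := by
    intro x
    have := (h₃.ker (D₂.outX x) (D₂.toY x)).2 ⟨x, rfl, rfl⟩
    have := congrArg (e • ·) this
    simp only [smul_add, smul_smul, he, one_smul, smul_zero] at this
    rw [eq_neg_iff_add_eq_zero, add_comm, this]
  have toY₂ : ∀ y, D₂.toY (o₂ (D₁.toX y)) = e • D₂.inY (D₁.outY y) := by
    intro y
    have := (ker₂ (D₁.outY y) (D₁.toX y)).2 ⟨y, rfl, rfl⟩
    rw [neg_smul, ← sub_eq_add_neg, sub_eq_zero] at this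
    rw [this, smul_smul, he, one_smul]
  have toY_inX₃ : ∀ a, D₃.toY (D₃.inX a) = o₃ (D₂.toY (o₂ (D₁.inX a))) := by
    intro a
    rw [r₃.toY_inX, inX₂]
  refine ⟨fun x => ?_, fun y => ?_, fun a b => ?_, fun a b => ?_⟩
  · obtain ⟨a, y, rfl⟩ := h₃.surj x
    obtain ⟨b, x₁, rfl⟩ := surj₂ y
    -- By `toX₃`, the part of the Y₂-summand that comes from `x₁` contributes `e • D₁.outX x₁` to A,
    -- as the signs `e` and `-e` meet the sign in `toX₃`.
    refine ⟨a + e • D₁.outX x₁, e • b, ?_⟩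
    simp only [map_add, map_neg, map_smul, smul_add, r₃.inY_eq, toX₃, outX₂, smul_neg, neg_smul,
      smul_smul, he, one_smul, neg_neg]
    abel
  · obtain ⟨y, rfl⟩ := o₃.surjective y
    obtain ⟨b, x₁, rfl⟩ := surj₂ y
    obtain ⟨a, y, rfl⟩ := h₁.surj x₁
    -- Here `toY₂` moves the part that comes from `y` into B; the coefficient is `(-e) * e * e =
    -- -e`.
    refine ⟨(-e) • a, b - e • D₁.outY (o₁ y), ?_⟩
    simp only [map_add, map_sub, map_neg, map_smul, smul_add, r₃.inY_eq, toY_inX₃, toY₂, smul_smul,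
      neg_smul, he, one_smul]
    abel
  · rw [r₃.inY_eq]
    -- Inserting `e * e = 1` brings the sum into the form required by `h₃.ker`.
    have : D₃.toX (o₃ (D₂.inY b)) = e • D₃.toX (o₃ (e • D₂.inY b)) := by
      rw [map_smul, map_smul, smul_smul, he, one_smul]
    rw [this, h₃.ker]
    constructor
    · rintro ⟨x, rfl, hx⟩
      obtain ⟨x, rfl⟩ := o₂.surjective x
      -- The equation for the second coordinate lives in Y₂, itself a cokernel, so it produces an
      -- element of Y.
      obtain ⟨y, hb, hy⟩ := (ker₂ b x).1 (by
        rw [← hx, smul_smul, neg_mul, he, neg_smul, one_smul, add_neg_cancel])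
      obtain ⟨y, rfl⟩ := o₁.surjective y
      exact ⟨y, by rw [outX₂, hy, r₁.outX_toX], by rw [hb, r₁.outY_eq]⟩
    · rintro ⟨y, rfl, rfl⟩
      refine ⟨o₂ (D₁.toX (o₁ y)), ?_, ?_⟩
      · rw [outX₂, r₁.outX_toX]
      · rw [toY₂, r₁.outY_eq]
  · rw [toY_inX₃, r₃.inY_eq, ← map_add, LinearEquiv.map_eq_zero_iff]
    have : D₂.toY (o₂ (D₁.inX a)) + D₂.inY b =
        D₂.inY b + (-e) • D₂.toY (o₂ ((-e) • D₁.inX a)) := by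
      rw [map_smul, map_smul, smul_smul, neg_mul_neg, he, one_smul, add_comm]
    rw [this, ker₂]
    constructor
    · rintro ⟨y, rfl, hy⟩
      obtain ⟨y, rfl⟩ := o₁.surjective y
      obtain ⟨x, rfl, rfl⟩ := (h₁.ker a y).1 (by
        rw [← hy, smul_smul, mul_neg, he, neg_smul, one_smul, add_neg_cancel])
      exact ⟨x, rfl, by rw [r₁.outY_eq]⟩
    · rintro ⟨x, rfl, rfl⟩
      refine ⟨o₁ (D.toY x), by rw [r₁.outY_eq], ?_⟩
      have := congrArg (e • ·) ((h₁.ker (D.outX x) (D.toY x)).2 ⟨x, rfl, rfl⟩)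
      simp only [smul_add, smul_smul, he, one_smul, smul_zero] at this
      rw [neg_smul, neg_eq_iff_add_eq_zero, this]

/-- Dually, an element of X₃ consists of a in A and an element of Y₂, which in turn consists of b in
B and an element of X₁; the equation defining X₃ expresses this last element through a. Likewise the
Y-coordinate of the X₁-part of an element of Y₂ is expressed through b. Only a and b survive. -/
theorem kerNormal_of_isKer (he : e * e = 1) (r₁ : IsRefl l₁ D D₁ o₁)
    (r₂ : IsRefl l₂ D₁.swap D₂.swap o₂) (r₃ : IsRefl l₃ D₂ D₃ o₃) (h₁ : IsKer e D D₁ o₁)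
    (h₂ : IsKer (-e) D₁.swap D₂.swap o₂) (h₃ : IsKer e D₂ D₃ o₃) : KerNormal D D₃ := by
  have inj₂ : ∀ y, D₂.outY y = 0 → D₂.toX y = 0 → y = 0 := h₂.inj
  have range₂ : ∀ b x, (∃ y, D₂.outY y = b ∧ D₂.toX y = o₂ x) ↔
      D₁.inY b + (-e) • D₁.toY x = 0 := h₂.range
  have outX₂ : ∀ x, D₂.outX (o₂ x) = D₁.outX x := r₂.outY_eq
  have inX₂ : ∀ a, D₂.inX a = o₂ (D₁.inX a) := r₂.inY_eq
  -- The defining equation of X₃, solved for the X-component of its Y₂-coordinate.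
  have toX₂ : ∀ x y, D₃.toY x = o₃ y → D₂.toX y = - (e • D₂.inX (D₃.outX x)) := by
    intro x y hy
    have := congrArg (e • ·) ((h₃.range (D₃.outX x) y).1 ⟨x, rfl, hy⟩)
    simp only [smul_add, smul_smul, he, one_smul, smul_zero] at this
    rw [eq_neg_iff_add_eq_zero, add_comm, this]
  have toX_inj : ∀ y, D₂.outX (D₂.toX y) = 0 → D₂.outY y = 0 → y = 0 := by
    intro y hx hy
    obtain ⟨x, hx'⟩ := o₂.surjective (D₂.toX y)
    have := (range₂ _ x).1 ⟨y, hy, hx'.symm⟩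
    rw [map_zero, zero_add] at this
    have := congrArg ((-e) • ·) this
    simp only [smul_smul, neg_mul_neg, he, one_smul, smul_zero] at this
    refine inj₂ y hy ?_
    rw [← hx', h₁.inj x (by rw [← outX₂, hx', hx]) this, map_zero]
  refine ⟨fun x hx hy => ?_, fun y hx hy => ?_, fun a b => ?_, fun a b => ?_⟩
  · obtain ⟨y, hy'⟩ := o₃.surjective (D₃.toY x)
    have h := toX₂ x y hy'.symm
    rw [hx, map_zero, smul_zero, neg_zero] at h
    refine h₃.inj x hx ?_
    rw [← hy', inj₂ y (by rw [← r₃.outY_eq, hy', hy]) h, map_zero]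
  · obtain ⟨y, rfl⟩ := o₃.surjective y
    rw [r₃.outY_eq] at hy
    rw [r₃.outX_toX] at hx
    rw [toX_inj y hx hy, map_zero]
  · have : D.toY (D.inX a) + D.inY b = 0 ↔
        D₁.inY b + (-e) • D₁.toY (-(e • D₁.inX a)) = 0 := by
      rw [map_neg, map_smul, smul_neg, neg_smul, neg_neg, smul_smul, he, one_smul, r₁.inY_eq,
        r₁.toY_inX, ← map_add, LinearEquiv.map_eq_zero_iff, add_comm]
    rw [this, ← range₂]
    constructor
    · rintro ⟨x, rfl, rfl⟩
      obtain ⟨y, hy⟩ := o₃.surjective (D₃.toY x)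
      refine ⟨y, by rw [← hy, r₃.outY_eq], ?_⟩
      rw [toX₂ x y hy.symm, inX₂, map_neg, map_smul]
    · rintro ⟨y, rfl, hy⟩
      obtain ⟨x, hx, hx'⟩ := (h₃.range a y).2 (by
        rw [hy, map_neg, map_smul, ← inX₂, smul_neg, smul_smul, he, one_smul, add_neg_cancel])
      exact ⟨x, hx, by rw [hx', r₃.outY_eq]⟩
  · have : D.inX a + D.toX (D.inY b) = D.inX a + e • D.toX (e • D.inY b) := by
      rw [map_smul, smul_smul, he, one_smul]
    rw [this, ← h₁.range]
    -- The equation of Y₂ for the pair of `b` and `x`, solved for the Y-coordinate of `x`.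
    have key : ∀ x, D₁.toY x = o₁ (e • D.inY b) ↔ D₁.inY b + (-e) • D₁.toY x = 0 := by
      intro x
      rw [r₁.inY_eq, map_smul, neg_smul, ← sub_eq_add_neg, sub_eq_zero]
      constructor
      · intro h
        rw [h, smul_smul, he, one_smul]
      · intro h
        rw [h, smul_smul, he, one_smul]
    constructor
    · rintro ⟨y, rfl, rfl⟩
      obtain ⟨y, rfl⟩ := o₃.surjective y
      obtain ⟨x, hx⟩ := o₂.surjective (D₂.toX y)
      refine ⟨x, by rw [r₃.outX_toX, ← hx, outX₂], (key x).2 ?_⟩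
      exact (range₂ _ _).1 ⟨y, by rw [r₃.outY_eq], hx.symm⟩
    · rintro ⟨x, rfl, hx⟩
      obtain ⟨y, hy, hy'⟩ := (range₂ b x).2 ((key x).1 hx)
      exact ⟨o₃ y, by rw [r₃.outX_toX, hy', outX₂], by rw [r₃.outY_eq, hy]⟩

end Chain

theorem Rel.toY_toX {e m n : K} (he : e * e = 1) (h : Rel e m n D) (y : D.Y) :
    D.toY (D.toX y) = e • (D.inY (D.outY y) - n • y) := by
  rw [← h.relY y, sub_sub_cancel, smul_smul, he, one_smul]

theorem Rel.toX_toY {e m n : K} (he : e * e = 1) (h : Rel e m n D) (x : D.X) :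
    D.toX (D.toY x) = e • (m • x - D.inX (D.outX x)) := by
  rw [← h.relX x, add_sub_cancel_left, smul_smul, he, one_smul]

/-- Both pairs of spaces are the same quotients of A ⊕ B, so the isomorphisms exist and commute with
the maps from A and B by construction. Everything else is checked on generators. `SamePaths`
evaluates the maps to A and B; `toX` and `toY` also need the relations at the two vertices. -/
theorem exists_intertwines_of_cokNormal {e m n s : K} (he : e * e = 1)
    (h : CokNormal D D₃) (h' : CokNormal D D₃') (p : SamePaths s D D₃) (p' : SamePaths s D D₃')
    (r : Rel e m n D₃) (r' : Rel e m n D₃') : ∃ φ ψ, Intertwines D₃ D₃' φ ψ := by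
  obtain ⟨φ, hφ⟩ := exists_equiv_of_ker_eq (D₃.inX.coprod (D₃.toX.comp D₃.inY))
    (D₃'.inX.coprod (D₃'.toX.comp D₃'.inY))
    (fun x => by
      obtain ⟨a, b, h⟩ := h.surjX x
      exact ⟨(a, b), h.symm⟩)
    (fun x => by
      obtain ⟨a, b, h⟩ := h'.surjX x
      exact ⟨(a, b), h.symm⟩)
    (fun z => (h.kerX z.1 z.2).trans (h'.kerX z.1 z.2).symm)
  obtain ⟨ψ, hψ⟩ := exists_equiv_of_ker_eq ((D₃.toY.comp D₃.inX).coprod D₃.inY)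
    ((D₃'.toY.comp D₃'.inX).coprod D₃'.inY)
    (fun x => by
      obtain ⟨a, b, h⟩ := h.surjY x
      exact ⟨(a, b), h.symm⟩)
    (fun x => by
      obtain ⟨a, b, h⟩ := h'.surjY x
      exact ⟨(a, b), h.symm⟩)
    (fun z => (h.kerY z.1 z.2).trans (h'.kerY z.1 z.2).symm)
  have φ₁ : ∀ a, φ (D₃.inX a) = D₃'.inX a := fun a => by simpa using hφ (a, 0)
  have φ₂ : ∀ b, φ (D₃.toX (D₃.inY b)) = D₃'.toX (D₃'.inY b) := fun b => by simpa using hφ (0, b)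
  have ψ₁ : ∀ a, ψ (D₃.toY (D₃.inX a)) = D₃'.toY (D₃'.inX a) := fun a => by simpa using hψ (a, 0)
  have ψ₂ : ∀ b, ψ (D₃.inY b) = D₃'.inY b := fun b => by simpa using hψ (0, b)
  refine ⟨φ, ψ, fun x => ?_, φ₁, fun x => ?_, fun y => ?_, fun y => ?_, ψ₂⟩
  · obtain ⟨a, b, rfl⟩ := h.surjX x
    simp only [map_add, φ₁, φ₂, p.outX_inX, p'.outX_inX, p.outX_toX_inY, p'.outX_toX_inY]
  · obtain ⟨a, b, rfl⟩ := h.surjX x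
    -- On a generator `toX (inY b)` the map `toY` completes a round trip, which the relation at Y
    -- rewrites as a round trip to B.
    simp only [map_add, map_sub, map_smul, φ₁, φ₂, ψ₁, ψ₂, r.toY_toX he, r'.toY_toX he, p.outY_inY,
      p'.outY_inY]
  · obtain ⟨a, b, rfl⟩ := h.surjY y
    simp only [map_add, map_sub, map_smul, φ₁, φ₂, ψ₁, ψ₂, r.toX_toY he, r'.toX_toY he, p.outX_inX,
      p'.outX_inX]
  · obtain ⟨a, b, rfl⟩ := h.surjY y
    simp only [map_add, ψ₁, ψ₂, p.outY_inY, p'.outY_inY, p.outY_toY_inX, p'.outY_toY_inX]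

/-- Now the isomorphisms come from equal subspaces of A ⊕ B. Equalities in X or Y are tested after
mapping to A and to B, and the same path values and relations give the results. -/
theorem exists_intertwines_of_kerNormal {e m n s : K} (he : e * e = 1)
    (h : KerNormal D D₃) (h' : KerNormal D D₃') (p : SamePaths s D D₃) (p' : SamePaths s D D₃')
    (r : Rel e m n D₃) (r' : Rel e m n D₃') : ∃ φ ψ, Intertwines D₃ D₃' φ ψ := by
  obtain ⟨φ, hφ⟩ := exists_equiv_of_range_eq (D₃.outX.prod (D₃.outY.comp D₃.toY))
    (D₃'.outX.prod (D₃'.outY.comp D₃'.toY))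
    ((injective_iff_map_eq_zero _).2 fun x hx =>
      h.injX x (congrArg Prod.fst hx) (congrArg Prod.snd hx))
    ((injective_iff_map_eq_zero _).2 fun x hx =>
      h'.injX x (congrArg Prod.fst hx) (congrArg Prod.snd hx))
    (fun z => by
      simp only [Prod.ext_iff]
      exact (h.rangeX z.1 z.2).trans (h'.rangeX z.1 z.2).symm)
  obtain ⟨ψ, hψ⟩ := exists_equiv_of_range_eq ((D₃.outX.comp D₃.toX).prod D₃.outY)
    ((D₃'.outX.comp D₃'.toX).prod D₃'.outY)
    ((injective_iff_map_eq_zero _).2 fun x hx =>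
      h.injY x (congrArg Prod.fst hx) (congrArg Prod.snd hx))
    ((injective_iff_map_eq_zero _).2 fun x hx =>
      h'.injY x (congrArg Prod.fst hx) (congrArg Prod.snd hx))
    (fun z => by
      simp only [Prod.ext_iff]
      exact (h.rangeY z.1 z.2).trans (h'.rangeY z.1 z.2).symm)
  have φ₁ : ∀ x, D₃'.outX (φ x) = D₃.outX x := fun x => congrArg Prod.fst (hφ x)
  have φ₂ : ∀ x, D₃'.outY (D₃'.toY (φ x)) = D₃.outY (D₃.toY x) := fun x => congrArg Prod.snd (hφ x)
  have ψ₁ : ∀ x, D₃'.outX (D₃'.toX (ψ x)) = D₃.outX (D₃.toX x) := fun x => congrArg Prod.fst (hψ x)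
  have ψ₂ : ∀ x, D₃'.outY (ψ x) = D₃.outY x := fun x => congrArg Prod.snd (hψ x)
  -- The two coordinates in A and B are jointly injective, so they detect equality in X; `extY` does
  -- the same for Y.
  have extX : ∀ x y, D₃'.outX x = D₃'.outX y → D₃'.outY (D₃'.toY x) = D₃'.outY (D₃'.toY y) →
      x = y := fun x y h₁ h₂ => sub_eq_zero.1 <| h'.injX _ (by rw [map_sub, h₁, sub_self])
    (by rw [map_sub, map_sub, h₂, sub_self])
  have extY : ∀ x y, D₃'.outX (D₃'.toX x) = D₃'.outX (D₃'.toX y) → D₃'.outY x = D₃'.outY y →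
      x = y := fun x y h₁ h₂ => sub_eq_zero.1 <| h'.injY _
    (by rw [map_sub, map_sub, h₁, sub_self]) (by rw [map_sub, h₂, sub_self])
  refine ⟨φ, ψ, φ₁, fun a => extX _ _ ?_ ?_, fun x => extY _ _ ?_ ?_, fun y => extX _ _ ?_ ?_, ψ₂,
    fun b => extY _ _ ?_ ?_⟩
  · rw [φ₁, p.outX_inX, p'.outX_inX]
  · rw [φ₂, p.outY_toY_inX, p'.outY_toY_inX]
  · simp only [ψ₁, r.toX_toY he, r'.toX_toY he, map_sub, map_smul, p.outX_inX, p'.outX_inX, φ₁]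
  · rw [ψ₂, φ₂]
  · rw [φ₁, ψ₁]
  · simp only [φ₂, r.toY_toX he, r'.toY_toX he, map_sub, map_smul, p.outY_inY, p'.outY_inY, ψ₂]
  · rw [ψ₁, p.outX_toX_inY, p'.outX_toX_inY]
  · rw [ψ₂, p.outY_inY, p'.outY_inY]

end TwoVertex

end TwoVertex

/-! ### The spaces and maps of the reflected representations -/

section Rules

variable {K : Type v} [Field K] {I : Type u} [Quiver.{u} I] [Fintype I] [DecidableEq I]
  [∀ i j : I, Fintype (i ⟶ j)] {lam lam' : I → K}

theorem rev_rev {i j : I} (a : DArr i j) : rev (rev a) = a := by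
  cases a <;> rfl

namespace DPRep

variable (V : DPRep.{u, v, w} lam)

/-- The identification of `V_k` with `C_i(V)_k` for `k ≠ i`. -/
def cOutAux {i k : I} (h : k ≠ i) : ∀ d : Decidable (k = i), V.obj k ≃ₗ[K] V.cObj i k d
  | isTrue h' => absurd h' h
  | isFalse _ => LinearEquiv.refl K _

/-- The identification of `V_k` with `C_i(V)_k` for `k ≠ i`. -/
def cOut {i : I} (hi : LoopFree i) (k : I) (h : k ≠ i) : V.obj k ≃ₗ[K] (V.cRep hi).obj k :=
  V.cOutAux h inferInstance

/-- The canonical map `V_⊕ → C_i(V)_i`. -/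
def cTopAux (i : I) : ∀ d : Decidable (i = i), V.plus i →ₗ[K] V.cObj i i d
  | isTrue _ => V.cokProj i
  | isFalse h => absurd rfl h

/-- The canonical map `V_⊕ → C_i(V)_i`. -/
def cTop {i : I} (hi : LoopFree i) : V.plus i →ₗ[K] (V.cRep hi).obj i :=
  V.cTopAux i inferInstance

/-- The identification of `V_k` with `K_i(V)_k` for `k ≠ i`. -/
def kOutAux {i k : I} (h : k ≠ i) : ∀ d : Decidable (k = i), V.obj k ≃ₗ[K] V.kObj i k d
  | isTrue h' => absurd h' h
  | isFalse _ => LinearEquiv.refl K _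

/-- The identification of `V_k` with `K_i(V)_k` for `k ≠ i`. -/
def kOut {i : I} (hi : LoopFree i) (k : I) (h : k ≠ i) : V.obj k ≃ₗ[K] (V.kRep hi).obj k :=
  V.kOutAux h inferInstance

/-- The canonical map `K_i(V)_i → V_⊕`. -/
def kTopAux (i : I) : ∀ d : Decidable (i = i), V.kObj i i d →ₗ[K] V.plus i
  | isTrue _ => V.kerIncl i
  | isFalse h => absurd rfl h

/-- The canonical map `K_i(V)_i → V_⊕`. -/
def kTop {i : I} (hi : LoopFree i) : (V.kRep hi).obj i →ₗ[K] V.plus i :=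
  V.kTopAux i inferInstance

variable {i : I} (hi : LoopFree i)

/-- The spaces and maps of `cRep` and `kRep` are defined by matching on decisions of `k = i`, which
do not reduce for a variable `k`. This rule and the following ones are therefore proved for all
decisions, where each case is impossible or definitional, and then specialised. -/
theorem cRep_map_out {k l : I} (a : DArr k l) (hk : k ≠ i) (hl : l ≠ i) (v : V.obj k) :
    (V.cRep hi).map a (V.cOut hi k hk v) = V.cOut hi l hl (V.map a v) := by
  have : ∀ dk dl, V.cMap i a dk dl (V.cOutAux hk dk v) = V.cOutAux hl dl (V.map a v) := by
    rintro (_ | h) (_ | h')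
    · rfl
    · exact absurd h' hl
    · exact absurd h hk
    · exact absurd h hk
  exact this _ _

theorem cRep_map_in {k : I} (a : DArr k i) (hk : k ≠ i) (v : V.obj k) :
    (V.cRep hi).map a (V.cOut hi k hk v) = eps K a • V.cTop hi (V.inj ⟨k, a⟩ v) := by
  have : ∀ dk di, V.cMap i a dk di (V.cOutAux hk dk v) =
      eps K a • V.cTopAux i di (V.inj ⟨k, a⟩ v) := by
    rintro (_ | h) (h' | _)
    · exact absurd rfl h'
    · rfl
    · exact absurd h hk
    · exact absurd h hk
  exact this _ _

theorem cRep_map_top {k : I} (a : DArr i k) (hk : k ≠ i) (y : V.plus i) :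
    (V.cRep hi).map a (V.cTop hi y) = V.cOut hi k hk (V.theta i y ⟨k, rev a⟩) := by
  have : ∀ di dk, V.cMap i a di dk (V.cTopAux i di y) =
      V.cOutAux hk dk (V.theta i y ⟨k, rev a⟩) := by
    rintro (h' | _) (_ | h)
    · exact absurd rfl h'
    · exact absurd rfl h'
    · rfl
    · exact absurd h hk
  exact this _ _

theorem cTop_surjective : Function.Surjective (V.cTop hi) := by
  have : ∀ di, Function.Surjective (V.cTopAux i di) := by
    rintro (h | _)
    · exact absurd rfl h
    · exact Submodule.mkQ_surjective _
  exact this _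

theorem cTop_eq_zero (y : V.plus i) : V.cTop hi y = 0 ↔ ∃ x, V.mu i x = y := by
  have : ∀ di, V.cTopAux i di y = 0 ↔ ∃ x, V.mu i x = y := by
    rintro (h | _)
    · exact absurd rfl h
    · exact Submodule.Quotient.mk_eq_zero _
  exact this _

theorem kRep_map_out {k l : I} (a : DArr k l) (hk : k ≠ i) (hl : l ≠ i) (v : V.obj k) :
    (V.kRep hi).map a (V.kOut hi k hk v) = V.kOut hi l hl (V.map a v) := by
  have : ∀ dk dl, V.kMap i a dk dl (V.kOutAux hk dk v) = V.kOutAux hl dl (V.map a v) := by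
    rintro (_ | h) (_ | h')
    · rfl
    · exact absurd h' hl
    · exact absurd h hk
    · exact absurd h hk
  exact this _ _

theorem kTop_map {k : I} (a : DArr k i) (hk : k ≠ i) (v : V.obj k) :
    V.kTop hi ((V.kRep hi).map a (V.kOut hi k hk v)) = eps K a • V.theta i (V.inj ⟨k, a⟩ v) := by
  have : ∀ dk di, V.kTopAux i di (V.kMap i a dk di (V.kOutAux hk dk v)) =
      eps K a • V.theta i (V.inj ⟨k, a⟩ v) := by
    rintro (_ | h) (h' | _)
    · exact absurd rfl h'
    · rfl
    · exact absurd h hk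
    · exact absurd h hk
  exact this _ _

theorem kRep_map_eq {k : I} (a : DArr i k) (hk : k ≠ i) (x : (V.kRep hi).obj i) :
    (V.kRep hi).map a x = V.kOut hi k hk (V.kTop hi x ⟨k, rev a⟩) := by
  have : ∀ di dk x, V.kMap i a di dk x = V.kOutAux hk dk (V.kTopAux i di x ⟨k, rev a⟩) := by
    rintro (h' | _) (_ | h) x
    · exact absurd rfl h'
    · exact absurd rfl h'
    · rfl
    · exact absurd h hk
  exact this _ _ _

theorem kTop_injective : Function.Injective (V.kTop hi) := by
  have : ∀ di, Function.Injective (V.kTopAux i di) := by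
    rintro (h | _)
    · exact absurd rfl h
    · exact Subtype.val_injective
  exact this _

theorem exists_kTop_eq (y : V.plus i) : (∃ x, V.kTop hi x = y) ↔ V.pi i y = 0 := by
  have : ∀ di, (∃ x, V.kTopAux i di x = y) ↔ V.pi i y = 0 := by
    rintro (h | _)
    · exact absurd rfl h
    · exact ⟨fun ⟨x, hx⟩ => hx ▸ x.2, fun h => ⟨⟨y, h⟩, rfl⟩⟩
  exact this _

variable {V}

theorem cFunctor_map_out {U : DPRep.{u, v, w} lam} (f : U ⟶ V) (k : I) (hk : k ≠ i) (x : U.obj k) :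
    ((cFunctor lam hi).map f).app k (U.cOut hi k hk x) = V.cOut hi k hk (f.app k x) := by
  have : ∀ d, cApp f i k d (U.cOutAux hk d x) = V.cOutAux hk d (f.app k x) := by
    rintro (_ | h)
    · rfl
    · exact absurd h hk
  exact this _

theorem kFunctor_map_out {U : DPRep.{u, v, w} lam} (f : U ⟶ V) (k : I) (hk : k ≠ i) (x : U.obj k) :
    ((kFunctor lam hi).map f).app k (U.kOut hi k hk x) = V.kOut hi k hk (f.app k x) := by
  have : ∀ d, kApp f i k d (U.kOutAux hk d x) = V.kOutAux hk d (f.app k x) := by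
    rintro (_ | h)
    · rfl
    · exact absurd h hk
  exact this _

/-- What `C_i(V)` and `K_i(V)` have in common: outside of `i` nothing changes, and the paths of
length two through `i` are given by the map `μ π - λ_i`. -/
structure IsReflection (i : I) (V : DPRep.{u, v, w} lam) (W : DPRep.{u, v, w} lam')
    (o : ∀ k, k ≠ i → V.obj k ≃ₗ[K] W.obj k) : Prop where
  map_out : ∀ {k l : I} (a : DArr k l) (hk : k ≠ i) (hl : l ≠ i) (v : V.obj k),
    W.map a (o k hk v) = o l hl (V.map a v)
  map_map_out : ∀ {k l : I} (a : DArr k i) (b : DArr i l) (hk : k ≠ i) (hl : l ≠ i) (v : V.obj k),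
    W.map b (W.map a (o k hk v)) = eps K a • o l hl (V.theta i (V.inj ⟨k, a⟩ v) ⟨l, rev b⟩)

variable (V)

/-- A path through i enters by `c` and leaves through `γ`, and `γ c = μ π - λ_i`. For `kRep` the
factors are distributed differently, `γ` on entering and `ι` on leaving, but the composite is the
same. -/
theorem isReflection_cRep : IsReflection i V (V.cRep hi) (V.cOut hi) where
  map_out := V.cRep_map_out hi
  map_map_out a b hk hl v := by
    rw [cRep_map_in, map_smul, cRep_map_top _ _ _ hl]

theorem isReflection_kRep : IsReflection i V (V.kRep hi) (V.kOut hi) where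
  map_out := V.kRep_map_out hi
  map_map_out a b hk hl v := by
    rw [kRep_map_eq _ _ _ hl, kTop_map, Pi.smul_apply, map_smul]

end DPRep

end Rules

/-! ### Representations with fixed spaces outside of two vertices -/

section Marking

variable {K : Type v} [Field K] {I : Type u} [Quiver.{u} I] [Fintype I] [DecidableEq I]
  [∀ i j : I, Fintype (i ⟶ j)] {lam lam' : I → K} {P : I → Prop} [DecidablePred P]

/-- The arrows of the double with head `i` and tail in `P`. -/
abbrev ArmIdx (P : I → Prop) (i : I) : Type u := Σ k : Subtype P, DArr k.1 i

/-- The sum of the spaces `E_{t(a)}` over the arrows with head `i` and tail in `P`. -/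
abbrev Arm (E : Subtype P → ModuleCat.{max u w} K) (i : I) : Type (max u w) :=
  ∀ x : ArmIdx P i, E x.1

/-- Isomorphisms of given spaces with the spaces of a representation at the vertices in `P`. -/
abbrev Marking (E : Subtype P → ModuleCat.{max u w} K) (W : DPRep.{u, v, w} lam) :
    Type (max u w) :=
  ∀ k : Subtype P, E k ≃ₗ[K] W.obj k.1

/-- The inclusion into `W_⊕` of the summands given by the arrows from `j` to `i`. -/
def DPRep.linkIncl (W : DPRep.{u, v, w} lam) (i j : I) (t : DArr j i → W.obj j) : W.plus i :=
  ∑ c : DArr j i, W.inj ⟨j, c⟩ (t c)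

namespace Marking

open DPRep

variable {E : Subtype P → ModuleCat.{max u w} K} {W : DPRep.{u, v, w} lam}
  {W₁ : DPRep.{u, v, w} lam'} (o : Marking E W) {i j : I}

/-- The map from `W_i` to the sum of the spaces at the neighbours of `i` in `P`. -/
def armOut (i : I) : W.obj i →ₗ[K] Arm E i :=
  LinearMap.pi fun x => ((o x.1).symm : W.obj x.1.1 →ₗ[K] E x.1).comp (W.map (rev x.2))

/-- The inclusion of the sum of the spaces at the neighbours of `i` in `P` into `W_⊕`. -/
def armIncl (i : I) : Arm E i →ₗ[K] W.plus i :=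
  ∑ x : ArmIdx P i, (W.inj ⟨x.1.1, x.2⟩).comp
    ((o x.1 : E x.1 →ₗ[K] W.obj x.1.1).comp (LinearMap.proj x))

/-- The map to `W_i` from the sum of the spaces at the neighbours of `i` in `P`. -/
def armIn (i : I) : Arm E i →ₗ[K] W.obj i := (W.pi i).comp (o.armIncl i)

theorem armOut_apply (i : I) (v : W.obj i) (x : ArmIdx P i) :
    o.armOut i v x = (o x.1).symm (W.map (rev x.2) v) := rfl

theorem armIncl_apply (i : I) (a : Arm E i) :
    o.armIncl i a = ∑ x : ArmIdx P i, W.inj ⟨x.1.1, x.2⟩ (o x.1 (a x)) := by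
  simp [armIncl]

theorem armIn_apply (i : I) (a : Arm E i) :
    o.armIn i a = ∑ x : ArmIdx P i, eps K x.2 • W.map x.2 (o x.1 (a x)) := by
  rw [armIn, LinearMap.comp_apply, armIncl_apply, map_sum]
  exact Finset.sum_congr rfl fun x _ => W.pi_inj _ _

theorem armIncl_of_mem (i : I) (a : Arm E i) (k : Subtype P) (c : DArr k.1 i) :
    o.armIncl i a ⟨k.1, c⟩ = o k (a ⟨k, c⟩) := by
  rw [armIncl_apply, Finset.sum_apply, Finset.sum_eq_single ⟨k, c⟩]
  · exact W.inj_same _ _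
  · rintro ⟨l, d⟩ _ h
    refine W.inj_ne ?_ _
    rintro h'
    obtain ⟨l, hl⟩ := l
    obtain ⟨k, hk⟩ := k
    obtain ⟨rfl, h'⟩ := Sigma.mk.inj h'
    exact h (by rw [eq_of_heq h'])
  · exact fun h => absurd (Finset.mem_univ _) h

theorem armIncl_of_notMem (i : I) (a : Arm E i) {j : I} (hj : ¬ P j) (c : DArr j i) :
    o.armIncl i a ⟨j, c⟩ = 0 := by
  rw [armIncl_apply, Finset.sum_apply]
  refine Finset.sum_eq_zero fun x _ => W.inj_ne ?_ _
  rintro h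
  have h' : j = x.1.1 := congrArg Sigma.fst h
  exact hj (h' ▸ x.1.2)

/-- Recovers single arrows from the combined map, so that compatibility with `armIn` gives
compatibility with each arrow. The factor `eps K c` cancels the sign built into `π`. -/
theorem map_eq_armIn [DecidableEq (ArmIdx P i)] (k : Subtype P) (c : DArr k.1 i) (v : E k) :
    W.map c (o k v) =
      o.armIn i (Pi.single (M := fun x : ArmIdx P i => E x.1) ⟨k, c⟩ (eps K c • v)) := by
  rw [armIn_apply, Finset.sum_eq_single ⟨k, c⟩]
  · rw [Pi.single_eq_same, map_smul, map_smul, smul_smul, eps_mul_self, one_smul]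
  · intro x _ hx
    rw [Pi.single_eq_of_ne hx, map_zero, map_zero, smul_zero]
  · exact fun h => absurd (Finset.mem_univ _) h

theorem linkIncl_same (i j : I) (t : DArr j i → W.obj j) (c : DArr j i) :
    W.linkIncl i j t ⟨j, c⟩ = t c := by
  rw [linkIncl, Finset.sum_apply, Finset.sum_eq_single c]
  · exact W.inj_same _ _
  · intro d _ h
    refine W.inj_ne ?_ _
    rintro h'
    exact h (eq_of_heq (Sigma.mk.inj h').2).symm
  · exact fun h => absurd (Finset.mem_univ _) h

theorem linkIncl_ne (i j : I) (t : DArr j i → W.obj j) {k : I} (hk : k ≠ j) (c : DArr k i) :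
    W.linkIncl i j t ⟨k, c⟩ = 0 := by
  rw [linkIncl, Finset.sum_apply]
  exact Finset.sum_eq_zero fun x _ => W.inj_ne (fun h => hk (congrArg Sigma.fst h)) _

theorem pi_linkIncl (i j : I) (t : DArr j i → W.obj j) :
    W.pi i (W.linkIncl i j t) = ∑ c : DArr j i, eps K c • W.map c (t c) := by
  rw [linkIncl, map_sum]
  exact Finset.sum_congr rfl fun x _ => W.pi_inj _ _

/-- As i is loop-free and `P` omits only i and j, every arrow into i starts in `P` or at j. This is
the splitting of V_⊕ into the arm A and the copies of V_j. -/
theorem eq_armIncl_add_linkIncl (hi : LoopFree i) (hP : ∀ k, P k ↔ k ≠ i ∧ k ≠ j)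
    (y : W.plus i) (a : Arm E i) (t : DArr j i → W.obj j)
    (ha : ∀ x : ArmIdx P i, y ⟨x.1.1, x.2⟩ = o x.1 (a x)) (ht : ∀ c, y ⟨j, c⟩ = t c) :
    y = o.armIncl i a + W.linkIncl i j t := by
  funext x
  obtain ⟨k, c⟩ := x
  rw [Pi.add_apply]
  by_cases hk : P k
  · rw [o.armIncl_of_mem i a ⟨k, hk⟩ c, linkIncl_ne _ _ _ ((hP k).1 hk).2, add_zero]
    exact ha ⟨⟨k, hk⟩, c⟩
  · rw [hP, not_and_or, not_not, not_not] at hk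
    rcases hk with rfl | rfl
    · exact (no_loop hi c rfl rfl).elim
    · rw [linkIncl_same, armIncl_of_notMem _ _ _ (fun h => ((hP k).1 h).2 rfl), zero_add, ht]

theorem mu_eq (hi : LoopFree i) (hP : ∀ k, P k ↔ k ≠ i ∧ k ≠ j)
    (x : W.obj i) :
    W.mu i x = o.armIncl i (o.armOut i x) + W.linkIncl i j fun c => W.map (rev c) x :=
  o.eq_armIncl_add_linkIncl hi hP _ _ _
    (fun x => by rw [armOut_apply, LinearEquiv.apply_symm_apply]; rfl) fun _ => rfl

theorem armIn_armOut (hi : LoopFree i) (hP : ∀ k, P k ↔ k ≠ i ∧ k ≠ j)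
    (x : W.obj i) :
    o.armIn i (o.armOut i x) + ∑ c : DArr j i, eps K c • W.map c (W.map (rev c) x) = lam i • x := by
  rw [← W.pi_mu, o.mu_eq hi hP, map_add, pi_linkIncl]
  rfl

/-- The marking of a reflected representation. -/
def trans (r : ∀ k, k ≠ i → W.obj k ≃ₗ[K] W₁.obj k) (hPi : ∀ k, P k → k ≠ i) : Marking E W₁ :=
  fun k => (o k).trans (r k.1 (hPi k.1 k.2))

/-! ### Effect of one reflection on arms and links -/

section IsReflection

variable {r : ∀ k, k ≠ i → W.obj k ≃ₗ[K] W₁.obj k}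

theorem trans_armOut_of_ne (hr : IsReflection i W W₁ r) (hPi : ∀ k, P k → k ≠ i)
    {j : I} (hj : j ≠ i) (y : W.obj j) :
    (o.trans r hPi).armOut j (r j hj y) = o.armOut j y := by
  funext x
  rw [armOut_apply, armOut_apply, hr.map_out _ hj (hPi _ x.1.2)]
  exact congrArg (o x.1).symm (LinearEquiv.symm_apply_apply _ _)

theorem trans_armIn_of_ne (hr : IsReflection i W W₁ r) (hPi : ∀ k, P k → k ≠ i)
    {j : I} (hj : j ≠ i) (b : Arm E j) :
    (o.trans r hPi).armIn j b = r j hj (o.armIn j b) := by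
  rw [armIn_apply, armIn_apply, map_sum]
  refine Finset.sum_congr rfl fun x _ => ?_
  rw [map_smul, ← hr.map_out _ (hPi _ x.1.2) hj]
  rfl

/-- The sign in `armIn` cancels the sign in `map_map_out`, so the whole arm passes through i by `μ π
- λ_i` without signs. -/
theorem map_trans_armIn (hr : IsReflection i W W₁ r) (hPi : ∀ k, P k → k ≠ i)
    {l : I} (b : DArr i l) (hl : l ≠ i) (a : Arm E i) :
    W₁.map b ((o.trans r hPi).armIn i a) = r l hl (W.theta i (o.armIncl i a) ⟨l, rev b⟩) := by
  rw [armIn_apply, armIncl_apply, map_sum, map_sum, Finset.sum_apply, map_sum]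
  refine Finset.sum_congr rfl fun x _ => ?_
  rw [map_smul]
  have := hr.map_map_out x.2 b (hPi _ x.1.2) hl (o x.1 (a x))
  refine (congrArg (eps K x.2 • ·) this).trans ?_
  simp only [smul_smul, eps_mul_self, one_smul]

theorem trans_armOut_armIn (hr : IsReflection i W W₁ r) (hPi : ∀ k, P k → k ≠ i)
    (a : Arm E i) :
    (o.trans r hPi).armOut i ((o.trans r hPi).armIn i a) =
      o.armOut i (o.armIn i a) - lam i • a := by
  funext x
  rw [armOut_apply, o.map_trans_armIn hr hPi _ (hPi _ x.1.2), rev_rev]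
  refine (congrArg (o x.1).symm (LinearEquiv.symm_apply_apply _ _)).trans ?_
  have : W.theta i (o.armIncl i a) ⟨x.1.1, x.2⟩ =
      W.map (rev x.2) (o.armIn i a) - lam i • o.armIncl i a ⟨x.1.1, x.2⟩ := rfl
  rw [this, armIncl_of_mem, map_sub, map_smul, LinearEquiv.symm_apply_apply]
  rfl

/-- The term `-λ_i` of `μ π - λ_i` only joins a summand to itself. The link from j and the arms are
different summands, so no shift occurs; the same holds in the opposite direction in
`link_trans_armIn`. -/
theorem trans_armOut_link (hr : IsReflection i W W₁ r) (hPi : ∀ k, P k → k ≠ i)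
    (hj : j ≠ i) (hPj : ¬ P j) (c : DArr j i) (y : W.obj j) :
    (o.trans r hPi).armOut i (W₁.map c (r j hj y)) = o.armOut i (W.map c y) := by
  funext x
  rw [armOut_apply, hr.map_map_out _ _ hj (hPi _ x.1.2), rev_rev, ← map_smul]
  refine (congrArg (o x.1).symm (LinearEquiv.symm_apply_apply _ _)).trans ?_
  have : W.theta i (W.inj ⟨j, c⟩ y) ⟨x.1.1, x.2⟩ =
      W.map (rev x.2) (W.pi i (W.inj ⟨j, c⟩ y)) - lam i • W.inj ⟨j, c⟩ y ⟨x.1.1, x.2⟩ := rfl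
  have hne : (⟨x.1.1, x.2⟩ : InArr i) ≠ ⟨j, c⟩ := fun h => by
    have h' : x.1.1 = j := congrArg Sigma.fst h
    exact hPj (h' ▸ x.1.2)
  rw [this, W.inj_ne hne, smul_zero,
    sub_zero, W.pi_inj, map_smul, map_smul, map_smul, smul_smul, eps_mul_self, one_smul]
  rfl

theorem link_trans_armIn (hr : IsReflection i W W₁ r) (hPi : ∀ k, P k → k ≠ i)
    (hj : j ≠ i) (hPj : ¬ P j) (c : DArr i j) (a : Arm E i) :
    W₁.map c ((o.trans r hPi).armIn i a) = r j hj (W.map c (o.armIn i a)) := by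
  rw [o.map_trans_armIn hr hPi c hj]
  have : W.theta i (o.armIncl i a) ⟨j, rev c⟩ =
      W.map (rev (rev c)) (o.armIn i a) - lam i • o.armIncl i a ⟨j, rev c⟩ := rfl
  rw [this, armIncl_of_notMem _ _ _ hPj, smul_zero, sub_zero, rev_rev]

end IsReflection

/-! ### Generators and relations of the cokernel -/

section Cok

theorem cTop_armIncl (hi : LoopFree i) (hPi : ∀ k, P k → k ≠ i)
    (a : Arm E i) :
    W.cTop hi (o.armIncl i a) = (o.trans (W.cOut hi) hPi).armIn i a := by
  rw [armIn_apply, armIncl_apply, map_sum]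
  refine Finset.sum_congr rfl fun x _ => ?_
  have := W.cRep_map_in hi x.2 (hPi _ x.1.2) (o x.1 (a x))
  refine Eq.trans ?_ (congrArg (eps K x.2 • ·) this).symm
  simp only [smul_smul, eps_mul_self, one_smul]

theorem cTop_linkIncl (hi : LoopFree i)
    (hj : j ≠ i) (t : DArr j i → W.obj j) :
    W.cTop hi (W.linkIncl i j t) =
      ∑ c : DArr j i, eps K c • (W.cRep hi).map c (W.cOut hi j hj (t c)) := by
  rw [linkIncl, map_sum]
  refine Finset.sum_congr rfl fun c _ => ?_
  rw [cRep_map_in, smul_smul, eps_mul_self, one_smul]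

theorem exists_cRep_eq (hi : LoopFree i) (hP : ∀ k, P k ↔ k ≠ i ∧ k ≠ j)
    (hPi : ∀ k, P k → k ≠ i)
    (hj : j ≠ i) (x : (W.cRep hi).obj i) :
    ∃ (a : Arm E i) (t : DArr j i → W.obj j), x = (o.trans (W.cOut hi) hPi).armIn i a +
      ∑ c : DArr j i, eps K c • (W.cRep hi).map c (W.cOut hi j hj (t c)) := by
  obtain ⟨y, rfl⟩ := W.cTop_surjective hi x
  refine ⟨fun x => (o x.1).symm (y ⟨x.1.1, x.2⟩), fun c => y ⟨j, c⟩, ?_⟩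
  rw [← cTop_armIncl, ← cTop_linkIncl, ← map_add]
  refine congrArg _ (o.eq_armIncl_add_linkIncl hi hP _ _ _ (fun x => ?_) fun _ => rfl)
  rw [LinearEquiv.apply_symm_apply]

/-- The kernel of `c` is the image of `μ`, here compared summand by summand along the splitting of
V_⊕. -/
theorem cRep_eq_zero_iff (hi : LoopFree i) (hP : ∀ k, P k ↔ k ≠ i ∧ k ≠ j)
    (hPi : ∀ k, P k → k ≠ i)
    (hj : j ≠ i) (a : Arm E i) (t : DArr j i → W.obj j) :
    (o.trans (W.cOut hi) hPi).armIn i a +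
      ∑ c : DArr j i, eps K c • (W.cRep hi).map c (W.cOut hi j hj (t c)) = 0 ↔
    ∃ x, a = o.armOut i x ∧ ∀ c, t c = W.map (rev c) x := by
  rw [← cTop_armIncl, ← cTop_linkIncl, ← map_add, cTop_eq_zero]
  refine exists_congr fun x => ⟨fun h => ⟨?_, fun c => ?_⟩, ?_⟩
  · funext z
    rw [armOut_apply, LinearEquiv.eq_symm_apply, ← armIncl_of_mem]
    have := congrFun h ⟨z.1.1, z.2⟩
    rw [Pi.add_apply, linkIncl_ne _ _ _ ((hP _).1 z.1.2).2, add_zero] at this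
    exact this.symm
  · have := congrFun h ⟨j, c⟩
    rw [Pi.add_apply, linkIncl_same, armIncl_of_notMem _ _ _ (fun h => ((hP j).1 h).2 rfl),
      zero_add] at this
    exact this.symm
  · rintro ⟨rfl, ht⟩
    rw [o.mu_eq hi hP, ← funext ht]

end Cok

/-! ### Coordinates and equations of the kernel -/

section Ker

/-- The arrows leaving i in K_i(V) are the coordinate projections of the kernel, so the values along
them recover the element of V_⊕. -/
theorem kTop_eq (hi : LoopFree i) (hP : ∀ k, P k ↔ k ≠ i ∧ k ≠ j)
    (hPi : ∀ k, P k → k ≠ i)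
    (hj : j ≠ i) (x : (W.kRep hi).obj i) (a : Arm E i) (t : DArr j i → W.obj j)
    (ha : (o.trans (W.kOut hi) hPi).armOut i x = a)
    (ht : ∀ c, (W.kRep hi).map (rev c) x = W.kOut hi j hj (t c)) :
    W.kTop hi x = o.armIncl i a + W.linkIncl i j t := by
  refine o.eq_armIncl_add_linkIncl hi hP _ _ _ (fun z => ?_) fun c => ?_
  · rw [← ha, armOut_apply, kRep_map_eq _ _ _ (hPi _ z.1.2), rev_rev]
    refine Eq.trans ?_ (congrArg (o z.1) (congrArg (o z.1).symm
      (LinearEquiv.symm_apply_apply _ _).symm))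
    rw [LinearEquiv.apply_symm_apply]
  · have := ht c
    rw [kRep_map_eq _ _ _ hj, rev_rev] at this
    exact (W.kOut hi j hj).injective this

theorem kRep_eq_zero (hi : LoopFree i) (hP : ∀ k, P k ↔ k ≠ i ∧ k ≠ j)
    (hPi : ∀ k, P k → k ≠ i)
    (hj : j ≠ i) (x : (W.kRep hi).obj i)
    (ha : (o.trans (W.kOut hi) hPi).armOut i x = 0)
    (ht : ∀ c : DArr j i, (W.kRep hi).map (rev c) x = 0) : x = 0 := by
  refine W.kTop_injective hi ?_
  rw [o.kTop_eq hi hP hPi hj x 0 0 ha (fun c => by rw [ht, Pi.zero_apply, map_zero]), map_zero,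
    map_zero, zero_add, linkIncl]
  exact Finset.sum_eq_zero fun c _ => map_zero _

theorem exists_kRep_eq_iff (hi : LoopFree i) (hP : ∀ k, P k ↔ k ≠ i ∧ k ≠ j)
    (hPi : ∀ k, P k → k ≠ i)
    (hj : j ≠ i) (a : Arm E i) (t : DArr j i → W.obj j) :
    (∃ x, (o.trans (W.kOut hi) hPi).armOut i x = a ∧
      ∀ c, (W.kRep hi).map (rev c) x = W.kOut hi j hj (t c)) ↔
    o.armIn i a + ∑ c : DArr j i, eps K c • W.map c (t c) = 0 := by
  have : o.armIn i a + ∑ c : DArr j i, eps K c • W.map c (t c) =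
      W.pi i (o.armIncl i a + W.linkIncl i j t) := by
    rw [map_add, pi_linkIncl]
    rfl
  rw [this, ← W.exists_kTop_eq hi]
  refine exists_congr fun x => ⟨fun h => o.kTop_eq hi hP hPi hj x a t h.1 h.2, fun h => ?_⟩
  refine ⟨funext fun z => ?_, fun c => ?_⟩
  · rw [armOut_apply, kRep_map_eq _ _ _ (hPi _ z.1.2), rev_rev]
    refine (congrArg (o z.1).symm (LinearEquiv.symm_apply_apply _ _)).trans ?_
    rw [h, Pi.add_apply, linkIncl_ne _ _ _ ((hP _).1 z.1.2).2, add_zero, armIncl_of_mem,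
      LinearEquiv.symm_apply_apply]
  · rw [kRep_map_eq _ _ _ hj, rev_rev, h, Pi.add_apply, linkIncl_same,
      armIncl_of_notMem _ _ _ (fun h => ((hP j).1 h).2 rfl), zero_add]

end Ker

end Marking
end Marking

section Braid

variable {K : Type v} [Field K] {I : Type u} [Quiver.{u} I] [Fintype I] [DecidableEq I]
  [∀ i j : I, Fintype (i ⟶ j)] {lam lam' : I → K} {P : I → Prop} [DecidablePred P]

namespace Marking

open DPRep

/-! ### Isomorphisms and equality of morphisms from data at two vertices -/

section Iso

variable {V : DPRep.{u, v, w} lam'} {W W' : DPRep.{u, v, w} lam}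
  (o : Marking (fun k : Subtype P => V.obj k.1) W)
  (o' : Marking (fun k : Subtype P => V.obj k.1) W') {i j : I}

/-- The marking is compatible with the maps of `V` between vertices in `P`. -/
def Compatible : Prop :=
  ∀ (k l : Subtype P) (a : DArr k.1 l.1) (v : V.obj k.1), W.map a (o k v) = o l (V.map a v)

theorem map_equiv_of_armIn {φ : W.obj i ≃ₗ[K] W'.obj i}
    (h : ∀ a, φ (o.armIn i a) = o'.armIn i a) (k : Subtype P) (c : DArr k.1 i) (v : V.obj k.1) :
    φ (W.map c (o k v)) = W'.map c (o' k v) := by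
  classical
  rw [map_eq_armIn o k c v, h, map_eq_armIn o' k c v]

theorem map_equiv_of_armOut {φ : W.obj i ≃ₗ[K] W'.obj i}
    (h : ∀ x, o'.armOut i (φ x) = o.armOut i x) (k : Subtype P) (c : DArr i k.1) (x : W.obj i) :
    (o' k).symm (W'.map c (φ x)) = (o k).symm (W.map c x) := by
  have := congrFun (h x) ⟨k, rev c⟩
  rw [armOut_apply, armOut_apply] at this
  simpa only [rev_rev] using this

/-- The isomorphism is glued from `φ` at i, `ψ` at j and the two markings elsewhere. Since i and j
are loop-free, the hypotheses cover every arrow of the double. -/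
theorem exists_iso (hi : LoopFree i) (hj : LoopFree j) (hP : ∀ k, P k ↔ k ≠ i ∧ k ≠ j)
    (ho : o.Compatible) (ho' : o'.Compatible)
    (φ : W.obj i ≃ₗ[K] W'.obj i) (ψ : W.obj j ≃ₗ[K] W'.obj j) (hij : i ≠ j)
    (hφ : ∀ a, φ (o.armIn i a) = o'.armIn i a) (hφ' : ∀ x, o'.armOut i (φ x) = o.armOut i x)
    (hψ : ∀ a, ψ (o.armIn j a) = o'.armIn j a) (hψ' : ∀ x, o'.armOut j (ψ x) = o.armOut j x)
    (hφψ : ∀ (c : DArr i j) x, ψ (W.map c x) = W'.map c (φ x))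
    (hψφ : ∀ (c : DArr j i) y, φ (W.map c y) = W'.map c (ψ y)) :
    ∃ e : W ≅ W', ∀ (k : Subtype P) v, e.hom.app k.1 (o k v) = o' k v := by
  -- The vertex `k` is a variable, so agreement with `φ` and `ψ` is stated by `HEq` and becomes an
  -- equality once `k` is i or j.
  have key : ∀ k, ∃ θ : W.obj k ≃ₗ[K] W'.obj k, (k = i → HEq θ φ) ∧ (k = j → HEq θ ψ) ∧
      ∀ h : P k, θ = (o ⟨k, h⟩).symm.trans (o' ⟨k, h⟩) := by
    intro k
    by_cases hki : k = i
    · subst hki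
      exact ⟨φ, fun _ => HEq.rfl, fun h => absurd h hij, fun h => absurd rfl ((hP k).1 h).1⟩
    · by_cases hkj : k = j
      · subst hkj
        exact ⟨ψ, fun h => absurd h hki, fun _ => HEq.rfl, fun h => absurd rfl ((hP k).1 h).2⟩
      · have hk : P k := (hP k).2 ⟨hki, hkj⟩
        exact ⟨(o ⟨k, hk⟩).symm.trans (o' ⟨k, hk⟩), fun h => absurd h hki, fun h => absurd h hkj,
          fun _ => rfl⟩
  choose θ hθi hθj hθ using key
  have ei : θ i = φ := eq_of_heq (hθi i rfl)
  have ej : θ j = ψ := eq_of_heq (hθj j rfl)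
  have cases : ∀ k, k = i ∨ k = j ∨ P k := fun k => by
    rw [hP]
    tauto
  have hfrom : ∀ {m : I} (χ : W.obj m ≃ₗ[K] W'.obj m) (_ : ∀ a, χ (o.armIn m a) = o'.armIn m a)
      (k : I) (hk : P k) (a : DArr k m) (x : W.obj k), χ (W.map a x) = W'.map a (θ k x) := by
    intro m χ h k hk a x
    obtain ⟨x, rfl⟩ := (o ⟨k, hk⟩).surjective x
    rw [o.map_equiv_of_armIn o' h ⟨k, hk⟩, hθ k hk, LinearEquiv.trans_apply,
      LinearEquiv.symm_apply_apply]
  have hto : ∀ {m : I} (χ : W.obj m ≃ₗ[K] W'.obj m) (_ : ∀ x, o'.armOut m (χ x) = o.armOut m x)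
      (k : I) (hk : P k) (a : DArr m k) (x : W.obj m), θ k (W.map a x) = W'.map a (χ x) := by
    intro m χ h k hk a x
    rw [hθ k hk, LinearEquiv.trans_apply, ← o.map_equiv_of_armOut o' h ⟨k, hk⟩,
      LinearEquiv.apply_symm_apply]
  let F : W ⟶ W' :=
    { app := fun k => (θ k : W.obj k →ₗ[K] W'.obj k)
      comm := by
        intro k l a x
        change θ l (W.map a x) = W'.map a (θ k x)
        rcases cases k with rfl | rfl | hk
        · rcases cases l with rfl | rfl | hl
          · exact (no_loop hi a rfl rfl).elim
          · rw [ei, ej, hφψ]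
          · rw [ei, hto φ hφ' l hl]
        · rcases cases l with rfl | rfl | hl
          · rw [ei, ej, hψφ]
          · exact (no_loop hj a rfl rfl).elim
          · rw [ej, hto ψ hψ' l hl]
        · rcases cases l with rfl | rfl | hl
          · rw [ei, hfrom φ hφ k hk]
          · rw [ej, hfrom ψ hψ k hk]
          · obtain ⟨x, rfl⟩ := (o ⟨k, hk⟩).surjective x
            rw [ho ⟨k, hk⟩ ⟨l, hl⟩, hθ k hk, hθ l hl, LinearEquiv.trans_apply,
              LinearEquiv.trans_apply, LinearEquiv.symm_apply_apply,
              LinearEquiv.symm_apply_apply, ho' ⟨k, hk⟩ ⟨l, hl⟩] }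
  refine ⟨isoOfBijective F fun k => (θ k).bijective, fun k v => ?_⟩
  change θ k.1 (o k v) = o' k v
  rw [hθ k.1 k.2, LinearEquiv.trans_apply, LinearEquiv.symm_apply_apply]

end Iso

section Ext

variable {E : Subtype P → ModuleCat.{max u w} K} {W T : DPRep.{u, v, w} lam} (o : Marking E W)
  {i j : I}

/-- The spaces at i and j are generated along arrows from `P`, so commuting with arrows determines a
morphism there. This replaces a computation of naturality squares for the functors C. -/
theorem hom_ext_of_armIn (hP : ∀ k, P k ↔ k ≠ i ∧ k ≠ j)
    (hX : ∀ x, ∃ (a : Arm E i) (t : DArr j i → Arm E j),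
      x = o.armIn i a + ∑ c : DArr j i, W.map c (o.armIn j (t c)))
    (hY : ∀ y, ∃ (b : Arm E j) (t : DArr i j → Arm E i),
      y = o.armIn j b + ∑ c : DArr i j, W.map c (o.armIn i (t c)))
    (F G : W ⟶ T) (h : ∀ (k : Subtype P) x, F.app k.1 x = G.app k.1 x) : F = G := by
  have key : ∀ m (a : Arm E m), F.app m (o.armIn m a) = G.app m (o.armIn m a) := by
    intro m a
    rw [armIn_apply, map_sum, map_sum]
    refine Finset.sum_congr rfl fun x _ => ?_
    rw [map_smul, map_smul, F.comm, G.comm, h]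
  refine DPRep.hom_ext fun k x => ?_
  by_cases hk : P k
  · exact h ⟨k, hk⟩ x
  · rw [hP, not_and_or, not_not, not_not] at hk
    rcases hk with rfl | rfl
    · obtain ⟨a, t, rfl⟩ := hX x
      simp only [map_add, map_sum, F.comm, G.comm, key]
    · obtain ⟨a, t, rfl⟩ := hY x
      simp only [map_add, map_sum, F.comm, G.comm, key]

/-- The dual criterion, for the functors K: elements at i and j are separated by their images at the
vertices in `P`. -/
theorem hom_ext_of_armOut (hP : ∀ k, P k ↔ k ≠ i ∧ k ≠ j)
    (hX : ∀ x, o.armOut i x = 0 → (∀ c : DArr i j, o.armOut j (W.map c x) = 0) → x = 0)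
    (hY : ∀ y, o.armOut j y = 0 → (∀ c : DArr j i, o.armOut i (W.map c y) = 0) → y = 0)
    (F G : T ⟶ W) (h : ∀ (k : Subtype P) x, F.app k.1 x = G.app k.1 x) : F = G := by
  have key : ∀ m x, o.armOut m (F.app m x) = o.armOut m (G.app m x) := by
    intro m x
    funext z
    rw [armOut_apply, armOut_apply, ← F.comm, ← G.comm, h]
  refine DPRep.hom_ext fun k x => ?_
  by_cases hk : P k
  · exact h ⟨k, hk⟩ x
  · rw [hP, not_and_or, not_not, not_not] at hk
    rcases hk with rfl | rfl
    · refine sub_eq_zero.1 (hX _ ?_ fun c => ?_)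
      · rw [map_sub, key, sub_self]
      · rw [map_sub, map_sub, ← F.comm, ← G.comm, key, sub_self]
    · refine sub_eq_zero.1 (hY _ ?_ fun c => ?_)
      · rw [map_sub, key, sub_self]
      · rw [map_sub, map_sub, ← F.comm, ← G.comm, key, sub_self]

end Ext

/-! ### Two vertices without an arrow between them -/

section Unlinked

variable {V : DPRep.{u, v, w} lam} {lam₁ lam₂ : I → K} {W : DPRep.{u, v, w} lam₁}
  {W' : DPRep.{u, v, w} lam₁} {W₂ : DPRep.{u, v, w} lam₂} {E : Subtype P → ModuleCat.{max u w} K}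

/-- The space of `W` at `i` is the cokernel of the map from `V_i` to its neighbours in `P`. -/
structure CokAt (i : I) (s : K) (o : Marking E V) (o₁ : Marking E W) : Prop where
  surj : ∀ x, ∃ a, x = o₁.armIn i a
  ker : ∀ a, o₁.armIn i a = 0 ↔ ∃ x, a = o.armOut i x
  path : ∀ a, o₁.armOut i (o₁.armIn i a) = o.armOut i (o.armIn i a) - s • a

/-- The space of `W` at `i` is the kernel of the map to `V_i` from its neighbours in `P`. -/
structure KerAt (i : I) (s : K) (o : Marking E V) (o₁ : Marking E W) : Prop where
  inj : ∀ x, o₁.armOut i x = 0 → x = 0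
  range : ∀ a, (∃ x, o₁.armOut i x = a) ↔ o.armIn i a = 0
  path : ∀ a, o₁.armOut i (o₁.armIn i a) = o.armOut i (o.armIn i a) - s • a

variable {o : Marking E V} {o₁ : Marking E W} {o₁' : Marking E W'} {i j : I} {s : K}

theorem CokAt.exists_equiv (h : CokAt i s o o₁) (h' : CokAt i s o o₁') :
    ∃ φ : W.obj i ≃ₗ[K] W'.obj i, (∀ a, φ (o₁.armIn i a) = o₁'.armIn i a) ∧
      ∀ x, o₁'.armOut i (φ x) = o₁.armOut i x := by
  obtain ⟨φ, hφ⟩ := exists_equiv_of_ker_eq (o₁.armIn i) (o₁'.armIn i)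
    (fun x => (h.surj x).imp fun _ => Eq.symm) (fun x => (h'.surj x).imp fun _ => Eq.symm)
    fun a => (h.ker a).trans (h'.ker a).symm
  refine ⟨φ, hφ, fun x => ?_⟩
  obtain ⟨a, rfl⟩ := h.surj x
  rw [hφ, h.path, h'.path]

theorem KerAt.exists_equiv (h : KerAt i s o o₁) (h' : KerAt i s o o₁') :
    ∃ φ : W.obj i ≃ₗ[K] W'.obj i, (∀ a, φ (o₁.armIn i a) = o₁'.armIn i a) ∧
      ∀ x, o₁'.armOut i (φ x) = o₁.armOut i x := by
  obtain ⟨φ, hφ⟩ := exists_equiv_of_range_eq (o₁.armOut i) (o₁'.armOut i)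
    ((injective_iff_map_eq_zero _).2 h.inj) ((injective_iff_map_eq_zero _).2 h'.inj)
    fun a => (h.range a).trans (h'.range a).symm
  refine ⟨φ, fun a => (injective_iff_map_eq_zero (o₁'.armOut i)).2 h'.inj ?_, hφ⟩
  rw [hφ, h.path, h'.path]

variable {r : ∀ k, k ≠ j → W.obj k ≃ₗ[K] W₂.obj k}
  {q : ∀ k, k ≠ j → V.obj k ≃ₗ[K] W.obj k}

/-- Arms at i only involve vertices in `P`, and a reflection at j changes neither these nor the
space at i. So the description at i survives a later reflection at j, and by `CokAt.of_trans` it may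
also be read before an earlier one. -/
theorem CokAt.trans (h : CokAt i s o o₁) (hr : IsReflection j W W₂ r) (hPj : ∀ k, P k → k ≠ j)
    (hij : i ≠ j) : CokAt i s o (o₁.trans r hPj) where
  surj x := by
    obtain ⟨x, rfl⟩ := (r i hij).surjective x
    obtain ⟨a, rfl⟩ := h.surj x
    exact ⟨a, (o₁.trans_armIn_of_ne hr hPj hij a).symm⟩
  ker a := by
    rw [o₁.trans_armIn_of_ne hr hPj hij, LinearEquiv.map_eq_zero_iff, h.ker]
  path a := by
    rw [o₁.trans_armIn_of_ne hr hPj hij, o₁.trans_armOut_of_ne hr hPj hij, h.path]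

theorem KerAt.trans (h : KerAt i s o o₁) (hr : IsReflection j W W₂ r) (hPj : ∀ k, P k → k ≠ j)
    (hij : i ≠ j) : KerAt i s o (o₁.trans r hPj) where
  inj x hx := by
    obtain ⟨x, rfl⟩ := (r i hij).surjective x
    rw [o₁.trans_armOut_of_ne hr hPj hij] at hx
    rw [h.inj x hx, map_zero]
  range a := by
    rw [← h.range]
    constructor
    · rintro ⟨x, rfl⟩
      obtain ⟨x, rfl⟩ := (r i hij).surjective x
      exact ⟨x, (o₁.trans_armOut_of_ne hr hPj hij x).symm⟩
    · rintro ⟨x, rfl⟩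
      exact ⟨r i hij x, o₁.trans_armOut_of_ne hr hPj hij x⟩
  path a := by
    rw [o₁.trans_armIn_of_ne hr hPj hij, o₁.trans_armOut_of_ne hr hPj hij, h.path]

theorem CokAt.of_trans {o₂ : Marking E W₂} (hq : IsReflection j V W q) (hPj : ∀ k, P k → k ≠ j)
    (hij : i ≠ j) (h : CokAt i s (o.trans q hPj) o₂) : CokAt i s o o₂ where
  surj := h.surj
  ker a := by
    rw [h.ker]
    constructor
    · rintro ⟨x, rfl⟩
      obtain ⟨x, rfl⟩ := (q i hij).surjective x
      exact ⟨x, o.trans_armOut_of_ne hq hPj hij x⟩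
    · rintro ⟨x, rfl⟩
      exact ⟨q i hij x, (o.trans_armOut_of_ne hq hPj hij x).symm⟩
  path a := by
    rw [h.path, o.trans_armIn_of_ne hq hPj hij, o.trans_armOut_of_ne hq hPj hij]

theorem KerAt.of_trans {o₂ : Marking E W₂} (hq : IsReflection j V W q) (hPj : ∀ k, P k → k ≠ j)
    (hij : i ≠ j) (h : KerAt i s (o.trans q hPj) o₂) : KerAt i s o o₂ where
  inj := h.inj
  range a := by
    rw [h.range, o.trans_armIn_of_ne hq hPj hij, LinearEquiv.map_eq_zero_iff]
  path a := by
    rw [h.path, o.trans_armIn_of_ne hq hPj hij, o.trans_armOut_of_ne hq hPj hij]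

/-- Without arrows from j to i the link sum is empty, and the arm is all of V_⊕. -/
theorem cokAt_cRep [IsEmpty (DArr j i)] (o : Marking E V) (hi : LoopFree i)
    (hP : ∀ k, P k ↔ k ≠ i ∧ k ≠ j) (hPi : ∀ k, P k → k ≠ i) (hj : j ≠ i) :
    CokAt i (lam i) o (o.trans (V.cOut hi) hPi) where
  surj x := by
    obtain ⟨a, t, rfl⟩ := o.exists_cRep_eq hi hP hPi hj x
    exact ⟨a, by rw [Finset.univ_eq_empty, Finset.sum_empty, add_zero]⟩
  ker a := by
    have := o.cRep_eq_zero_iff hi hP hPi hj a 0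
    rw [Finset.univ_eq_empty, Finset.sum_empty, add_zero] at this
    rw [this]
    exact exists_congr fun x => and_iff_left isEmptyElim
  path := o.trans_armOut_armIn (V.isReflection_cRep hi) hPi

theorem kerAt_kRep [IsEmpty (DArr j i)] (o : Marking E V) (hi : LoopFree i)
    (hP : ∀ k, P k ↔ k ≠ i ∧ k ≠ j) (hPi : ∀ k, P k → k ≠ i) (hj : j ≠ i) :
    KerAt i (lam i) o (o.trans (V.kOut hi) hPi) where
  inj x hx := o.kRep_eq_zero hi hP hPi hj x hx isEmptyElim
  range a := by
    have := o.exists_kRep_eq_iff hi hP hPi hj a 0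
    rw [Finset.univ_eq_empty, Finset.sum_empty, add_zero] at this
    rw [← this]
    exact exists_congr fun x => (and_iff_left isEmptyElim).symm
  path := o.trans_armOut_armIn (V.isReflection_kRep hi) hPi

end Unlinked

/-! ### Two vertices with one arrow between them -/

section Linked

/-- The vertices `i` and `j` are loop-free, joined by exactly one arrow, and `P` consists of the
other vertices. -/
structure _root_.DefPreproj.IsLink (P : I → Prop) (i j : I) (c : DArr j i) (c' : DArr i j) :
    Prop where
  loopFree : LoopFree i
  loopFree' : LoopFree j
  mem_iff : ∀ k, P k ↔ k ≠ i ∧ k ≠ j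
  ne : i ≠ j
  rev_eq : rev c = c'
  rev_eq' : rev c' = c
  eq_link : ∀ d : DArr j i, d = c
  eq_link' : ∀ d : DArr i j, d = c'

variable {V : DPRep.{u, v, w} lam} {W : DPRep.{u, v, w} lam'}
  {E : Subtype P → ModuleCat.{max u w} K} {i j : I} {c : DArr j i} {c' : DArr i j}

theorem _root_.DefPreproj.IsLink.symm (h : IsLink P i j c c') : IsLink P j i c' c :=
  ⟨h.loopFree', h.loopFree, fun k => (h.mem_iff k).trans and_comm, h.ne.symm, h.rev_eq', h.rev_eq,
    h.eq_link', h.eq_link⟩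

theorem _root_.DefPreproj.IsLink.ne_of_mem (h : IsLink P i j c c') (k : I) (hk : P k) : k ≠ i :=
  ((h.mem_iff k).1 hk).1

theorem _root_.DefPreproj.IsLink.notMem (h : IsLink P i j c c') : ¬ P j :=
  fun hj => ((h.mem_iff j).1 hj).2 rfl

theorem _root_.DefPreproj.IsLink.sum_eq {M : Type*} [AddCommMonoid M] (h : IsLink P i j c c')
    (f : DArr j i → M) : ∑ d, f d = f c :=
  Finset.sum_eq_single c (fun d _ hd => absurd (h.eq_link d) hd)
    fun hc => absurd (Finset.mem_univ _) hc

/-- The data of a representation at two vertices joined by an arrow. -/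
def toTwo (o : Marking E W) (c : DArr j i) (c' : DArr i j) :
    TwoVertex K (Arm E i) (Arm E j) where
  X := W.obj i
  Y := W.obj j
  outX := o.armOut i
  inX := o.armIn i
  toY := W.map c'
  toX := W.map c
  outY := o.armOut j
  inY := o.armIn j

/-- The two relations carry opposite signs on the link because `c'` is the reverse of `c`. -/
theorem rel_toTwo (h : IsLink P i j c c') (o : Marking E W) :
    (o.toTwo c c').Rel (eps K c) (lam' i) (lam' j) where
  relX x := by
    have := o.armIn_armOut h.loopFree h.mem_iff x
    rw [h.sum_eq, h.rev_eq] at this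
    exact this
  relY y := by
    have := o.armIn_armOut h.loopFree' h.symm.mem_iff y
    rw [h.symm.sum_eq, h.rev_eq', ← h.rev_eq, eps_rev, neg_smul, ← sub_eq_add_neg, h.rev_eq] at this
    exact this

theorem isRefl_toTwo (h : IsLink P i j c c') (o : Marking E V)
    {r : ∀ k, k ≠ i → V.obj k ≃ₗ[K] W.obj k} (hr : IsReflection i V W r) :
    TwoVertex.IsRefl (lam i) (o.toTwo c c') ((o.trans r h.ne_of_mem).toTwo c c')
      (r j h.ne.symm) where
  outY_eq := o.trans_armOut_of_ne hr h.ne_of_mem h.ne.symm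
  inY_eq := o.trans_armIn_of_ne hr h.ne_of_mem h.ne.symm
  outX_inX := o.trans_armOut_armIn hr h.ne_of_mem
  outX_toX := o.trans_armOut_link hr h.ne_of_mem h.ne.symm h.notMem c
  toY_inX := o.link_trans_armIn hr h.ne_of_mem h.ne.symm h.notMem c'

theorem isCok_toTwo (h : IsLink P i j c c') (o : Marking E V) :
    TwoVertex.IsCok (eps K c) (o.toTwo c c')
      ((o.trans (V.cOut h.loopFree) h.ne_of_mem).toTwo c c') (V.cOut h.loopFree j h.ne.symm) where
  surj x := by
    obtain ⟨a, t, hx⟩ := o.exists_cRep_eq h.loopFree h.mem_iff h.ne_of_mem h.ne.symm x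
    rw [h.sum_eq] at hx
    exact ⟨a, t c, hx⟩
  ker a y := by
    have := o.cRep_eq_zero_iff h.loopFree h.mem_iff h.ne_of_mem h.ne.symm a fun _ => y
    rw [h.sum_eq] at this
    refine this.trans (exists_congr fun x => and_congr_right fun _ => ⟨fun hx => ?_, ?_⟩)
    · rw [hx c, h.rev_eq]
      rfl
    · rintro rfl d
      rw [h.eq_link d, h.rev_eq]
      rfl

theorem isKer_toTwo (h : IsLink P i j c c') (o : Marking E V) :
    TwoVertex.IsKer (eps K c) (o.toTwo c c')
      ((o.trans (V.kOut h.loopFree) h.ne_of_mem).toTwo c c') (V.kOut h.loopFree j h.ne.symm) where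
  inj x hx hy := o.kRep_eq_zero h.loopFree h.mem_iff h.ne_of_mem h.ne.symm x hx fun d => by
    rw [h.eq_link d, h.rev_eq]
    exact hy
  range a y := by
    have := o.exists_kRep_eq_iff h.loopFree h.mem_iff h.ne_of_mem h.ne.symm a fun _ => y
    rw [h.sum_eq] at this
    refine Iff.trans (exists_congr fun x => and_congr_right fun _ => ⟨?_, fun hx => ?_⟩) this
    · intro hx d
      rw [h.eq_link d, h.rev_eq]
      exact hx
    · have := hx c
      rw [h.rev_eq] at this
      exact this

end Linked

end Marking
end Braid

/-! ### The braid relations -/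

section Weights

variable {K : Type v} [Field K] {I : Type u} [Quiver.{u} I] [Fintype I] [DecidableEq I]
  [∀ i j : I, Fintype (i ⟶ j)]

theorem symForm_comm (α β : I → ℤ) : symForm α β = symForm β α := add_comm _ _

theorem symForm_self {i : I} (hi : LoopFree i) :
    symForm (Pi.single i 1 : I → ℤ) (Pi.single i 1) = 2 := by
  have : IsEmpty (i ⟶ i) := hi
  simp [symForm, ringelForm_single]

theorem symForm_ne {i j : I} (h : i ≠ j) :
    symForm (Pi.single i 1 : I → ℤ) (Pi.single j 1) = - (numArrows i j : ℤ) := by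
  simp [symForm, ringelForm_single, h, h.symm, numArrows]
  ring

theorem reflWeight_comm {i j : I} (hij : i ≠ j) (h : numArrows i j = 0) (lam : I → K) :
    reflWeight i (reflWeight j lam) = reflWeight j (reflWeight i lam) := by
  funext k
  have h₁ := symForm_ne hij
  rw [h] at h₁
  simp only [reflWeight, symForm_comm (Pi.single j 1) (Pi.single i 1), h₁]
  push_cast
  ring

theorem reflWeight_braid {i j : I} (hi : LoopFree i) (hj : LoopFree j) (hij : i ≠ j)
    (h : numArrows i j = 1) (lam : I → K) :
    reflWeight i (reflWeight j (reflWeight i lam)) =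
      reflWeight j (reflWeight i (reflWeight j lam)) := by
  funext k
  have h₁ := symForm_ne hij
  rw [h] at h₁
  simp only [reflWeight, symForm_comm (Pi.single j 1) (Pi.single i 1), h₁, symForm_self hi,
    symForm_self hj]
  push_cast
  ring

theorem card_dArr (i j : I) : Fintype.card (DArr i j) = numArrows i j := Fintype.card_sum

end Weights

/-! ### Natural isomorphisms for representations -/

section Rep

variable {K : Type v} [Field K] {I : Type u} [Quiver.{u} I] [Fintype I] [DecidableEq I]
  [∀ i j : I, Fintype (i ⟶ j)] {lam lam' : I → K} {P : I → Prop} [DecidablePred P]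

/-- The identity functor, read as a functor between categories of representations for equal
weights. -/
def repCast (h : lam = lam') : DPRep.{u, v, w} lam ⥤ DPRep.{u, v, w} lam' where
  obj V := ⟨V.obj, V.map, h ▸ V.rel⟩
  map f := ⟨f.app, f.comm⟩

namespace Marking

open DPRep

/-- The marking of a representation by its own spaces. -/
def refl (P : I → Prop) (V : DPRep.{u, v, w} lam) : Marking (fun k : Subtype P => V.obj k.1) V :=
  fun _ => LinearEquiv.refl K _

theorem compatible_refl (V : DPRep.{u, v, w} lam) : (refl P V).Compatible := fun _ _ _ _ => rfl

theorem Compatible.trans {lam₁ lam₂ : I → K} {V : DPRep.{u, v, w} lam} {W : DPRep.{u, v, w} lam₁}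
    {W₁ : DPRep.{u, v, w} lam₂} {o : Marking (fun k : Subtype P => V.obj k.1) W}
    (ho : o.Compatible) {i : I} {r : ∀ k, k ≠ i → W.obj k ≃ₗ[K] W₁.obj k}
    (hr : IsReflection i W W₁ r) (hPi : ∀ k, P k → k ≠ i) : (o.trans r hPi).Compatible := by
  intro k l a v
  refine (hr.map_out a (hPi _ k.2) (hPi _ l.2) (o k v)).trans ?_
  rw [ho]
  rfl

/-- The isomorphisms `e V` are chosen independently for each `V`. Both sides of a naturality square
agree at the vertices in `P`, where the markings compute them, and `hext` extends this to i and j.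
-/
theorem nonempty_iso {Φ Ψ : DPRep.{u, v, w} lam ⥤ DPRep.{u, v, w} lam'}
    (o : ∀ V, Marking (fun k : Subtype P => V.obj k.1) (Φ.obj V))
    (o' : ∀ V, Marking (fun k : Subtype P => V.obj k.1) (Ψ.obj V))
    (ho : ∀ {U V} (f : U ⟶ V) (k : Subtype P) x, (Φ.map f).app k.1 (o U k x) = o V k (f.app k.1 x))
    (ho' : ∀ {U V} (f : U ⟶ V) (k : Subtype P) x,
      (Ψ.map f).app k.1 (o' U k x) = o' V k (f.app k.1 x))
    (h : ∀ V, ∃ e : Φ.obj V ≅ Ψ.obj V, ∀ (k : Subtype P) x, e.hom.app k.1 (o V k x) = o' V k x)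
    (hext : ∀ {U V} (F G : Φ.obj U ⟶ Ψ.obj V),
      (∀ (k : Subtype P) x, F.app k.1 x = G.app k.1 x) → F = G) : Nonempty (Φ ≅ Ψ) := by
  choose e he using h
  refine ⟨NatIso.ofComponents e fun {U V} f => hext _ _ fun k x => ?_⟩
  obtain ⟨x, rfl⟩ := (o U k).surjective x
  rw [comp_app, comp_app, LinearMap.comp_apply, LinearMap.comp_apply, ho, he, he, ho']

/-! ### Commuting reflections -/

section Unlinked

variable {i j : I} (hi : LoopFree i) (hj : LoopFree j) (hP : ∀ k, P k ↔ k ≠ i ∧ k ≠ j)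

/-- The marking of `C_j C_i(V)`. -/
def cMarkTwo (V : DPRep.{u, v, w} lam) :
    Marking (fun k : Subtype P => V.obj k.1) ((V.cRep hi).cRep hj) :=
  ((refl P V).trans (V.cOut hi) fun k hk => ((hP k).1 hk).1).trans ((V.cRep hi).cOut hj)
    fun k hk => ((hP k).1 hk).2

/-- The marking of `K_j K_i(V)`. -/
def kMarkTwo (V : DPRep.{u, v, w} lam) :
    Marking (fun k : Subtype P => V.obj k.1) ((V.kRep hi).kRep hj) :=
  ((refl P V).trans (V.kOut hi) fun k hk => ((hP k).1 hk).1).trans ((V.kRep hi).kOut hj)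
    fun k hk => ((hP k).1 hk).2

theorem compatible_cMarkTwo (V : DPRep.{u, v, w} lam) : (cMarkTwo hi hj hP V).Compatible :=
  ((compatible_refl V).trans (V.isReflection_cRep hi) _).trans
    ((V.cRep hi).isReflection_cRep hj) _

theorem compatible_kMarkTwo (V : DPRep.{u, v, w} lam) : (kMarkTwo hi hj hP V).Compatible :=
  ((compatible_refl V).trans (V.isReflection_kRep hi) _).trans
    ((V.kRep hi).isReflection_kRep hj) _

theorem isEmpty_dArr (h : numArrows i j = 0) : IsEmpty (DArr i j) :=
  Fintype.card_eq_zero_iff.1 ((card_dArr i j).trans h)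

theorem numArrows_comm (i j : I) : numArrows i j = numArrows j i := add_comm _ _

theorem cokAt_cMarkTwo (hij : i ≠ j) (h : numArrows i j = 0) (V : DPRep.{u, v, w} lam) :
    CokAt i (lam i) (refl P V) (cMarkTwo hi hj hP V) ∧
      CokAt j (lam j) (refl P V) (cMarkTwo hi hj hP V) := by
  have e₁ := isEmpty_dArr h
  have e₂ := isEmpty_dArr ((numArrows_comm j i).trans h)
  refine ⟨(cokAt_cRep _ hi hP _ hij.symm).trans ((V.cRep hi).isReflection_cRep hj) _ hij, ?_⟩
  -- The second reflection uses the weight `r_i λ` at j, which is still `λ_j` as no arrow joins i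
  -- and j.
  have hw : reflWeight i lam j = lam j := by
    rw [reflWeight_ne hij.symm, card_dArr, h, Nat.cast_zero, zero_mul, add_zero]
  rw [← hw]
  exact .of_trans (V.isReflection_cRep hi) _ hij.symm
    (cokAt_cRep _ hj (fun k => (hP k).trans and_comm) _ hij)

theorem kerAt_kMarkTwo (hij : i ≠ j) (h : numArrows i j = 0) (V : DPRep.{u, v, w} lam) :
    KerAt i (lam i) (refl P V) (kMarkTwo hi hj hP V) ∧
      KerAt j (lam j) (refl P V) (kMarkTwo hi hj hP V) := by
  have e₁ := isEmpty_dArr h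
  have e₂ := isEmpty_dArr ((numArrows_comm j i).trans h)
  refine ⟨(kerAt_kRep _ hi hP _ hij.symm).trans ((V.kRep hi).isReflection_kRep hj) _ hij, ?_⟩
  have hw : reflWeight i lam j = lam j := by
    rw [reflWeight_ne hij.symm, card_dArr, h, Nat.cast_zero, zero_mul, add_zero]
  rw [← hw]
  exact .of_trans (V.isReflection_kRep hi) _ hij.symm
    (kerAt_kRep _ hj (fun k => (hP k).trans and_comm) _ hij)

section Cast

variable {lam₁ lam₂ : I → K} {V : DPRep.{u, v, w} lam} {W : DPRep.{u, v, w} lam₁}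
  {W' : DPRep.{u, v, w} lam₂} {s t : K}

theorem exists_iso_of_cokAt (hi : LoopFree i) (hj : LoopFree j)
    (hP : ∀ k, P k ↔ k ≠ i ∧ k ≠ j) (hw : lam₁ = lam₂) (hij : i ≠ j) (h : numArrows i j = 0)
    (o : Marking (fun k : Subtype P => V.obj k.1) W)
    (o' : Marking (fun k : Subtype P => V.obj k.1) W') (ho : o.Compatible) (ho' : o'.Compatible)
    (A : CokAt i s (refl P V) o) (A' : CokAt i s (refl P V) o')
    (B : CokAt j t (refl P V) o) (B' : CokAt j t (refl P V) o') :
    ∃ e : (repCast hw).obj W ≅ W', ∀ (k : Subtype P) v, e.hom.app k.1 (o k v) = o' k v := by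
  -- With equal weights identified, `repCast` is the identity by definition, and both
  -- representations live in one category.
  subst hw
  have e₁ := isEmpty_dArr h
  have e₂ := isEmpty_dArr ((numArrows_comm j i).trans h)
  obtain ⟨φ, hφ, hφ'⟩ := A.exists_equiv A'
  obtain ⟨ψ, hψ, hψ'⟩ := B.exists_equiv B'
  exact exists_iso o o' hi hj hP ho ho' φ ψ hij hφ hφ' hψ hψ' isEmptyElim isEmptyElim

theorem exists_iso_of_kerAt (hi : LoopFree i) (hj : LoopFree j)
    (hP : ∀ k, P k ↔ k ≠ i ∧ k ≠ j) (hw : lam₁ = lam₂) (hij : i ≠ j) (h : numArrows i j = 0)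
    (o : Marking (fun k : Subtype P => V.obj k.1) W)
    (o' : Marking (fun k : Subtype P => V.obj k.1) W') (ho : o.Compatible) (ho' : o'.Compatible)
    (A : KerAt i s (refl P V) o) (A' : KerAt i s (refl P V) o')
    (B : KerAt j t (refl P V) o) (B' : KerAt j t (refl P V) o') :
    ∃ e : (repCast hw).obj W ≅ W', ∀ (k : Subtype P) v, e.hom.app k.1 (o k v) = o' k v := by
  subst hw
  have e₁ := isEmpty_dArr h
  have e₂ := isEmpty_dArr ((numArrows_comm j i).trans h)
  obtain ⟨φ, hφ, hφ'⟩ := A.exists_equiv A'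
  obtain ⟨ψ, hψ, hψ'⟩ := B.exists_equiv B'
  exact exists_iso o o' hi hj hP ho ho' φ ψ hij hφ hφ' hψ hψ' isEmptyElim isEmptyElim

theorem hom_ext_of_cokAt (hP : ∀ k, P k ↔ k ≠ i ∧ k ≠ j) (hw : lam₁ = lam₂)
    (o : Marking (fun k : Subtype P => V.obj k.1) W) (A : CokAt i s (refl P V) o)
    (B : CokAt j t (refl P V) o) (F G : (repCast hw).obj W ⟶ W')
    (H : ∀ (k : Subtype P) x, F.app k.1 x = G.app k.1 x) : F = G := by
  subst hw
  refine hom_ext_of_armIn o hP (fun x => ?_) (fun y => ?_) F G H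
  · obtain ⟨a, ha⟩ := A.surj x
    exact ⟨a, 0, by simp [ha]⟩
  · obtain ⟨a, ha⟩ := B.surj y
    exact ⟨a, 0, by simp [ha]⟩

theorem hom_ext_of_kerAt {T : DPRep.{u, v, w} lam₂} (hP : ∀ k, P k ↔ k ≠ i ∧ k ≠ j)
    (o : Marking (fun k : Subtype P => V.obj k.1) W') (A : KerAt i s (refl P V) o)
    (B : KerAt j t (refl P V) o) (F G : T ⟶ W')
    (H : ∀ (k : Subtype P) x, F.app k.1 x = G.app k.1 x) : F = G :=
  hom_ext_of_armOut o hP (fun x hx _ => A.inj x hx) (fun y hy _ => B.inj y hy) F G H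

end Cast

theorem cFunctor_map_cMarkTwo {U V : DPRep.{u, v, w} lam} (f : U ⟶ V) (k : Subtype P)
    (x : U.obj k.1) :
    ((cFunctor _ hj).map ((cFunctor _ hi).map f)).app k.1 (cMarkTwo hi hj hP U k x) =
      cMarkTwo hi hj hP V k (f.app k.1 x) :=
  (cFunctor_map_out _ _ _ _ _).trans (congrArg _ (cFunctor_map_out _ _ _ _ _))

theorem kFunctor_map_kMarkTwo {U V : DPRep.{u, v, w} lam} (f : U ⟶ V) (k : Subtype P)
    (x : U.obj k.1) :
    ((kFunctor _ hj).map ((kFunctor _ hi).map f)).app k.1 (kMarkTwo hi hj hP U k x) =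
      kMarkTwo hi hj hP V k (f.app k.1 x) :=
  (kFunctor_map_out _ _ _ _ _).trans (congrArg _ (kFunctor_map_out _ _ _ _ _))

theorem nonempty_cFunctor_comm (hij : i ≠ j) (h : numArrows i j = 0)
    (hw : reflWeight i (reflWeight j lam) = reflWeight j (reflWeight i lam)) :
    Nonempty (cFunctor.{u, v, w} lam hj ⋙ cFunctor.{u, v, w} (reflWeight j lam) hi ⋙ repCast hw ≅
      cFunctor.{u, v, w} lam hi ⋙ cFunctor.{u, v, w} (reflWeight i lam) hj) := by
  have hP : ∀ k, (k ≠ i ∧ k ≠ j) ↔ k ≠ i ∧ k ≠ j := fun _ => Iff.rfl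
  -- Both orders use the same predicate `P`, so the two composites are marked by the same spaces.
  have hP' : ∀ k, (k ≠ i ∧ k ≠ j) ↔ k ≠ j ∧ k ≠ i := fun _ => and_comm
  have A := fun V : DPRep.{u, v, w} lam => cokAt_cMarkTwo hi hj hP hij h V
  have B := fun V : DPRep.{u, v, w} lam =>
    cokAt_cMarkTwo hj hi hP' hij.symm ((numArrows_comm j i).trans h) V
  exact nonempty_iso (cMarkTwo hj hi hP') (cMarkTwo hi hj hP)
    (fun f k x => cFunctor_map_cMarkTwo hj hi hP' f k x)
    (fun f k x => cFunctor_map_cMarkTwo hi hj hP f k x)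
    (fun V => exists_iso_of_cokAt hi hj hP hw hij h (cMarkTwo hj hi hP' V)
      (cMarkTwo hi hj hP V) (compatible_cMarkTwo hj hi hP' V) (compatible_cMarkTwo hi hj hP V)
      (B V).2 (A V).1 (B V).1 (A V).2)
    fun {U _} F G H => hom_ext_of_cokAt hP hw (cMarkTwo hj hi hP' U) (B U).2 (B U).1 F G H

theorem nonempty_kFunctor_comm (hij : i ≠ j) (h : numArrows i j = 0)
    (hw : reflWeight i (reflWeight j lam) = reflWeight j (reflWeight i lam)) :
    Nonempty (kFunctor.{u, v, w} lam hj ⋙ kFunctor.{u, v, w} (reflWeight j lam) hi ⋙ repCast hw ≅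
      kFunctor.{u, v, w} lam hi ⋙ kFunctor.{u, v, w} (reflWeight i lam) hj) := by
  have hP : ∀ k, (k ≠ i ∧ k ≠ j) ↔ k ≠ i ∧ k ≠ j := fun _ => Iff.rfl
  have hP' : ∀ k, (k ≠ i ∧ k ≠ j) ↔ k ≠ j ∧ k ≠ i := fun _ => and_comm
  have A := fun V : DPRep.{u, v, w} lam => kerAt_kMarkTwo hi hj hP hij h V
  have B := fun V : DPRep.{u, v, w} lam =>
    kerAt_kMarkTwo hj hi hP' hij.symm ((numArrows_comm j i).trans h) V
  exact nonempty_iso (kMarkTwo hj hi hP') (kMarkTwo hi hj hP)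
    (fun f k x => kFunctor_map_kMarkTwo hj hi hP' f k x)
    (fun f k x => kFunctor_map_kMarkTwo hi hj hP f k x)
    (fun V => exists_iso_of_kerAt hi hj hP hw hij h (kMarkTwo hj hi hP' V)
      (kMarkTwo hi hj hP V) (compatible_kMarkTwo hj hi hP' V) (compatible_kMarkTwo hi hj hP V)
      (B V).2 (A V).1 (B V).1 (A V).2)
    fun {_ V} F G H => hom_ext_of_kerAt hP (kMarkTwo hi hj hP V) (A V).1 (A V).2 F G H

end Unlinked

/-! ### Braid relation for linked vertices -/

section Linked

variable {i j : I} {c : DArr j i} {c' : DArr i j}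

/-- The marking of `C_i C_j C_i(V)`. -/
def cMark (h : IsLink P i j c c') (V : DPRep.{u, v, w} lam) :
    Marking (fun k : Subtype P => V.obj k.1)
      (((V.cRep h.loopFree).cRep h.loopFree').cRep h.loopFree) :=
  (((refl P V).trans (V.cOut h.loopFree) h.ne_of_mem).trans
    ((V.cRep h.loopFree).cOut h.loopFree') h.symm.ne_of_mem).trans
      (((V.cRep h.loopFree).cRep h.loopFree').cOut h.loopFree) h.ne_of_mem

/-- The marking of `K_i K_j K_i(V)`. -/
def kMark (h : IsLink P i j c c') (V : DPRep.{u, v, w} lam) :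
    Marking (fun k : Subtype P => V.obj k.1)
      (((V.kRep h.loopFree).kRep h.loopFree').kRep h.loopFree) :=
  (((refl P V).trans (V.kOut h.loopFree) h.ne_of_mem).trans
    ((V.kRep h.loopFree).kOut h.loopFree') h.symm.ne_of_mem).trans
      (((V.kRep h.loopFree).kRep h.loopFree').kOut h.loopFree) h.ne_of_mem

theorem compatible_cMark (h : IsLink P i j c c') (V : DPRep.{u, v, w} lam) :
    (cMark h V).Compatible :=
  (((compatible_refl V).trans (V.isReflection_cRep _) _).trans
    ((V.cRep _).isReflection_cRep _) _).trans (((V.cRep _).cRep _).isReflection_cRep _) _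

theorem compatible_kMark (h : IsLink P i j c c') (V : DPRep.{u, v, w} lam) :
    (kMark h V).Compatible :=
  (((compatible_refl V).trans (V.isReflection_kRep _) _).trans
    ((V.kRep _).isReflection_kRep _) _).trans (((V.kRep _).kRep _).isReflection_kRep _) _

theorem _root_.DefPreproj.IsLink.card_eq (h : IsLink P i j c c') :
    Fintype.card (DArr i j) = 1 :=
  Fintype.card_eq_one_iff.2 ⟨c', h.eq_link'⟩

theorem _root_.DefPreproj.IsLink.reflWeight_eq (h : IsLink P i j c c') (lam : I → K) :
    reflWeight i lam j = lam i + lam j := by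
  rw [reflWeight_ne h.ne.symm, h.card_eq, Nat.cast_one, one_mul, add_comm]

/-- The weight at i in the third reflection is `λ_j`, so the two shifts at i add up to the single
shift at j; this is `hl` of `samePaths_of_isRefl`. -/
theorem _root_.DefPreproj.IsLink.reflWeight_reflWeight_eq (h : IsLink P i j c c') (lam : I → K) :
    lam i + reflWeight j (reflWeight i lam) i = reflWeight i lam j := by
  rw [h.symm.reflWeight_eq, reflWeight_self h.loopFree]
  ring

theorem samePaths_cMark (h : IsLink P i j c c') (V : DPRep.{u, v, w} lam) :
    TwoVertex.SamePaths (lam i + lam j) ((refl P V).toTwo c c') ((cMark h V).toTwo c c') := by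
  -- The symmetric value `λ_i + λ_j` is the weight at j used by the middle reflection.
  rw [← h.reflWeight_eq]
  exact TwoVertex.samePaths_of_isRefl (isRefl_toTwo h _ (V.isReflection_cRep _))
    (isRefl_toTwo h.symm _ ((V.cRep _).isReflection_cRep _))
    (isRefl_toTwo h _ (((V.cRep _).cRep _).isReflection_cRep _)) (h.reflWeight_reflWeight_eq lam)

theorem samePaths_kMark (h : IsLink P i j c c') (V : DPRep.{u, v, w} lam) :
    TwoVertex.SamePaths (lam i + lam j) ((refl P V).toTwo c c') ((kMark h V).toTwo c c') := by
  rw [← h.reflWeight_eq]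
  exact TwoVertex.samePaths_of_isRefl (isRefl_toTwo h _ (V.isReflection_kRep _))
    (isRefl_toTwo h.symm _ ((V.kRep _).isReflection_kRep _))
    (isRefl_toTwo h _ (((V.kRep _).kRep _).isReflection_kRep _)) (h.reflWeight_reflWeight_eq lam)

theorem _root_.DefPreproj.IsLink.eps_eq (h : IsLink P i j c c') : eps K c' = - eps K c := by
  rw [← h.rev_eq, eps_rev]

theorem cokNormal_cMark (h : IsLink P i j c c') (V : DPRep.{u, v, w} lam) :
    TwoVertex.CokNormal ((refl P V).toTwo c c') ((cMark h V).toTwo c c') := by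
  -- The middle reflection is at j, where the link is `c'`, with sign opposite to that of `c`.
  have h₂ := isCok_toTwo h.symm ((refl P V).trans (V.cOut h.loopFree) h.ne_of_mem)
  rw [h.eps_eq] at h₂
  exact TwoVertex.cokNormal_of_isCok (eps_mul_self c) (isRefl_toTwo h _ (V.isReflection_cRep _))
    (isRefl_toTwo h.symm _ ((V.cRep _).isReflection_cRep _))
    (isRefl_toTwo h _ (((V.cRep _).cRep _).isReflection_cRep _)) (isCok_toTwo h _) h₂
    (isCok_toTwo h _)

theorem kerNormal_kMark (h : IsLink P i j c c') (V : DPRep.{u, v, w} lam) :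
    TwoVertex.KerNormal ((refl P V).toTwo c c') ((kMark h V).toTwo c c') := by
  have h₂ := isKer_toTwo h.symm ((refl P V).trans (V.kOut h.loopFree) h.ne_of_mem)
  rw [h.eps_eq] at h₂
  exact TwoVertex.kerNormal_of_isKer (eps_mul_self c) (isRefl_toTwo h _ (V.isReflection_kRep _))
    (isRefl_toTwo h.symm _ ((V.kRep _).isReflection_kRep _))
    (isRefl_toTwo h _ (((V.kRep _).kRep _).isReflection_kRep _)) (isKer_toTwo h _) h₂
    (isKer_toTwo h _)

theorem exists_iso_of_intertwines {V : DPRep.{u, v, w} lam} {W W' : DPRep.{u, v, w} lam'}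
    (h : IsLink P i j c c') (o : Marking (fun k : Subtype P => V.obj k.1) W)
    (o' : Marking (fun k : Subtype P => V.obj k.1) W') (ho : o.Compatible) (ho' : o'.Compatible)
    (H : ∃ φ ψ, TwoVertex.Intertwines (o.toTwo c c') (o'.toTwo c c') φ ψ) :
    ∃ e : W ≅ W', ∀ (k : Subtype P) v, e.hom.app k.1 (o k v) = o' k v := by
  obtain ⟨φ, ψ, H⟩ := H
  refine exists_iso o o' h.loopFree h.loopFree' h.mem_iff ho ho' φ ψ h.ne H.inX_eq H.outX_eq
    H.inY_eq H.outY_eq (fun d x => ?_) fun d y => ?_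
  · rw [h.eq_link' d]
    exact H.toY_eq x
  · rw [h.eq_link d]
    exact H.toX_eq y

/-- Since `toTwo c' c` is by definition the swap of `toTwo c c'`, a result for reflections that
start at j can be compared with one for reflections that start at i. -/
theorem _root_.DefPreproj.TwoVertex.CokNormal.toTwo_symm {lam₁ lam₂ : I → K}
    {V : DPRep.{u, v, w} lam₁} {W : DPRep.{u, v, w} lam₂} {E : Subtype P → ModuleCat.{max u w} K}
    {o : Marking E V} {o₁ : Marking E W} (h : TwoVertex.CokNormal (o.toTwo c' c) (o₁.toTwo c' c)) :
    TwoVertex.CokNormal (o.toTwo c c') (o₁.toTwo c c') :=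
  .of_swap h

theorem _root_.DefPreproj.TwoVertex.KerNormal.toTwo_symm {lam₁ lam₂ : I → K}
    {V : DPRep.{u, v, w} lam₁} {W : DPRep.{u, v, w} lam₂} {E : Subtype P → ModuleCat.{max u w} K}
    {o : Marking E V} {o₁ : Marking E W} (h : TwoVertex.KerNormal (o.toTwo c' c) (o₁.toTwo c' c)) :
    TwoVertex.KerNormal (o.toTwo c c') (o₁.toTwo c c') :=
  .of_swap h

theorem _root_.DefPreproj.TwoVertex.SamePaths.toTwo_symm {lam₁ lam₂ : I → K}
    {V : DPRep.{u, v, w} lam₁} {W : DPRep.{u, v, w} lam₂} {E : Subtype P → ModuleCat.{max u w} K}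
    {o : Marking E V} {o₁ : Marking E W} {s t : K}
    (h : TwoVertex.SamePaths (s + t) (o.toTwo c' c) (o₁.toTwo c' c)) :
    TwoVertex.SamePaths (t + s) (o.toTwo c c') (o₁.toTwo c c') := by
  rw [add_comm]
  exact .of_swap h

section Cast

variable {lam₁ lam₂ : I → K} {V : DPRep.{u, v, w} lam} {W : DPRep.{u, v, w} lam₁}
  {W' : DPRep.{u, v, w} lam₂} {s : K}

theorem exists_iso_of_cokNormal (hw : lam₁ = lam₂) (h : IsLink P i j c c')
    (o : Marking (fun k : Subtype P => V.obj k.1) W)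
    (o' : Marking (fun k : Subtype P => V.obj k.1) W') (ho : o.Compatible) (ho' : o'.Compatible)
    (p : TwoVertex.SamePaths s ((refl P V).toTwo c c') (o.toTwo c c'))
    (p' : TwoVertex.SamePaths s ((refl P V).toTwo c c') (o'.toTwo c c'))
    (n : TwoVertex.CokNormal ((refl P V).toTwo c c') (o.toTwo c c'))
    (n' : TwoVertex.CokNormal ((refl P V).toTwo c c') (o'.toTwo c c')) :
    ∃ e : (repCast hw).obj W ≅ W', ∀ (k : Subtype P) v, e.hom.app k.1 (o k v) = o' k v := by
  subst hw
  exact exists_iso_of_intertwines h o o' ho ho' <|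
    TwoVertex.exists_intertwines_of_cokNormal (eps_mul_self c) n n' p p' (rel_toTwo h o)
      (rel_toTwo h o')

theorem exists_iso_of_kerNormal (hw : lam₁ = lam₂) (h : IsLink P i j c c')
    (o : Marking (fun k : Subtype P => V.obj k.1) W)
    (o' : Marking (fun k : Subtype P => V.obj k.1) W') (ho : o.Compatible) (ho' : o'.Compatible)
    (p : TwoVertex.SamePaths s ((refl P V).toTwo c c') (o.toTwo c c'))
    (p' : TwoVertex.SamePaths s ((refl P V).toTwo c c') (o'.toTwo c c'))
    (n : TwoVertex.KerNormal ((refl P V).toTwo c c') (o.toTwo c c'))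
    (n' : TwoVertex.KerNormal ((refl P V).toTwo c c') (o'.toTwo c c')) :
    ∃ e : (repCast hw).obj W ≅ W', ∀ (k : Subtype P) v, e.hom.app k.1 (o k v) = o' k v := by
  subst hw
  exact exists_iso_of_intertwines h o o' ho ho' <|
    TwoVertex.exists_intertwines_of_kerNormal (eps_mul_self c) n n' p p' (rel_toTwo h o)
      (rel_toTwo h o')

theorem hom_ext_of_cokNormal (hw : lam₁ = lam₂) (h : IsLink P i j c c')
    (o : Marking (fun k : Subtype P => V.obj k.1) W)
    (n : TwoVertex.CokNormal ((refl P V).toTwo c c') (o.toTwo c c'))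
    (F G : (repCast hw).obj W ⟶ W') (H : ∀ (k : Subtype P) x, F.app k.1 x = G.app k.1 x) :
    F = G := by
  subst hw
  refine hom_ext_of_armIn o h.mem_iff (fun x => ?_) (fun y => ?_) F G H
  · obtain ⟨a, b, hx⟩ := n.surjX x
    exact ⟨a, fun _ => b, by rw [h.sum_eq]; exact hx⟩
  · obtain ⟨a, b, hy⟩ := n.surjY y
    exact ⟨b, fun _ => a, by rw [h.symm.sum_eq, add_comm]; exact hy⟩

theorem hom_ext_of_kerNormal {T : DPRep.{u, v, w} lam₂} (h : IsLink P i j c c')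
    (o : Marking (fun k : Subtype P => V.obj k.1) W')
    (n : TwoVertex.KerNormal ((refl P V).toTwo c c') (o.toTwo c c'))
    (F G : T ⟶ W') (H : ∀ (k : Subtype P) x, F.app k.1 x = G.app k.1 x) : F = G :=
  hom_ext_of_armOut o h.mem_iff (fun x hx hx' => n.injX x hx (hx' c'))
    (fun y hy hy' => n.injY y (hy' c) hy) F G H

end Cast

theorem cFunctor_map_cMark (h : IsLink P i j c c') {U V : DPRep.{u, v, w} lam} (f : U ⟶ V)
    (k : Subtype P) (x : U.obj k.1) :
    ((cFunctor _ h.loopFree).map ((cFunctor _ h.loopFree').map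
      ((cFunctor _ h.loopFree).map f))).app k.1 (cMark h U k x) = cMark h V k (f.app k.1 x) := by
  refine (cFunctor_map_out _ _ _ _ _).trans (congrArg _ ?_)
  exact (cFunctor_map_out _ _ _ _ _).trans (congrArg _ (cFunctor_map_out _ _ _ _ _))

theorem kFunctor_map_kMark (h : IsLink P i j c c') {U V : DPRep.{u, v, w} lam} (f : U ⟶ V)
    (k : Subtype P) (x : U.obj k.1) :
    ((kFunctor _ h.loopFree).map ((kFunctor _ h.loopFree').map
      ((kFunctor _ h.loopFree).map f))).app k.1 (kMark h U k x) = kMark h V k (f.app k.1 x) := by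
  refine (kFunctor_map_out _ _ _ _ _).trans (congrArg _ ?_)
  exact (kFunctor_map_out _ _ _ _ _).trans (congrArg _ (kFunctor_map_out _ _ _ _ _))

/-- The composite C_j C_i C_j is the first construction applied to `h.symm`. After swapping the
vertices back, both composites have the same normal form and path values relative to `V`. -/
theorem nonempty_cFunctor_braid (h : IsLink P i j c c')
    (hw : reflWeight i (reflWeight j (reflWeight i lam)) =
      reflWeight j (reflWeight i (reflWeight j lam))) :
    Nonempty (cFunctor.{u, v, w} lam h.loopFree ⋙
        cFunctor.{u, v, w} (reflWeight i lam) h.loopFree' ⋙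
        cFunctor.{u, v, w} (reflWeight j (reflWeight i lam)) h.loopFree ⋙ repCast hw ≅
      cFunctor.{u, v, w} lam h.loopFree' ⋙ cFunctor.{u, v, w} (reflWeight j lam) h.loopFree ⋙
        cFunctor.{u, v, w} (reflWeight i (reflWeight j lam)) h.loopFree') :=
  nonempty_iso (cMark h) (cMark h.symm) (fun f k x => cFunctor_map_cMark h f k x)
    (fun f k x => cFunctor_map_cMark h.symm f k x)
    (fun V => exists_iso_of_cokNormal hw h (cMark h V) (cMark h.symm V)
      (compatible_cMark h V) (compatible_cMark h.symm V) (samePaths_cMark h V)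
      (samePaths_cMark h.symm V).toTwo_symm (cokNormal_cMark h V)
      (cokNormal_cMark h.symm V).toTwo_symm)
    fun {U _} F G H => hom_ext_of_cokNormal hw h (cMark h U) (cokNormal_cMark h U) F G H

theorem nonempty_kFunctor_braid (h : IsLink P i j c c')
    (hw : reflWeight i (reflWeight j (reflWeight i lam)) =
      reflWeight j (reflWeight i (reflWeight j lam))) :
    Nonempty (kFunctor.{u, v, w} lam h.loopFree ⋙
        kFunctor.{u, v, w} (reflWeight i lam) h.loopFree' ⋙
        kFunctor.{u, v, w} (reflWeight j (reflWeight i lam)) h.loopFree ⋙ repCast hw ≅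
      kFunctor.{u, v, w} lam h.loopFree' ⋙ kFunctor.{u, v, w} (reflWeight j lam) h.loopFree ⋙
        kFunctor.{u, v, w} (reflWeight i (reflWeight j lam)) h.loopFree') :=
  nonempty_iso (kMark h) (kMark h.symm) (fun f k x => kFunctor_map_kMark h f k x)
    (fun f k x => kFunctor_map_kMark h.symm f k x)
    (fun V => exists_iso_of_kerNormal hw h (kMark h V) (kMark h.symm V)
      (compatible_kMark h V) (compatible_kMark h.symm V) (samePaths_kMark h V)
      (samePaths_kMark h.symm V).toTwo_symm (kerNormal_kMark h V)
      (kerNormal_kMark h.symm V).toTwo_symm)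
    fun {_ V} F G H =>
      -- For kernels it is the target of the morphisms, K_j K_i K_j, whose elements must be
      -- separated; for cokernels the source was used.
      hom_ext_of_kerNormal h (kMark h.symm V) (kerNormal_kMark h.symm V).toTwo_symm F G H

end Linked

end Marking
end Rep

/-! ### Transport from representations to modules -/

section Modules

variable {K : Type v} [Field K] {I : Type u} [Quiver.{u} I] [Fintype I] [DecidableEq I]
  [∀ i j : I, Fintype (i ⟶ j)] {lam lam' : I → K}

/-- The identification of modules with representations is compatible with equality of weights. -/
def inverseCompModCast (h : lam = lam') :
    (modEquivRep.{u, v, w} lam).inverse ⋙ modCast h ≅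
      repCast h ⋙ (modEquivRep.{u, v, w} lam').inverse := by
  subst h
  exact Iso.refl _

/-- Between consecutive conjugated functors stands `e₁.inverse ⋙ e₁.functor`, which the counit
removes; `m` moves the change of weight past the last inverse. -/
theorem nonempty_iso_conj_two {C₀ C₁ C₁' C₂ C₂' D₀ D₁ D₁' D₂ D₂' : Type*} [Category C₀]
    [Category C₁] [Category C₁'] [Category C₂] [Category C₂'] [Category D₀] [Category D₁]
    [Category D₁'] [Category D₂] [Category D₂'] (e₀ : C₀ ≌ D₀) (e₁ : C₁ ≌ D₁) (e₁' : C₁' ≌ D₁')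
    (e₂ : C₂ ≌ D₂) (e₂' : C₂' ≌ D₂') {F₁ : D₀ ⥤ D₁} {F₂ : D₁ ⥤ D₂} {G₁ : D₀ ⥤ D₁'} {G₂ : D₁' ⥤ D₂'}
    {M : C₂ ⥤ C₂'} {N : D₂ ⥤ D₂'} (m : e₂.inverse ⋙ M ≅ N ⋙ e₂'.inverse)
    (h : Nonempty (F₁ ⋙ F₂ ⋙ N ≅ G₁ ⋙ G₂)) :
    Nonempty ((e₀.functor ⋙ F₁ ⋙ e₁.inverse) ⋙ (e₁.functor ⋙ F₂ ⋙ e₂.inverse) ⋙ M ≅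
      (e₀.functor ⋙ G₁ ⋙ e₁'.inverse) ⋙ (e₁'.functor ⋙ G₂ ⋙ e₂'.inverse)) := by
  obtain ⟨h⟩ := h
  refine ⟨?_⟩
  calc (e₀.functor ⋙ F₁ ⋙ e₁.inverse) ⋙ (e₁.functor ⋙ F₂ ⋙ e₂.inverse) ⋙ M
      ≅ (e₀.functor ⋙ F₁) ⋙ (e₁.inverse ⋙ e₁.functor) ⋙ F₂ ⋙ (e₂.inverse ⋙ M) := Iso.refl _
    _ ≅ (e₀.functor ⋙ F₁) ⋙ 𝟭 D₁ ⋙ F₂ ⋙ (N ⋙ e₂'.inverse) :=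
      Functor.isoWhiskerLeft _ (Functor.isoWhiskerRight e₁.counitIso _ ≪≫
        Functor.isoWhiskerLeft _ (Functor.isoWhiskerLeft _ m))
    _ ≅ e₀.functor ⋙ (F₁ ⋙ F₂ ⋙ N) ⋙ e₂'.inverse := Iso.refl _
    _ ≅ e₀.functor ⋙ (G₁ ⋙ G₂) ⋙ e₂'.inverse :=
      Functor.isoWhiskerLeft _ (Functor.isoWhiskerRight h _)
    _ ≅ (e₀.functor ⋙ G₁) ⋙ 𝟭 D₁' ⋙ G₂ ⋙ e₂'.inverse := Iso.refl _
    _ ≅ (e₀.functor ⋙ G₁) ⋙ (e₁'.inverse ⋙ e₁'.functor) ⋙ G₂ ⋙ e₂'.inverse :=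
      Functor.isoWhiskerLeft _ (Functor.isoWhiskerRight e₁'.counitIso.symm _)
    _ ≅ (e₀.functor ⋙ G₁ ⋙ e₁'.inverse) ⋙ (e₁'.functor ⋙ G₂ ⋙ e₂'.inverse) := Iso.refl _

theorem nonempty_iso_conj_three {C₀ C₁ C₁' C₂ C₂' C₃ C₃' D₀ D₁ D₁' D₂ D₂' D₃ D₃' : Type*}
    [Category C₀] [Category C₁] [Category C₁'] [Category C₂] [Category C₂'] [Category C₃]
    [Category C₃'] [Category D₀] [Category D₁] [Category D₁'] [Category D₂] [Category D₂']
    [Category D₃] [Category D₃'] (e₀ : C₀ ≌ D₀) (e₁ : C₁ ≌ D₁) (e₁' : C₁' ≌ D₁') (e₂ : C₂ ≌ D₂)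
    (e₂' : C₂' ≌ D₂') (e₃ : C₃ ≌ D₃) (e₃' : C₃' ≌ D₃') {F₁ : D₀ ⥤ D₁} {F₂ : D₁ ⥤ D₂} {F₃ : D₂ ⥤ D₃}
    {G₁ : D₀ ⥤ D₁'} {G₂ : D₁' ⥤ D₂'} {G₃ : D₂' ⥤ D₃'} {M : C₃ ⥤ C₃'} {N : D₃ ⥤ D₃'}
    (m : e₃.inverse ⋙ M ≅ N ⋙ e₃'.inverse)
    (h : Nonempty (F₁ ⋙ F₂ ⋙ F₃ ⋙ N ≅ G₁ ⋙ G₂ ⋙ G₃)) :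
    Nonempty ((e₀.functor ⋙ F₁ ⋙ e₁.inverse) ⋙ (e₁.functor ⋙ F₂ ⋙ e₂.inverse) ⋙
        (e₂.functor ⋙ F₃ ⋙ e₃.inverse) ⋙ M ≅
      (e₀.functor ⋙ G₁ ⋙ e₁'.inverse) ⋙ (e₁'.functor ⋙ G₂ ⋙ e₂'.inverse) ⋙
        (e₂'.functor ⋙ G₃ ⋙ e₃'.inverse)) := by
  -- Treating the last two functors on each side as one leaves only the counits of `e₂` and `e₂'` to
  -- be inserted.
  obtain ⟨k⟩ := nonempty_iso_conj_two e₀ e₁ e₁' e₃ e₃' (F₂ := F₂ ⋙ F₃) (G₂ := G₂ ⋙ G₃) m h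
  refine ⟨?_⟩
  calc (e₀.functor ⋙ F₁ ⋙ e₁.inverse) ⋙ (e₁.functor ⋙ F₂ ⋙ e₂.inverse) ⋙
          (e₂.functor ⋙ F₃ ⋙ e₃.inverse) ⋙ M
      ≅ (e₀.functor ⋙ F₁ ⋙ e₁.inverse ⋙ e₁.functor ⋙ F₂) ⋙ (e₂.inverse ⋙ e₂.functor) ⋙
          (F₃ ⋙ e₃.inverse ⋙ M) := Iso.refl _
    _ ≅ (e₀.functor ⋙ F₁ ⋙ e₁.inverse ⋙ e₁.functor ⋙ F₂) ⋙ 𝟭 D₂ ⋙ (F₃ ⋙ e₃.inverse ⋙ M) :=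
      Functor.isoWhiskerLeft _ (Functor.isoWhiskerRight e₂.counitIso _)
    _ ≅ (e₀.functor ⋙ F₁ ⋙ e₁.inverse) ⋙ (e₁.functor ⋙ (F₂ ⋙ F₃) ⋙ e₃.inverse) ⋙ M := Iso.refl _
    _ ≅ (e₀.functor ⋙ G₁ ⋙ e₁'.inverse) ⋙ (e₁'.functor ⋙ (G₂ ⋙ G₃) ⋙ e₃'.inverse) := k
    _ ≅ (e₀.functor ⋙ G₁ ⋙ e₁'.inverse ⋙ e₁'.functor ⋙ G₂) ⋙ 𝟭 D₂' ⋙ (G₃ ⋙ e₃'.inverse) :=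
      Iso.refl _
    _ ≅ (e₀.functor ⋙ G₁ ⋙ e₁'.inverse ⋙ e₁'.functor ⋙ G₂) ⋙ (e₂'.inverse ⋙ e₂'.functor) ⋙
          (G₃ ⋙ e₃'.inverse) :=
      Functor.isoWhiskerLeft _ (Functor.isoWhiskerRight e₂'.counitIso.symm _)
    _ ≅ (e₀.functor ⋙ G₁ ⋙ e₁'.inverse) ⋙ (e₁'.functor ⋙ G₂ ⋙ e₂'.inverse) ⋙
        (e₂'.functor ⋙ G₃ ⋙ e₃'.inverse) := Iso.refl _

theorem exists_isLink {i j : I} (hi : LoopFree i) (hj : LoopFree j) (hij : i ≠ j)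
    (h : numArrows i j = 1) :
    ∃ (c : DArr j i) (c' : DArr i j), IsLink (fun k => k ≠ i ∧ k ≠ j) i j c c' := by
  obtain ⟨c', hc'⟩ := Fintype.card_eq_one_iff.1 ((card_dArr i j).trans h)
  refine ⟨rev c', c', hi, hj, fun _ => Iff.rfl, hij, rev_rev c', rfl, fun d => ?_, hc'⟩
  rw [← hc' (rev d), rev_rev]

end Modules

end DefPreproj

end

theorem theorem1p3 {K : Type v} [Field K] {I : Type u} [Quiver.{u} I] [Fintype I] [DecidableEq I]
    [∀ i j : I, Fintype (i ⟶ j)] (lam : I → K) (i j : I)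
    (hi : DefPreproj.LoopFree i) (hj : DefPreproj.LoopFree j) :
    (DefPreproj.numArrows i j = 0 →
      ∃ h : DefPreproj.reflWeight i (DefPreproj.reflWeight j lam) =
          DefPreproj.reflWeight j (DefPreproj.reflWeight i lam),
        Nonempty
          (DefPreproj.reflC.{u, v, w} lam j hj ⋙
              DefPreproj.reflC.{u, v, w} (DefPreproj.reflWeight j lam) i hi ⋙
              DefPreproj.modCast.{u, v, w} h ≅
            DefPreproj.reflC.{u, v, w} lam i hi ⋙
              DefPreproj.reflC.{u, v, w} (DefPreproj.reflWeight i lam) j hj) ∧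
        Nonempty
          (DefPreproj.reflK.{u, v, w} lam j hj ⋙
              DefPreproj.reflK.{u, v, w} (DefPreproj.reflWeight j lam) i hi ⋙
              DefPreproj.modCast.{u, v, w} h ≅
            DefPreproj.reflK.{u, v, w} lam i hi ⋙
              DefPreproj.reflK.{u, v, w} (DefPreproj.reflWeight i lam) j hj)) ∧
    (DefPreproj.numArrows i j = 1 →
      ∃ h : DefPreproj.reflWeight i (DefPreproj.reflWeight j (DefPreproj.reflWeight i lam)) =
          DefPreproj.reflWeight j (DefPreproj.reflWeight i (DefPreproj.reflWeight j lam)),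
        Nonempty
          (DefPreproj.reflC.{u, v, w} lam i hi ⋙
              DefPreproj.reflC.{u, v, w} (DefPreproj.reflWeight i lam) j hj ⋙
              DefPreproj.reflC.{u, v, w}
                (DefPreproj.reflWeight j (DefPreproj.reflWeight i lam)) i hi ⋙
              DefPreproj.modCast.{u, v, w} h ≅
            DefPreproj.reflC.{u, v, w} lam j hj ⋙
              DefPreproj.reflC.{u, v, w} (DefPreproj.reflWeight j lam) i hi ⋙
              DefPreproj.reflC.{u, v, w}
                (DefPreproj.reflWeight i (DefPreproj.reflWeight j lam)) j hj) ∧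
        Nonempty
          (DefPreproj.reflK.{u, v, w} lam i hi ⋙
              DefPreproj.reflK.{u, v, w} (DefPreproj.reflWeight i lam) j hj ⋙
              DefPreproj.reflK.{u, v, w}
                (DefPreproj.reflWeight j (DefPreproj.reflWeight i lam)) i hi ⋙
              DefPreproj.modCast.{u, v, w} h ≅
            DefPreproj.reflK.{u, v, w} lam j hj ⋙
              DefPreproj.reflK.{u, v, w} (DefPreproj.reflWeight j lam) i hi ⋙
              DefPreproj.reflK.{u, v, w}
                (DefPreproj.reflWeight i (DefPreproj.reflWeight j lam)) j hj)) := by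
  refine ⟨fun h => ?_, fun h => ?_⟩
  · rcases eq_or_ne i j with rfl | hij
    -- A loop-free vertex has no arrows to itself, so i = j is allowed in this case; both composites
    -- then coincide.
    · exact ⟨rfl, ⟨Iso.refl _⟩, ⟨Iso.refl _⟩⟩
    · refine ⟨DefPreproj.reflWeight_comm hij h lam, ?_, ?_⟩
      · exact DefPreproj.nonempty_iso_conj_two _ _ _ _ _ (DefPreproj.inverseCompModCast _)
          (DefPreproj.Marking.nonempty_cFunctor_comm hi hj hij h _)
      · exact DefPreproj.nonempty_iso_conj_two _ _ _ _ _ (DefPreproj.inverseCompModCast _)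
          (DefPreproj.Marking.nonempty_kFunctor_comm hi hj hij h _)
  -- For i = j loop-freeness would make the number of arrows 0.
  · have hij : i ≠ j := by
      rintro rfl
      have : IsEmpty (i ⟶ i) := hi
      simp [DefPreproj.numArrows] at h
    obtain ⟨c, c', hc⟩ := DefPreproj.exists_isLink hi hj hij h
    refine ⟨DefPreproj.reflWeight_braid hi hj hij h lam, ?_, ?_⟩
    · exact DefPreproj.nonempty_iso_conj_three _ _ _ _ _ _ _ (DefPreproj.inverseCompModCast _)
        (DefPreproj.Marking.nonempty_cFunctor_braid hc _)
    · exact DefPreproj.nonempty_iso_conj_three _ _ _ _ _ _ _ (DefPreproj.inverseCompModCast _)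
        (DefPreproj.Marking.nonempty_kFunctor_braid hc _)
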